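/- Let $\mathcal A\in\{0,1\}^{n\times n}$ be the zero-nonzero pattern of the matrix of a linear system with states $x_1,\dots,x_n$. Its digraph has the edge $x_j\to x_i$ when $\mathcal A_{ij}=1$. The system is structurally cyclic if this digraph contains a family of pairwise disjoint directed cycles (self-loops allowed) spanning all states. A parent SCC is a strongly connected component without edges to states outside it. For $\mathcal H\in\{0,1\}^{m\times n}$ the pair $(\mathcal A,\mathcal H)$ is structurally observable if some observable pair $(A,H)$ of real matrices has exactly the zero-nonzero patterns $\mathcal A$ and $\mathcal H$. Let the system be structurally cyclic with exactly $m$ parent SCCs $SCC_1,\dots,SCC_m$, let there be $m$ sensors, and let $c\in\mathbb R^{m\times n}$, where $c_{ij}$ is the cost for sensor $i$ to measure state $x_j$. Consider the sensor selection problem $$\min_{\mathcal H}\ \sum_{i=1}^m\sum_{j=1}^n c_{ij}\mathcal H_{ij}\quad\text{s.t. } (\mathcal A,\mathcal H)\text{ structurally observable},\ \ \sum_{i}\mathcal H_{ij}\le 1\ \forall j,\ \ \sum_{j}\mathcal H_{ij}=1\ \forall i,\ \ \mathcal H_{ij}\in\{0,1\},\tag{1}$$ and, with $\mathcal C_{ij}=\min\{c_{il}: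 x_l\in SCC_j\}$ for $1\le i,j\le m$, the linear sum assignment problem $$\min_{\mathcal Z}\ \sum_{i=1}^m\sum_{j=1}^m \mathcal C_{ij}\mathcal Z_{ij}\quad\text{s.t. } \sum_j\mathcal Z_{ij}=1\ \forall i,\ \ \sum_i\mathcal Z_{ij}=1\ \forall j,\ \ \mathcal Z_{ij}\in\{0,1\}.\tag{2}$$ For $\mathcal H$ feasible in (1) let $\mathcal Z(\mathcal H)_{ij}=1$ if sensor $i$ measures a state of $SCC_j$, and $0$ otherwise. For $\mathcal Z$ feasible in (2), and any choice of states $x_{\sigma(i,j)}\in SCC_j$ with $c_{i\sigma(i,j)}=\mathcal C_{ij}$, let $\mathcal H_\sigma(\mathcal Z)$ be the selection in which sensor $i$ measures exactly the state $x_{\sigma(i,j)}$ for the $j$ with $\mathcal Z_{ij}=1$. Then the two problems are equivalent: 1. If $\mathcal H$ is feasible in (1), then $\mathcal Z(\mathcal H)$ is feasible in (2), and its cost is at most that of $\mathcal H$. 2. If $\mathcal Z$ is feasible in (2), then $\mathcal H_\sigma(\mathcal Z)$ is feasible in (1), has the same cost as $\mathcal Z$, and $\mathcal Z(\mathcal H_\sigma(\mathcal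 Z))=\mathcal Z$. 3. Both minima are attained and they are equal. 4. A selection $\mathcal H$ is optimal in (1) if and only if it is feasible in (1), $\mathcal Z(\mathcal H)$ is optimal in (2), and both have the same cost. A feasible $\mathcal Z$ is optimal in (2) if and only if $\mathcal H_\sigma(\mathcal Z)$ is optimal in (1). Moreover, on a random access machine with real registers (unit-cost addition, subtraction, comparison and array access), one fixed program computes, from $m$ and any $\mathcal C\in\mathbb R^{m\times m}$, an optimal solution of (2) in $O(m^3)$ steps, and one fixed program computes, from $n$, $m$, $\mathcal A$ and $c$ as above, an optimal solution of (1) in $O(n^2+m^3)$ steps. -/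

import Mathlib

namespace SensorSelection

/-! ### Structured systems and their digraphs -/

/-- All entries of the matrix are `0` or `1`. -/
def IsZeroOne {m n : ℕ} (M : Matrix (Fin m) (Fin n) ℕ) : Prop :=
  ∀ i j, M i j = 0 ∨ M i j = 1

/-- The real matrix `M` has the zero-nonzero pattern described by the 0-1 matrix `S`. -/
def HasPattern {m n : ℕ} (M : Matrix (Fin m) (Fin n) ℝ) (S : Matrix (Fin m) (Fin n) ℕ) : Prop :=
  ∀ i j, M i j ≠ 0 ↔ S i j = 1

/-- Edge relation on state nodes: the nonzero entry `A i j` is the edge `x_j → x_i`. -/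
def Edge {n : ℕ} (A : Matrix (Fin n) (Fin n) ℕ) (j i : Fin n) : Prop :=
  A i j = 1

/-- `y` can be reached from `x` along a directed path (possibly of length zero). -/
def Reach {n : ℕ} (A : Matrix (Fin n) (Fin n) ℕ) : Fin n → Fin n → Prop :=
  Relation.ReflTransGen (Edge A)

/-- The digraph contains a family of pairwise disjoint directed cycles (self-loops are cycles of
length one) that spans all state nodes. -/
def StructurallyCyclic {n : ℕ} (A : Matrix (Fin n) (Fin n) ℕ) : Prop :=
  ∃ F : Set (Cycle (Fin n)),
    (∀ s ∈ F, s ≠ Cycle.nil ∧ s.Nodup ∧ s.Chain (Edge A)) ∧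
    F.Pairwise (fun s t => ∀ x, x ∈ s → x ∉ t) ∧
    ∀ x : Fin n, ∃ s ∈ F, x ∈ s

/-- `S` is a strongly connected component: a class of mutually reachable states. -/
def IsSCC {n : ℕ} (A : Matrix (Fin n) (Fin n) ℕ) (S : Set (Fin n)) : Prop :=
  ∃ x, S = {y | Reach A x y ∧ Reach A y x}

/-- A parent SCC is an SCC without outgoing edges to states outside it. -/
def IsParentSCC {n : ℕ} (A : Matrix (Fin n) (Fin n) ℕ) (S : Set (Fin n)) : Prop :=
  IsSCC A S ∧ ∀ x ∈ S, ∀ y, y ∉ S → ¬ Edge A x y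

/-! ### Observability -/

/-- Observability of the pair `(A, H)`: the initial state is determined by the (noise-free)
outputs `H A ^ k x`, that is, the unobservable subspace is trivial. By the Kalman criterion this is
the same notion for continuous-time and for discrete-time linear systems. -/
def IsObservable {m n : ℕ} (A : Matrix (Fin n) (Fin n) ℝ) (H : Matrix (Fin m) (Fin n) ℝ) : Prop :=
  ∀ x : Fin n → ℝ, (∀ k : ℕ, H.mulVec ((A ^ k).mulVec x) = 0) → x = 0

/-- Structural observability of a pair of 0-1 patterns: some pair of real matrices with exactly
these zero-nonzero patterns is observable. -/
def StructurallyObservable {m n : ℕ} (A : Matrix (Fin n) (Fin n) ℕ)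
    (H : Matrix (Fin m) (Fin n) ℕ) : Prop :=
  ∃ (A' : Matrix (Fin n) (Fin n) ℝ) (H' : Matrix (Fin m) (Fin n) ℝ),
    HasPattern A' A ∧ HasPattern H' H ∧ IsObservable A' H'

/-! ### The two optimization problems -/

/-- The objective `∑ i, ∑ j, c i j * M i j`. -/
def totalCost {m n : ℕ} (c : Matrix (Fin m) (Fin n) ℝ) (M : Matrix (Fin m) (Fin n) ℕ) : ℝ :=
  ∑ i, ∑ j, c i j * (M i j : ℝ)

/-- Feasible sensor selections: `H i j = 1` means that sensor `i` measures state `j`. -/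
structure IsSelection {m n : ℕ} (A : Matrix (Fin n) (Fin n) ℕ)
    (H : Matrix (Fin m) (Fin n) ℕ) : Prop where
  zero_one : IsZeroOne H
  observable : StructurallyObservable A H
  col_sum : ∀ j, ∑ i, H i j ≤ 1
  row_sum : ∀ i, ∑ j, H i j = 1

/-- Feasible points of the linear sum assignment problem. -/
structure IsAssignment {m : ℕ} (Z : Matrix (Fin m) (Fin m) ℕ) : Prop where
  zero_one : IsZeroOne Z
  row_sum : ∀ i, ∑ j, Z i j = 1
  col_sum : ∀ j, ∑ i, Z i j = 1

/-- Solutions of the sensor selection problem with sensor-state costs `c`. -/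
def IsOptimalSelection {m n : ℕ} (A : Matrix (Fin n) (Fin n) ℕ) (c : Matrix (Fin m) (Fin n) ℝ)
    (H : Matrix (Fin m) (Fin n) ℕ) : Prop :=
  IsSelection A H ∧ ∀ H', IsSelection A H' → totalCost c H ≤ totalCost c H'

/-- Solutions of the linear sum assignment problem with cost matrix `C`. -/
def IsOptimalAssignment {m : ℕ} (C : Matrix (Fin m) (Fin m) ℝ)
    (Z : Matrix (Fin m) (Fin m) ℕ) : Prop :=
  IsAssignment Z ∧ ∀ Z', IsAssignment Z' → totalCost C Z ≤ totalCost C Z'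

/-- An enumeration of all parent SCCs by `Fin m` (so there are exactly `m` of them). -/
abbrev ParentEnum {n : ℕ} (A : Matrix (Fin n) (Fin n) ℕ) (m : ℕ) : Type :=
  Fin m ≃ {S : Set (Fin n) // IsParentSCC A S}

/-- The SCC-sensor cost matrix: `C i j` is the minimum of `c i l` over the states `l` of the
`j`-th parent SCC (a finite nonempty set, so the infimum is attained). -/
noncomputable def sccCost {m n : ℕ} {A : Matrix (Fin n) (Fin n) ℕ}
    (c : Matrix (Fin m) (Fin n) ℝ) (P : ParentEnum A m) : Matrix (Fin m) (Fin m) ℝ :=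
  fun i j => sInf (c i '' (P j).1)

theorem sccCost_isLeast {m n : ℕ} {A : Matrix (Fin n) (Fin n) ℕ}
    (c : Matrix (Fin m) (Fin n) ℝ) (P : ParentEnum A m) (i j : Fin m) :
    IsLeast (c i '' (P j).1) (sccCost c P i j) := by
  have hne : (P j).1.Nonempty := by
    obtain ⟨x, hx⟩ := (P j).2.1
    exact ⟨x, by rw [hx]; exact ⟨Relation.ReflTransGen.refl, Relation.ReflTransGen.refl⟩⟩
  have hfin : (c i '' (P j).1).Finite := (Set.toFinite _).image _
  exact ⟨(hne.image _).csInf_mem hfin, fun y hy => csInf_le hfin.bddBelow hy⟩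

open Classical in
/-- The assignment of sensors to parent SCCs induced by a sensor selection: sensor `i` is assigned
to the `j`-th parent SCC when it measures one of its states. -/
noncomputable def assignmentOf {m n : ℕ} {A : Matrix (Fin n) (Fin n) ℕ} (P : ParentEnum A m)
    (H : Matrix (Fin m) (Fin n) ℕ) : Matrix (Fin m) (Fin m) ℕ :=
  fun i j => if ∃ l ∈ (P j).1, H i l = 1 then 1 else 0

/-- `σ i j` is a state of the `j`-th parent SCC which sensor `i` measures at minimum cost. -/
def IsCheapest {m n : ℕ} {A : Matrix (Fin n) (Fin n) ℕ} (c : Matrix (Fin m) (Fin n) ℝ)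
    (P : ParentEnum A m) (σ : Fin m → Fin m → Fin n) : Prop :=
  ∀ i j, σ i j ∈ (P j).1 ∧ ∀ l ∈ (P j).1, c i (σ i j) ≤ c i l

open Classical in
/-- The sensor selection induced by an assignment: if sensor `i` is assigned to the `j`-th parent
SCC, it measures the state `σ i j`. -/
noncomputable def selectionOf {m n : ℕ} (σ : Fin m → Fin m → Fin n)
    (Z : Matrix (Fin m) (Fin m) ℕ) : Matrix (Fin m) (Fin n) ℕ :=
  fun i l => if ∃ j, Z i j = 1 ∧ σ i j = l then 1 else 0

/-! ### Running time: a random access machine with real registers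

The machine has registers and two-dimensional arrays of natural numbers (used as indices) and of
real numbers. A program is a finite text that does not depend on the input. Each elementary
instruction and each evaluation of a test is one step. The only arithmetic is addition and
subtraction (truncated on natural numbers), and the only tests are comparisons. -/

/-- Machine configurations. The arrays are given by name, row and column. -/
structure State where
  natReg : ℕ → ℕ
  realReg : ℕ → ℝ
  natArr : ℕ → ℕ → ℕ → ℕ
  realArr : ℕ → ℕ → ℕ → ℝ

/-- The array memory `f` with the entry `(b, i, j)` replaced by `v`. -/
def setEntry {α : Type} (f : ℕ → ℕ → ℕ → α) (b i j : ℕ) (v : α) : ℕ → ℕ → ℕ → α :=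
  fun b' i' j' => if b' = b ∧ i' = i ∧ j' = j then v else f b' i' j'

/-- Elementary instructions. -/
inductive Instr : Type
  | natConst (x k : ℕ)
  | natAdd (x y z : ℕ)
  | natSub (x y z : ℕ)
  | natLoad (x b y z : ℕ)
  | natStore (b y z x : ℕ)
  | realAdd (x y z : ℕ)
  | realSub (x y z : ℕ)
  | realLoad (x b y z : ℕ)
  | realStore (b y z x : ℕ)

/-- Effect of an elementary instruction. In loads and stores, `b` is the name of an array and the
natural-number registers `y` and `z` hold the row and the column. -/
noncomputable def Instr.apply : Instr → State → State
  | .natConst x k, s => { s with natReg := Function.update s.natReg x k }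
  | .natAdd x y z, s => { s with natReg := Function.update s.natReg x (s.natReg y + s.natReg z) }
  | .natSub x y z, s => { s with natReg := Function.update s.natReg x (s.natReg y - s.natReg z) }
  | .natLoad x b y z, s =>
      { s with natReg := Function.update s.natReg x (s.natArr b (s.natReg y) (s.natReg z)) }
  | .natStore b y z x, s =>
      { s with natArr := setEntry s.natArr b (s.natReg y) (s.natReg z) (s.natReg x) }
  | .realAdd x y z, s =>
      { s with realReg := Function.update s.realReg x (s.realReg y + s.realReg z) }
  | .realSub x y z, s =>
      { s with realReg := Function.update s.realReg x (s.realReg y - s.realReg z) }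
  | .realLoad x b y z, s =>
      { s with realReg := Function.update s.realReg x (s.realArr b (s.natReg y) (s.natReg z)) }
  | .realStore b y z x, s =>
      { s with realArr := setEntry s.realArr b (s.natReg y) (s.natReg z) (s.realReg x) }

/-- Tests: comparison of two registers. -/
inductive Test : Type
  | natLt (x y : ℕ)
  | realLt (x y : ℕ)

/-- The outcome of a test. -/
def Test.Holds : Test → State → Prop
  | .natLt x y, s => s.natReg x < s.natReg y
  | .realLt x y, s => s.realReg x < s.realReg y

/-- Programs. -/
inductive Program : Type
  | instr (a : Instr)
  | seq (p q : Program)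
  | ite (b : Test) (p q : Program)
  | loop (b : Test) (p : Program)

/-- `Exec p s t s'`: started in `s`, the program `p` halts after exactly `t` steps in `s'`. The
program `loop b p` repeats `p` as long as the test `b` holds. -/
inductive Exec : Program → State → ℕ → State → Prop
  | instr (a : Instr) (s : State) : Exec (.instr a) s 1 (a.apply s)
  | seq {p q : Program} {s s' s'' : State} {t t' : ℕ} :
      Exec p s t s' → Exec q s' t' s'' → Exec (.seq p q) s (t + t') s''
  | ite_true {b : Test} {p q : Program} {s s' : State} {t : ℕ} :
      b.Holds s → Exec p s t s' → Exec (.ite b p q) s (1 + t) s'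
  | ite_false {b : Test} {p q : Program} {s s' : State} {t : ℕ} :
      ¬ b.Holds s → Exec q s t s' → Exec (.ite b p q) s (1 + t) s'
  | loop_true {b : Test} {p : Program} {s s' s'' : State} {t t' : ℕ} :
      b.Holds s → Exec p s t s' → Exec (.loop b p) s' t' s'' → Exec (.loop b p) s (1 + t + t') s''
  | loop_false {b : Test} {p : Program} {s : State} :
      ¬ b.Holds s → Exec (.loop b p) s 1 s

/-- The matrix `M`, extended by zero, as the array named `0`; all other arrays are zero. -/
def arrayOf {α : Type} [Zero α] {m n : ℕ} (M : Matrix (Fin m) (Fin n) α) : ℕ → ℕ → ℕ → α :=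
  fun b i j => if h : b = 0 ∧ i < m ∧ j < n then M ⟨i, h.2.1⟩ ⟨j, h.2.2⟩ else 0

/-- Start configuration for the assignment problem: `m` in register `0` and the cost matrix `C` in
the real array `0`; all else is zero. -/
def assignmentInput {m : ℕ} (C : Matrix (Fin m) (Fin m) ℝ) : State where
  natReg := Function.update 0 0 m
  realReg := 0
  natArr := 0
  realArr := arrayOf C

/-- Start configuration for the sensor selection problem: `m` and `n` in the registers `0` and `1`,
the system pattern `A` in the natural-number array `0` and the sensor-state costs `c` in the real
array `0`; all else is zero. -/
def selectionInput {m n : ℕ} (A : Matrix (Fin n) (Fin n) ℕ) (c : Matrix (Fin m) (Fin n) ℝ) :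
    State where
  natReg := Function.update (Function.update 0 0 m) 1 n
  realReg := 0
  natArr := arrayOf A
  realArr := arrayOf c

/-- The output of a run, read off as an `m × n` matrix from the natural-number array `1`. -/
def output (m n : ℕ) (s : State) : Matrix (Fin m) (Fin n) ℕ :=
  fun i j => s.natArr 1 i j

end SensorSelection

/-!
The proof has a system-theoretic part and an algorithmic part.

*Structural observability.* A selection has one measured state per sensor. If a parent strongly
connected component is not measured, then the states supported on it are never observed, since no
edge leaves it. Conversely, suppose that all parent components are measured. The spanning cycle
family is a permutation of the states. Give the cycles distinct positive weights, and add one edge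
from each unmeasured cycle to a cycle that is closer to the measured ones. For this matrix, an
eigenvector has no zero entry on a chain of cycles that ends in a measured cycle
(`exists_cycle_ne_zero`), because the eigenvalues of different cycles have different moduli. By the
Hautus test the pair is observable, and as observability is an open condition the remaining entries
of the pattern can be made nonzero (`exists_hasPattern_isObservable`). Hence feasible selections are
those where the sensors measure states in the parent components according to a permutation
(`isSelection_iff`), and the equivalence of the two problems is a comparison of sums.

*Running time.* `Runs` is a program logic with time bounds for the random access machine. The
assignment problem is solved by the Hungarian algorithm: for each row, Dijkstra's algorithm with
reduced costs finds a shortest augmenting path (`SearchTree`), the column potentials are updated,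
and the matching is changed along the path (`Augmenting`). Row potentials need not be stored, since
they are the reduced costs of the matched entries. The invariant says that each matched entry has
the least reduced cost of its row, which proves optimality at the end
(`isOptimalAssignment_of_potential`). Each of the `m` rows takes `O(m ^ 2)` steps.

The parent components are found by three graph searches, with `O(n ^ 2)` steps each. A backward
search from all states has a root in each parent component; a second backward search from these
roots, in reversed order, has roots in parent components only; and a forward search from the latter
labels exactly the parent components (`exists_parentEnum`). It remains to compute the cheapest
states, to solve the assignment problem and to write the selection.
-/

namespace SensorSelection

/-! ### Zero-one matrices with one nonzero entry in each row -/

/-- The zero-one matrix whose nonzero entry in the row `i` is in the column `f i`. -/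
def indicator {m n : ℕ} (f : Fin m → Fin n) : Matrix (Fin m) (Fin n) ℕ :=
  fun i l => if f i = l then 1 else 0

theorem indicator_eq_one {m n : ℕ} {f : Fin m → Fin n} {i : Fin m} {l : Fin n} :
    indicator f i l = 1 ↔ f i = l := by
  simp [indicator]

theorem isZeroOne_indicator {m n : ℕ} (f : Fin m → Fin n) : IsZeroOne (indicator f) := by
  intro i j
  unfold indicator
  split_ifs <;> simp

theorem indicator_row_sum {m n : ℕ} (f : Fin m → Fin n) (i : Fin m) :
    ∑ j, indicator f i j = 1 := by
  simp [indicator]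

theorem totalCost_indicator {m n : ℕ} (c : Matrix (Fin m) (Fin n) ℝ) (f : Fin m → Fin n) :
    totalCost c (indicator f) = ∑ i, c i (f i) := by
  simp [totalCost, indicator]

theorem exists_eq_indicator {m n : ℕ} {M : Matrix (Fin m) (Fin n) ℕ} (h01 : IsZeroOne M)
    (hrow : ∀ i, ∑ j, M i j = 1) : ∃ f, M = indicator f := by
  have h1 : ∀ i, ∃ j, M i j = 1 := by
    intro i
    by_contra! hne
    have : ∑ j, M i j = 0 := Finset.sum_eq_zero fun j _ => (h01 i j).resolve_right (hne j)
    rw [hrow i] at this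
    omega
  choose f hf using h1
  refine ⟨f, ?_⟩
  ext i j
  unfold indicator
  split_ifs with e
  · rw [← e, hf]
  · refine (h01 i j).resolve_right fun h => ?_
    have h2 : ∑ l ∈ {f i, j}, M i l ≤ ∑ l, M i l :=
      Finset.sum_le_sum_of_subset (Finset.subset_univ _)
    rw [Finset.sum_pair e, hf, h, hrow] at h2
    omega

theorem indicator_col_sum_le {m n : ℕ} {f : Fin m → Fin n} :
    (∀ j, ∑ i, indicator f i j ≤ 1) ↔ Function.Injective f := by
  have h : ∀ j, ∑ i, indicator f i j = (Finset.univ.filter (f · = j)).card := by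
    intro j
    simp [indicator]
  simp only [h, Finset.card_le_one, Finset.mem_filter, Finset.mem_univ, true_and]
  exact ⟨fun H a b hab => H (f b) a hab b rfl, fun H j a ha b hb => H (ha.trans hb.symm)⟩

/-- The feasible points of the assignment problem are the permutation matrices. -/
theorem isAssignment_iff {m : ℕ} {Z : Matrix (Fin m) (Fin m) ℕ} :
    IsAssignment Z ↔ ∃ τ : Equiv.Perm (Fin m), Z = indicator τ := by
  constructor
  · rintro ⟨h01, hrow, hcol⟩
    obtain ⟨f, rfl⟩ := exists_eq_indicator h01 hrow
    have hf := indicator_col_sum_le.1 fun j => (hcol j).le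
    exact ⟨Equiv.ofBijective f (Finite.injective_iff_bijective.1 hf), rfl⟩
  · rintro ⟨τ, rfl⟩
    refine ⟨isZeroOne_indicator _, indicator_row_sum _, fun j => ?_⟩
    simp [indicator, ← Equiv.eq_symm_apply]

/-- Linear programming duality for the assignment problem: a permutation matrix is optimal when
each of its entries has the least reduced cost of its row. -/
theorem isOptimalAssignment_of_potential {m : ℕ} {C : Matrix (Fin m) (Fin m) ℝ}
    (τ : Equiv.Perm (Fin m)) (v : Fin m → ℝ) (h : ∀ i j, C i (τ i) - v (τ i) ≤ C i j - v j) :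
    IsOptimalAssignment C (indicator τ) := by
  refine ⟨isAssignment_iff.2 ⟨τ, rfl⟩, fun Z' hZ' => ?_⟩
  obtain ⟨τ', rfl⟩ := isAssignment_iff.1 hZ'
  rw [totalCost_indicator, totalCost_indicator]
  have h1 : ∑ i, (C i (τ i) - v (τ i)) ≤ ∑ i, (C i (τ' i) - v (τ' i)) :=
    Finset.sum_le_sum fun i _ => h i _
  rw [Finset.sum_sub_distrib, Finset.sum_sub_distrib, Equiv.sum_comp τ v, Equiv.sum_comp τ' v] at h1
  linarith

/-! ### Parent strongly connected components -/

section
variable {n : ℕ} {A : Matrix (Fin n) (Fin n) ℕ} {S T : Set (Fin n)} {x y : Fin n}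

theorem IsParentSCC.nonempty (h : IsParentSCC A S) : S.Nonempty := by
  obtain ⟨x, rfl⟩ := h.1
  exact ⟨x, .refl, .refl⟩

theorem IsParentSCC.reach (h : IsParentSCC A S) (hx : x ∈ S) (hy : y ∈ S) : Reach A x y := by
  obtain ⟨z, rfl⟩ := h.1
  exact hx.2.trans hy.1

theorem IsParentSCC.mem_of_reach (h : IsParentSCC A S) (hx : x ∈ S) (hxy : Reach A x y) :
    y ∈ S := by
  induction hxy with
  | refl => exact hx
  | tail _ he ih =>
    by_contra hne
    exact h.2 _ ih _ hne he

theorem IsParentSCC.eq_of_mem (hS : IsParentSCC A S) (hT : IsParentSCC A T) (hxS : x ∈ S)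
    (hxT : x ∈ T) : S = T :=
  Set.Subset.antisymm (fun _ hy => hT.mem_of_reach hxT (hS.reach hxS hy))
    fun _ hy => hS.mem_of_reach hxS (hT.reach hxT hy)

/-- From each state a parent SCC can be reached: the component of a reachable state from which as
few states as possible can be reached. -/
theorem exists_isParentSCC_reach (A : Matrix (Fin n) (Fin n) ℕ) (x : Fin n) :
    ∃ S, IsParentSCC A S ∧ ∃ y ∈ S, Reach A x y := by
  classical
  let R : Fin n → Finset (Fin n) := fun y => Finset.univ.filter (Reach A y)
  obtain ⟨y, hy, hmin⟩ := (R x).exists_min_image (fun y => (R y).card)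
    ⟨x, by simp only [R, Finset.mem_filter, Finset.mem_univ, true_and]; exact .refl⟩
  have hxy : Reach A x y := by simpa [R] using hy
  have hback : ∀ z, Reach A y z → Reach A z y := by
    intro z hz
    have hsub : R z ⊆ R y := by
      intro w hw
      simp only [R, Finset.mem_filter, Finset.mem_univ, true_and] at hw ⊢
      exact hz.trans hw
    have heq := Finset.eq_of_subset_of_card_le hsub
      (hmin z (by simp only [R, Finset.mem_filter, Finset.mem_univ, true_and]; exact hxy.trans hz))
    have : y ∈ R z := by
      rw [heq]
      simp only [R, Finset.mem_filter, Finset.mem_univ, true_and]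
      exact .refl
    simpa [R] using this
  refine ⟨{z | Reach A y z ∧ Reach A z y}, ⟨⟨y, rfl⟩, ?_⟩, y, ⟨.refl, .refl⟩, hxy⟩
  intro z hz w hw he
  have : Reach A y w := hz.1.tail he
  exact hw ⟨this, hback w this⟩

end

/-- A state lies in at most one of the enumerated parent SCCs. -/
theorem ParentEnum.index_eq {n m : ℕ} {A : Matrix (Fin n) (Fin n) ℕ} (P : ParentEnum A m)
    {j j' : Fin m} {x : Fin n} (h : x ∈ (P j).1) (h' : x ∈ (P j').1) : j = j' :=
  P.injective (Subtype.ext ((P j).2.eq_of_mem (P j').2 h h'))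

/-! ### Structural observability -/

theorem chain_next {α : Type*} [DecidableEq α] {r : α → α → Prop} {s : Cycle α} (hs : s.Nodup)
    (hc : s.Chain r) {x : α} (hx : x ∈ s) : r x (s.next hs x hx) := by
  induction s using Quotient.inductionOn' with
  | h l =>
    have hl : l.Nodup := hs
    have hxl : x ∈ l := hx
    show r x (l.next x hxl)
    cases l with
    | nil => simp at hxl
    | cons a l =>
      have hc' : List.IsChain r (a :: (l ++ [a])) := (Cycle.chain_coe_cons r a l).1 hc
      obtain ⟨i, hi, rfl⟩ := List.getElem_of_mem hxl
      rw [List.next_getElem _ hl i hi]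
      have hlen : (a :: l).length = l.length + 1 := rfl
      have h1 := List.isChain_iff_getElem.1 hc' i (by simp at hi ⊢; omega)
      have e1 : (a :: (l ++ [a]))[i]'(by simp at hi ⊢; omega) = (a :: l)[i] := by
        simp only [← List.cons_append]
        exact List.getElem_append_left hi
      rw [e1] at h1
      by_cases hlast : i = l.length
      · subst hlast
        simpa using h1
      · have e2 : (a :: (l ++ [a]))[i + 1]'(by simp at hi ⊢; omega)
            = (a :: l)[(i + 1) % (a :: l).length]'(Nat.mod_lt _ (by simp)) := by
          simp only [← List.cons_append]
          rw [List.getElem_append_left (by simp at hi ⊢; omega)]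
          congr 1
          rw [Nat.mod_eq_of_lt (by simp at hi ⊢; omega)]
        rwa [e2] at h1

/-- In a structurally cyclic system there is a permutation of the states that follows edges. -/
theorem StructurallyCyclic.exists_perm {n : ℕ} {A : Matrix (Fin n) (Fin n) ℕ}
    (h : StructurallyCyclic A) : ∃ π : Equiv.Perm (Fin n), ∀ x, Edge A x (π x) := by
  obtain ⟨F, hF, hdisj, hcov⟩ := h
  choose c hcF hxc using hcov
  let f : Fin n → Fin n := fun x => (c x).next (hF _ (hcF x)).2.1 x (hxc x)
  have hfc : ∀ x, f x ∈ c x := fun x => Cycle.next_mem _ _ _ _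
  have huniq : ∀ x y, x ∈ c y → c x = c y := by
    intro x y hxy
    by_contra hne
    exact hdisj (hcF x) (hcF y) hne x (hxc x) hxy
  have hinj : Function.Injective f := by
    intro x y hxy
    have e : c x = c y := by
      rw [← huniq _ _ (hfc x), hxy, huniq _ _ (hfc y)]
    have h1 := Cycle.prev_next (c x) (hF _ (hcF x)).2.1 x (hxc x)
    have h2 := Cycle.prev_next (c y) (hF _ (hcF y)).2.1 y (hxc y)
    rw [← h1, ← h2]
    congr 1
  refine ⟨Equiv.ofBijective f (Finite.injective_iff_bijective.1 hinj), fun x => ?_⟩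
  exact chain_next _ (hF _ (hcF x)).2.2 _

/-- A complex Hautus test: a real pair is observable if the outputs vanish on no complex eigenvector
of the state matrix. -/
theorem isObservable_of_eigenvectors {m n : ℕ} {A : Matrix (Fin n) (Fin n) ℝ}
    {H : Matrix (Fin m) (Fin n) ℝ}
    (h : ∀ (μ : ℂ) (v : Fin n → ℂ), v ≠ 0 → (A.map Complex.ofRealHom).mulVec v = μ • v →
      (H.map Complex.ofRealHom).mulVec v ≠ 0) : IsObservable A H := by
  intro x hx
  by_contra hne
  set Ac := A.map Complex.ofRealHom with hAc
  set Hc := H.map Complex.ofRealHom with hHc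
  let U : Submodule ℂ (Fin n → ℂ) := ⨅ k : ℕ, LinearMap.ker (Hc * Ac ^ k).mulVecLin
  have hU : ∀ v, v ∈ U ↔ ∀ k : ℕ, (Hc * Ac ^ k).mulVec v = 0 := by
    intro v
    simp [U, Submodule.mem_iInf]
  have hxU : (Complex.ofRealHom ∘ x) ∈ U := by
    rw [hU]
    intro k
    have e : Hc * Ac ^ k = (H * A ^ k).map Complex.ofRealHom := by
      rw [Matrix.map_mul, hHc, hAc]
      congr 1
      exact (map_pow (Complex.ofRealHom.mapMatrix) A k).symm
    rw [e]
    ext i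
    have := RingHom.map_mulVec Complex.ofRealHom (H * A ^ k) x i
    rw [← this, ← Matrix.mulVec_mulVec, hx k]
    simp
  have hinv : ∀ v ∈ U, Ac.mulVecLin v ∈ U := by
    intro v hv
    rw [hU] at hv ⊢
    intro k
    rw [Matrix.mulVecLin_apply, Matrix.mulVec_mulVec, Matrix.mul_assoc, ← pow_succ]
    exact hv (k + 1)
  have hnt : Nontrivial U := by
    refine ⟨⟨⟨_, hxU⟩, 0, fun e => hne ?_⟩⟩
    have e1 := congrArg Subtype.val e
    funext i
    have := congrFun e1 i
    simpa using this
  obtain ⟨μ, hμ⟩ := Module.End.exists_eigenvalue (Ac.mulVecLin.restrict hinv)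
  obtain ⟨w, hw⟩ := hμ.exists_hasEigenvector
  have hw0 : (w : Fin n → ℂ) ≠ 0 := fun e => hw.2 (Subtype.ext e)
  have hw1 : Ac.mulVec w = μ • (w : Fin n → ℂ) := by
    have := congrArg Subtype.val hw.apply_eq_smul
    simpa using this
  refine h μ w hw0 hw1 ?_
  have := (hU w).1 w.2 0
  simpa using this

/-- By the Cayley-Hamilton theorem, the outputs at the first `n` times determine the others. -/
theorem isObservable_iff_lt {m n : ℕ} {A : Matrix (Fin n) (Fin n) ℝ}
    {H : Matrix (Fin m) (Fin n) ℝ} :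
    IsObservable A H ↔
      ∀ x : Fin n → ℝ, (∀ k : Fin n, (H * A ^ (k : ℕ)).mulVec x = 0) → x = 0 := by
  constructor
  swap
  · intro h x hx
    refine h x fun k => ?_
    rw [← Matrix.mulVec_mulVec]
    exact hx k
  intro h x hx
  refine h x fun k => ?_
  rcases Nat.eq_zero_or_pos n with rfl | hn
  · have : (A ^ k).mulVec x = 0 := Subsingleton.elim _ _
    rw [this, Matrix.mulVec_zero]
  rw [Matrix.mulVec_mulVec, Matrix.pow_eq_aeval_mod_charpoly]
  have hmonic := Matrix.charpoly_monic A
  have hdeg : ((Polynomial.X ^ k : Polynomial ℝ) %ₘ A.charpoly).natDegree < n := by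
    have h1 := Polynomial.natDegree_modByMonic_lt (Polynomial.X ^ k : Polynomial ℝ) hmonic (by
      intro e
      have := Matrix.charpoly_natDegree_eq_dim A
      rw [e] at this
      simp at this
      omega)
    simpa [Matrix.charpoly_natDegree_eq_dim] using h1
  rw [Polynomial.aeval_eq_sum_range' hdeg, Matrix.mul_sum, Matrix.sum_mulVec]
  refine Finset.sum_eq_zero fun j hj => ?_
  rw [Matrix.mul_smul, Matrix.smul_mulVec, hx ⟨j, Finset.mem_range.1 hj⟩, smul_zero]

/-- The observability matrix, with its rows indexed by time and output. -/
def observabilityMatrix {m n : ℕ} (A : Matrix (Fin n) (Fin n) ℝ) (H : Matrix (Fin m) (Fin n) ℝ) :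
    Matrix (Fin n × Fin m) (Fin n) ℝ :=
  fun p j => (H * A ^ (p.1 : ℕ)) p.2 j

theorem isObservable_iff_det {m n : ℕ} {A : Matrix (Fin n) (Fin n) ℝ}
    {H : Matrix (Fin m) (Fin n) ℝ} :
    IsObservable A H ↔
      ((observabilityMatrix A H).transpose * observabilityMatrix A H).det ≠ 0 := by
  have hO : ∀ x : Fin n → ℝ, (observabilityMatrix A H).mulVec x = 0 ↔
      ∀ k : Fin n, (H * A ^ (k : ℕ)).mulVec x = 0 := by
    intro x
    constructor
    · intro h k
      funext i
      exact congrFun h (k, i)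
    · intro h
      funext p
      exact congrFun (h p.1) p.2
  have hG : ∀ x : Fin n → ℝ,
      ((observabilityMatrix A H).transpose * observabilityMatrix A H).mulVec x = 0 ↔
      (observabilityMatrix A H).mulVec x = 0 := by
    intro x
    rw [← Matrix.conjTranspose_eq_transpose_of_trivial]
    exact Matrix.conjTranspose_mul_self_mulVec_eq_zero _ x
  rw [isObservable_iff_lt, ne_eq, ← Matrix.exists_mulVec_eq_zero_iff]
  simp only [hG, hO]
  constructor
  · rintro h ⟨v, hv, hv'⟩
    exact hv (h v hv')
  · intro h x hx
    by_contra hne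
    exact h ⟨x, hne, hx⟩

/-- Observability is an open condition. Hence an observable pair whose state matrix vanishes
outside a pattern can be perturbed to an observable pair with exactly this pattern. -/
theorem exists_hasPattern_isObservable {m n : ℕ} {S : Matrix (Fin n) (Fin n) ℕ}
    {A : Matrix (Fin n) (Fin n) ℝ} {H : Matrix (Fin m) (Fin n) ℝ}
    (hA : ∀ i j, A i j ≠ 0 → S i j = 1) (h : IsObservable A H) :
    ∃ A', HasPattern A' S ∧ IsObservable A' H := by
  classical
  let B : Matrix (Fin n) (Fin n) ℝ := fun i j => if S i j = 1 then 1 else 0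
  let g : ℝ → ℝ := fun ε =>
    ((observabilityMatrix (A + ε • B) H).transpose * observabilityMatrix (A + ε • B) H).det
  have hcont : Continuous g := by
    have hAB : Continuous fun ε : ℝ => A + ε • B := by fun_prop
    have hO : Continuous fun ε : ℝ => observabilityMatrix (A + ε • B) H := by
      refine continuous_matrix fun p j => ?_
      have : Continuous fun ε : ℝ => H * (A + ε • B) ^ (p.1 : ℕ) :=
        continuous_const.matrix_mul (hAB.pow _)
      exact this.matrix_elem p.2 j
    exact (hO.matrix_transpose.matrix_mul hO).matrix_det
  have hg0 : g 0 ≠ 0 := by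
    simpa [g] using isObservable_iff_det.1 h
  have hev : ∀ᶠ ε in nhdsWithin (0 : ℝ) {0}ᶜ, g ε ≠ 0 :=
    (hcont.continuousAt.eventually_ne hg0).filter_mono nhdsWithin_le_nhds
  have hev' : ∀ᶠ ε in nhdsWithin (0 : ℝ) {0}ᶜ, ∀ i j, A i j + ε ≠ 0 := by
    refine Filter.eventually_all.2 fun i => Filter.eventually_all.2 fun j => ?_
    by_cases hz : A i j = 0
    · filter_upwards [self_mem_nhdsWithin] with ε hε
      simpa [hz] using hε
    · have hc : Continuous fun ε : ℝ => A i j + ε := by fun_prop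
      exact (hc.continuousAt.eventually_ne (by simpa using hz)).filter_mono nhdsWithin_le_nhds
  obtain ⟨ε, h1, h2⟩ := (hev.and hev').exists
  refine ⟨A + ε • B, fun i j => ?_, isObservable_iff_det.2 h1⟩
  have e : (A + ε • B) i j = A i j + ε * B i j := rfl
  rw [e]
  by_cases hS : S i j = 1
  · simpa [B, hS] using h2 i j
  · have : A i j = 0 := by
      by_contra hne
      exact hS (hA i j hne)
    simp [B, hS, this]

/-- If a set `M` can be reached from everywhere, then outside `M` there is a step to a vertex that is
closer to `M`. -/
theorem exists_descent {Q : Type*} (r : Q → Q → Prop) (M : Set Q)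
    (h : ∀ c, ∃ e ∈ M, Relation.ReflTransGen r c e) :
    ∃ (f : Q → Q) (d : Q → ℕ), ∀ c, c ∉ M → r c (f c) ∧ d (f c) < d c := by
  classical
  let L : ℕ → Q → Prop := fun k =>
    Nat.rec (motive := fun _ => Q → Prop) (· ∈ M) (fun _ P c => ∃ c', r c c' ∧ P c') k
  have hL : ∀ c, ∃ k, L k c := by
    intro c
    obtain ⟨e, he, hc⟩ := h c
    induction hc using Relation.ReflTransGen.head_induction_on with
    | refl => exact ⟨0, he⟩
    | head hr _ ih =>
      obtain ⟨k, hk⟩ := ih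
      exact ⟨k + 1, _, hr, hk⟩
  have hmin : ∀ c, ∃ k, L k c ∧ ∀ k', L k' c → k ≤ k' := fun c =>
    ⟨Nat.find (hL c), Nat.find_spec (hL c), fun _ => Nat.find_min' (hL c)⟩
  choose d hd hmin using hmin
  have hstep : ∀ c, ∃ c', c ∉ M → r c c' ∧ d c' < d c := by
    intro c
    by_cases hc : c ∈ M
    · exact ⟨c, fun h => absurd hc h⟩
    · have h1 := hd c
      cases hk : d c with
      | zero =>
        rw [hk] at h1
        exact absurd h1 hc
      | succ k =>
        rw [hk] at h1
        obtain ⟨c', hr, hc'⟩ := h1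
        exact ⟨c', fun _ => ⟨hr, Nat.lt_succ_of_le (hmin c' k hc')⟩⟩
  choose f hf using hstep
  exact ⟨f, d, hf⟩

section
variable {n : ℕ} {Q : Type*} {π : Equiv.Perm (Fin n)} {q : Fin n → Q} {ρ : Q → ℝ} {μ : ℂ}
  {v : Fin n → ℂ}

/-- On a cycle of weight `ρ c` that is fed by no other cycle, only eigenvalues of modulus `ρ c` are
possible. -/
theorem norm_eq_of_cycle (hq : ∀ x, q (π x) = q x) {c : Q} (hρ : 0 < ρ c)
    (h : ∀ y, q y = c → μ * v y = ρ c * v (π.symm y)) {x : Fin n} (hx : q x = c) (hvx : v x ≠ 0) :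
    ‖μ‖ = ρ c := by
  classical
  have hq' : ∀ y, q (π.symm y) = q y := fun y => by rw [← hq (π.symm y), π.apply_symm_apply]
  set s := Finset.univ.filter fun y => q y = c with hs
  have h1 : ∑ y ∈ s, ‖v (π.symm y)‖ = ∑ y ∈ s, ‖v y‖ := by
    refine Finset.sum_equiv π.symm (fun y => ?_) fun y _ => rfl
    simp [hs, hq']
  have h2 : ‖μ‖ * ∑ y ∈ s, ‖v y‖ = ρ c * ∑ y ∈ s, ‖v y‖ := by
    rw [Finset.mul_sum, ← h1, Finset.mul_sum]
    refine Finset.sum_congr rfl fun y hy => ?_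
    have e := congrArg norm (h y (by simpa [hs] using hy))
    rwa [norm_mul, norm_mul, Complex.norm_real, Real.norm_of_nonneg hρ.le] at e
  have h3 : 0 < ∑ y ∈ s, ‖v y‖ :=
    Finset.sum_pos' (fun _ _ => norm_nonneg _) ⟨x, by simp [hs, hx], norm_pos_iff.2 hvx⟩
  exact mul_right_cancel₀ h3.ne' h2

/-- The entries of an eigenvector vanish on a whole cycle if they vanish at one state that is
followed by unfed states only. -/
theorem eq_zero_of_cycle (hμ : μ ≠ 0) {c : Q} (hq : ∀ x, q (π x) = q x)
    (htrans : ∀ x y, q x = q y → ∃ k : ℕ, (π ^ k) x = y) {e : Fin n} (he : q e = c)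
    (h : ∀ y, q y = c → y ≠ e → μ * v y = ρ c * v (π.symm y)) (hve : v e = 0) {x : Fin n}
    (hx : q x = c) : v x = 0 := by
  obtain ⟨k, rfl⟩ := htrans e x (he.trans hx.symm)
  clear hx
  induction k with
  | zero => simpa using hve
  | succ k ih =>
    have hqk : ∀ j : ℕ, q ((π ^ j) e) = c := by
      intro j
      induction j with
      | zero => simpa using he
      | succ j ihj => rw [pow_succ', Equiv.Perm.mul_apply, hq, ihj]
    by_cases hk : (π ^ (k + 1)) e = e
    · rw [hk, hve]
    · have h1 := h _ (hqk (k + 1)) hk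
      rw [pow_succ', Equiv.Perm.mul_apply, π.symm_apply_apply, ih, mul_zero] at h1
      rw [pow_succ', Equiv.Perm.mul_apply]
      exact (mul_eq_zero.1 h1).resolve_left hμ

open Classical in
/-- The weighted cycles are joined by one edge from the state `ex c` of each cycle `c ∉ M` to the
state `en c` of the cycle `f c`, which is closer to the set `M`. An eigenvector for this matrix has
no zero entry on the cycles of the path that starts in a cycle `c₀` as far away as possible among
those where the eigenvector does not vanish, and it vanishes on all other cycles. The path ends in
`M`. -/
theorem exists_cycle_ne_zero (hq : ∀ x, q (π x) = q x)
    (htrans : ∀ x y, q x = q y → ∃ k : ℕ, (π ^ k) x = y) (hρ : ∀ c, 0 < ρ c)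
    (hinj : Function.Injective ρ) (M : Set Q) (f : Q → Q) (d : Q → ℕ) (ex en : Q → Fin n)
    (hex : ∀ c, c ∉ M → q (ex c) = c) (hen : ∀ c, c ∉ M → q (en c) = f c)
    (hd : ∀ c, c ∉ M → d (f c) < d c) (hv : v ≠ 0)
    (heq : ∀ y, μ * v y = ρ (q y) * v (π.symm y) +
      ∑ x, if q x ∉ M ∧ ex (q x) = x ∧ en (q x) = y then v x else 0) :
    ∃ c ∈ M, ∀ x, q x = c → v x ≠ 0 := by
  obtain ⟨x₀, hx₀, hmax⟩ : ∃ x, v x ≠ 0 ∧ ∀ x', v x' ≠ 0 → d (q x') ≤ d (q x) := by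
    obtain ⟨x1, hx1⟩ := Function.ne_iff.1 hv
    obtain ⟨x, hx, h⟩ := (Finset.univ.filter fun x => v x ≠ 0).exists_max_image (fun x => d (q x))
      ⟨x1, by simpa using hx1⟩
    exact ⟨x, by simpa using hx, fun x' hx' => h x' (by simpa using hx')⟩
  set c₀ := q x₀ with hc₀
  let Path : Q → Prop := Relation.ReflTransGen (fun c c' => c ∉ M ∧ c' = f c) c₀
  have hunfed : ∀ y, (∀ x, q x ∉ M → f (q x) = q y → v x = 0) →
      μ * v y = ρ (q y) * v (π.symm y) := by
    intro y hy
    rw [heq y, Finset.sum_eq_zero, add_zero]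
    intro x _
    split_ifs with hx
    · exact hy x hx.1 (by rw [← hen _ hx.1, hx.2.2])
    · rfl
  have hfed : ∀ y c', c' ∉ M → (∀ x, q x ∉ M → f (q x) = q y → q x ≠ c' → v x = 0) →
      μ * v y = ρ (q y) * v (π.symm y) + if en c' = y then v (ex c') else 0 := by
    intro y c' hc' hy
    rw [heq y, Finset.sum_eq_single (ex c')]
    · simp [hex c' hc', hc']
    · intro x _ hx
      split_ifs with h1
      · refine hy x h1.1 (by rw [← hen _ h1.1, h1.2.2]) ?_
        rintro rfl
        exact hx h1.2.1.symm
      · rfl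
    · simp
  have hzero₀ : ∀ x, q x ∉ M → f (q x) = c₀ → v x = 0 := by
    intro x hxM hfx
    by_contra hne
    have h1 := hmax x hne
    have h2 := hd _ hxM
    rw [hfx] at h2
    omega
  have hunfed₀ : ∀ y, q y = c₀ → μ * v y = ρ c₀ * v (π.symm y) := by
    intro y hy
    have := hunfed y fun x hxM hfx => hzero₀ x hxM (hfx.trans hy)
    rwa [hy] at this
  have hnorm : ‖μ‖ = ρ c₀ := norm_eq_of_cycle hq (hρ c₀) hunfed₀ rfl hx₀
  have hμ : μ ≠ 0 := by
    rw [← norm_pos_iff, hnorm]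
    exact hρ c₀
  have hdle : ∀ c c', Relation.ReflTransGen (fun c c' => c ∉ M ∧ c' = f c) c c' → d c' ≤ d c := by
    intro c c' h
    induction h with
    | refl => exact le_rfl
    | tail _ h1 ih =>
      obtain ⟨h2, rfl⟩ := h1
      exact (hd _ h2).le.trans ih
  have hpred : ∀ c' c'', Path c' → Path c'' → c' ∉ M → c'' ∉ M → f c' = f c'' → c' = c'' := by
    have key : ∀ c' c'', Relation.ReflTransGen (fun c c' => c ∉ M ∧ c' = f c) c' c'' → c' ∉ M →
        c'' ∉ M → f c' = f c'' → c' = c'' := by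
      intro c' c'' h h1 h2 e
      rcases Relation.ReflTransGen.cases_head h with h3 | ⟨c1, ⟨-, rfl⟩, h4⟩
      · exact h3
      · have h5 := hdle _ _ h4
        have h6 := hd _ h2
        rw [← e] at h6
        omega
    intro c' c'' h1 h2 h3 h4 e
    rcases Relation.ReflTransGen.total_of_right_unique
      (fun a b c hab hac => hab.2.trans hac.2.symm) h1 h2 with h | h
    · exact key _ _ h h3 h4 e
    · exact (key _ _ h h4 h3 e.symm).symm
  set D := Finset.univ.sup fun x => d (q x) with hD
  have hDle : ∀ x, d (q x) ≤ D := fun x => Finset.le_sup (f := fun x => d (q x)) (Finset.mem_univ x)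
  have main : ∀ x, (Path (q x) → v x ≠ 0) ∧ (¬ Path (q x) → v x = 0) := by
    intro x
    induction hk : D - d (q x) using Nat.strong_induction_on generalizing x with
    | _ k ih =>
      have IH : ∀ y, d (q x) < d (q y) → (Path (q y) → v y ≠ 0) ∧ (¬ Path (q y) → v y = 0) := by
        intro y hy
        have := hDle y
        exact ih (D - d (q y)) (by omega) y rfl
      constructor
      · intro hp hvx
        rcases Relation.ReflTransGen.cases_tail hp with h0 | ⟨c', hc', hM', hf'⟩
        · exact hx₀ (eq_zero_of_cycle hμ hq htrans h0 (fun y hy _ => hunfed₀ y hy) hvx rfl)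
        · have hzero : ∀ y, q y = q x → ∀ z, q z ∉ M → f (q z) = q y → q z ≠ c' → v z = 0 := by
            intro y hy z hz hfz hzc
            rw [hy] at hfz
            refine (IH z (hfz ▸ hd _ hz)).2 fun hpz => hzc ?_
            exact hpred _ _ hpz hc' hz hM' (hfz.trans hf')
          have hexc : v (ex c') ≠ 0 := by
            refine (IH (ex c') ?_).1 ?_
            · rw [hex c' hM', hf']
              exact hd c' hM'
            · rwa [hex c' hM']
          have hqe : q (en c') = q x := by rw [hen c' hM', hf']
          have hoff : ∀ y, q y = q x → y ≠ en c' → μ * v y = ρ (q x) * v (π.symm y) := by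
            intro y hy hye
            have := hfed y c' hM' (hzero y hy)
            rwa [if_neg (Ne.symm hye), add_zero, hy] at this
          have hq' : ∀ y, q (π.symm y) = q y := fun y => by
            rw [← hq (π.symm y), π.apply_symm_apply]
          -- Going backwards from `x` along the cycle, one comes to `en c'`.
          have hback : ∀ k : ℕ, ∀ y, q y = q x → v y = 0 → (π ^ k) (en c') = y → v (en c') = 0 := by
            intro k
            induction k with
            | zero =>
              intro y _ hvy e
              have e' : en c' = y := by simpa using e
              rwa [e']
            | succ k ihk =>
              intro y hy hvy e
              by_cases hye : y = en c'
              · rwa [← hye]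
              · have h1 := hoff y hy hye
                rw [hvy, mul_zero] at h1
                have h2 : v (π.symm y) = 0 := by
                  refine (mul_eq_zero.1 h1.symm).resolve_left ?_
                  exact_mod_cast (hρ (q x)).ne'
                refine ihk _ ((hq' y).trans hy) h2 ?_
                rw [← e, pow_succ', Equiv.Perm.mul_apply, π.symm_apply_apply]
          obtain ⟨k, hk⟩ := htrans (en c') x hqe
          have hve : v (en c') = 0 := hback k x rfl hvx hk
          have hall : v (π.symm (en c')) = 0 :=
            eq_zero_of_cycle hμ hq htrans hqe hoff hve ((hq' _).trans hqe)
          have := hfed (en c') c' hM' (hzero _ hqe)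
          rw [if_pos rfl, hve, hall, mul_zero, mul_zero, zero_add] at this
          exact hexc this.symm
      · intro hp
        by_contra hvx
        have h1 : ∀ y, q y = q x → μ * v y = ρ (q x) * v (π.symm y) := by
          intro y hy
          have := hunfed y fun z hz hfz => by
            rw [hy] at hfz
            refine (IH z (hfz ▸ hd _ hz)).2 fun hpz => hp ?_
            exact Relation.ReflTransGen.tail hpz ⟨hz, hfz.symm⟩
          rwa [hy] at this
        have h2 := norm_eq_of_cycle hq (hρ _) h1 rfl hvx
        have h3 : c₀ = q x := hinj (hnorm.symm.trans h2)
        exact hp (h3 ▸ .refl)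
  have hend : ∀ k : ℕ, ∀ c, Path c → d c = k → ∃ c' ∈ M, Path c' := by
    intro k
    induction k using Nat.strong_induction_on with
    | _ k ih =>
      intro c hc hk
      by_cases hM : c ∈ M
      · exact ⟨c, hM, hc⟩
      · exact ih _ (hk ▸ hd c hM) (f c) (Relation.ReflTransGen.tail hc ⟨hM, rfl⟩) rfl
  obtain ⟨c, hcM, hc⟩ := hend _ c₀ .refl rfl
  exact ⟨c, hcM, fun x hx => (main x).1 (hx ▸ hc)⟩

end

/-- In a structurally cyclic system with sensors measuring one state each, all parent SCCs have to
be measured, since a state vector supported on a parent SCC stays supported on it; and this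
suffices. -/
theorem structurallyObservable_iff {m n : ℕ} {A : Matrix (Fin n) (Fin n) ℕ}
    (hA : StructurallyCyclic A) (l : Fin m → Fin n) :
    StructurallyObservable A (indicator l) ↔ ∀ S, IsParentSCC A S → ∃ i, l i ∈ S := by
  classical
  constructor
  · rintro ⟨A', H', hA', hH', hobs⟩ S hS
    by_contra! hne
    obtain ⟨x₀, hx₀⟩ := hS.nonempty
    have hsupp : ∀ k : ℕ, ∀ j, j ∉ S →
        ((A' ^ k).mulVec (fun j => if j ∈ S then 1 else 0)) j = 0 := by
      intro k
      induction k with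
      | zero =>
        intro j hj
        simp [hj]
      | succ k ih =>
        intro i hi
        rw [pow_succ', ← Matrix.mulVec_mulVec, Matrix.mulVec, dotProduct]
        refine Finset.sum_eq_zero fun j _ => ?_
        by_cases hj : j ∈ S
        · have : ¬ A' i j ≠ 0 := fun h => hS.2 j hj i hi ((hA' i j).1 h)
          rw [not_not.1 this, zero_mul]
        · rw [ih j hj, mul_zero]
    have hzero := hobs (fun j => if j ∈ S then 1 else 0) fun k => by
      funext i
      rw [Matrix.mulVec, dotProduct]
      refine Finset.sum_eq_zero fun j _ => ?_
      by_cases hj : j ∈ S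
      · have : ¬ H' i j ≠ 0 := fun h => by
          have h1 := indicator_eq_one.1 ((hH' i j).1 h)
          exact hne i (h1 ▸ hj)
        rw [not_not.1 this, zero_mul]
      · rw [hsupp k j hj, mul_zero]
    have := congrFun hzero x₀
    simp [hx₀] at this
  · intro hmeas
    obtain ⟨π, hπ⟩ := hA.exists_perm
    let Q := Quotient (Equiv.Perm.SameCycle.setoid π)
    let q : Fin n → Q := Quotient.mk _
    have hqiff : ∀ x y, q x = q y ↔ π.SameCycle x y := fun x y => Quotient.eq
    have hq : ∀ x, q (π x) = q x := fun x =>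
      (hqiff _ _).2 (Equiv.Perm.sameCycle_apply_left.2 (Equiv.Perm.SameCycle.refl π x))
    have htrans : ∀ x y, q x = q y → ∃ k : ℕ, (π ^ k) x = y := by
      intro x y hxy
      obtain ⟨k, -, hk⟩ := ((hqiff x y).1 hxy).exists_pow_eq'
      exact ⟨k, hk⟩
    let M : Set Q := {c | ∃ i, q (l i) = c}
    let r : Q → Q → Prop := fun c c' => ∃ x y, q x = c ∧ q y = c' ∧ Edge A x y
    have hreach : ∀ c, ∃ e ∈ M, Relation.ReflTransGen r c e := by
      intro c
      obtain ⟨x, rfl⟩ := Quotient.exists_rep c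
      obtain ⟨S, hS, y, hy, hxy⟩ := exists_isParentSCC_reach A x
      obtain ⟨i, hi⟩ := hmeas S hS
      refine ⟨q (l i), ⟨i, rfl⟩, ?_⟩
      exact Relation.ReflTransGen.lift (p := r) q (fun a b hab => ⟨a, b, rfl, rfl, hab⟩) _ _
        (hxy.trans (hS.reach hy hi))
    obtain ⟨f, d, hfd⟩ := exists_descent r M hreach
    have hchoose : ∀ c, ∃ p : Fin n × Fin n, c ∉ M → q p.1 = c ∧ q p.2 = f c ∧ Edge A p.1 p.2 := by
      intro c
      by_cases hc : c ∈ M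
      · obtain ⟨x, -⟩ := Quotient.exists_rep c
        exact ⟨(x, x), fun h => absurd hc h⟩
      · obtain ⟨x, y, h⟩ := (hfd c hc).1
        exact ⟨(x, y), fun _ => h⟩
    choose p hp using hchoose
    let e := Fintype.equivFin Q
    let ρ : Q → ℝ := fun c => (e c : ℕ) + 1
    have hρ : ∀ c, 0 < ρ c := fun c => by positivity
    have hinj : Function.Injective ρ := by
      intro c c' h
      have h1 : ((e c : ℕ) : ℝ) = (e c' : ℕ) := by simpa [ρ] using h
      exact e.injective (Fin.ext (by exact_mod_cast h1))
    let A₀ : Matrix (Fin n) (Fin n) ℝ := fun y x => (if π x = y then ρ (q x) else 0) +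
      if q x ∉ M ∧ (p (q x)).1 = x ∧ (p (q x)).2 = y then 1 else 0
    have hsub : ∀ y x, A₀ y x ≠ 0 → A y x = 1 := by
      intro y x h
      by_cases h1 : π x = y
      · exact h1 ▸ hπ x
      · by_cases h2 : q x ∉ M ∧ (p (q x)).1 = x ∧ (p (q x)).2 = y
        · have h3 := (hp _ h2.1).2.2
          rwa [h2.2.1, h2.2.2] at h3
        · simp [A₀, h1, h2] at h
    have hobs : IsObservable A₀ ((indicator l).map ((↑) : ℕ → ℝ)) := by
      refine isObservable_of_eigenvectors fun μ v hv hμv hout => ?_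
      obtain ⟨c, ⟨i, rfl⟩, hne⟩ := exists_cycle_ne_zero (μ := μ) hq htrans hρ hinj M f d
        (fun c => (p c).1) (fun c => (p c).2) (fun c hc => (hp c hc).1) (fun c hc => (hp c hc).2.1)
        (fun c hc => (hfd c hc).2) hv (by
          intro y
          have h1 := congrFun hμv y
          rw [Pi.smul_apply, smul_eq_mul] at h1
          rw [← h1, Matrix.mulVec, dotProduct]
          have h2 : ∀ x, (A₀.map Complex.ofRealHom) y x * v x =
              (if π x = y then (ρ (q x) : ℂ) * v x else 0) +
              if q x ∉ M ∧ (p (q x)).1 = x ∧ (p (q x)).2 = y then v x else 0 := by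
            intro x
            change ((A₀ y x : ℝ) : ℂ) * v x = _
            simp only [A₀]
            split_ifs <;> simp [add_mul]
          rw [Finset.sum_congr rfl fun x _ => h2 x, Finset.sum_add_distrib]
          congr 1
          swap
          · exact Finset.sum_congr rfl fun x _ => by congr
          rw [Finset.sum_eq_single (π.symm y)]
          · rw [if_pos (π.apply_symm_apply y), ← hq (π.symm y), π.apply_symm_apply]
          · intro x _ hx
            exact if_neg fun h => hx (by rw [← h, π.symm_apply_apply])
          · simp)
      refine hne (l i) rfl ?_
      have h1 := congrFun hout i
      rw [Matrix.mulVec, dotProduct, Finset.sum_eq_single (l i)] at h1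
      · simpa [indicator] using h1
      · intro x _ hx
        simp [indicator, Ne.symm hx]
      · simp
    obtain ⟨A', hA', hobs'⟩ := exists_hasPattern_isObservable hsub hobs
    refine ⟨A', _, hA', fun i j => ?_, hobs'⟩
    simp [indicator]

/-! ### Equivalence of sensor selection and assignment -/

section
variable {m n : ℕ} {A : Matrix (Fin n) (Fin n) ℕ}

/-- The feasible selections: the sensors measure one state each, in different parent SCCs. There are
as many sensors as parent SCCs, so that each parent SCC is measured exactly once. -/
theorem isSelection_iff (hA : StructurallyCyclic A) (P : ParentEnum A m)
    {H : Matrix (Fin m) (Fin n) ℕ} :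
    IsSelection A H ↔ ∃ (τ : Equiv.Perm (Fin m)) (l : Fin m → Fin n),
      (∀ i, l i ∈ (P (τ i)).1) ∧ H = indicator l := by
  constructor
  · rintro ⟨h01, hobs, -, hrow⟩
    obtain ⟨l, rfl⟩ := exists_eq_indicator h01 hrow
    rw [structurallyObservable_iff hA] at hobs
    choose g hg using fun j => hobs (P j).1 (P j).2
    have hinj : Function.Injective g := by
      intro j j' e
      exact P.index_eq (hg j) (e ▸ hg j')
    let τ := Equiv.ofBijective g (Finite.injective_iff_bijective.1 hinj)
    refine ⟨τ.symm, l, fun i => ?_, rfl⟩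
    have h1 := hg (τ.symm i)
    have h2 : g (τ.symm i) = i := τ.apply_symm_apply i
    rwa [h2] at h1
  · rintro ⟨τ, l, hl, rfl⟩
    refine ⟨isZeroOne_indicator l, ?_, indicator_col_sum_le.2 ?_, indicator_row_sum l⟩
    · rw [structurallyObservable_iff hA]
      intro S hS
      obtain ⟨j, hj⟩ := P.surjective ⟨S, hS⟩
      refine ⟨τ.symm j, ?_⟩
      have h1 := hl (τ.symm j)
      rwa [τ.apply_symm_apply, hj] at h1
    · intro i i' e
      exact τ.injective (P.index_eq (hl i) (e ▸ hl i'))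

theorem assignmentOf_indicator (P : ParentEnum A m) {τ : Fin m → Fin m} {l : Fin m → Fin n}
    (hl : ∀ i, l i ∈ (P (τ i)).1) : assignmentOf P (indicator l) = indicator τ := by
  ext i j
  by_cases h : τ i = j
  · rw [indicator_eq_one.2 h]
    exact if_pos ⟨l i, h ▸ hl i, indicator_eq_one.2 rfl⟩
  · rw [show indicator τ i j = 0 from if_neg h]
    refine if_neg ?_
    rintro ⟨x, hx, hx'⟩
    rw [indicator_eq_one] at hx'
    exact h (P.index_eq (hl i) (hx' ▸ hx))

theorem selectionOf_indicator (σ : Fin m → Fin m → Fin n) (τ : Fin m → Fin m) :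
    selectionOf σ (indicator τ) = indicator fun i => σ i (τ i) := by
  ext i x
  simp only [selectionOf, indicator]
  congr 1
  simp

theorem exists_isCheapest (c : Matrix (Fin m) (Fin n) ℝ) (P : ParentEnum A m) :
    ∃ σ, IsCheapest c P σ := by
  have h : ∀ i j, ∃ x ∈ (P j).1, ∀ l ∈ (P j).1, c i x ≤ c i l := by
    intro i j
    obtain ⟨⟨x, hx, e⟩, h⟩ := sccCost_isLeast c P i j
    exact ⟨x, hx, fun l hl => e ▸ h ⟨l, hl, rfl⟩⟩
  choose σ h1 h2 using h
  exact ⟨σ, fun i j => ⟨h1 i j, h2 i j⟩⟩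

theorem IsCheapest.sccCost_eq {c : Matrix (Fin m) (Fin n) ℝ} {P : ParentEnum A m}
    {σ : Fin m → Fin m → Fin n} (h : IsCheapest c P σ) (i j : Fin m) :
    sccCost c P i j = c i (σ i j) := by
  refine (sccCost_isLeast c P i j).unique ⟨⟨_, (h i j).1, rfl⟩, ?_⟩
  rintro _ ⟨l, hl, rfl⟩
  exact (h i j).2 l hl

theorem isAssignment_assignmentOf (hA : StructurallyCyclic A) (c : Matrix (Fin m) (Fin n) ℝ)
    (P : ParentEnum A m) {H : Matrix (Fin m) (Fin n) ℕ} (hH : IsSelection A H) :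
    IsAssignment (assignmentOf P H) ∧
      totalCost (sccCost c P) (assignmentOf P H) ≤ totalCost c H := by
  obtain ⟨τ, l, hl, rfl⟩ := (isSelection_iff hA P).1 hH
  rw [assignmentOf_indicator P hl, totalCost_indicator, totalCost_indicator]
  exact ⟨isAssignment_iff.2 ⟨τ, rfl⟩,
    Finset.sum_le_sum fun i _ => (sccCost_isLeast c P i (τ i)).2 ⟨l i, hl i, rfl⟩⟩

theorem isSelection_selectionOf (hA : StructurallyCyclic A) {c : Matrix (Fin m) (Fin n) ℝ}
    {P : ParentEnum A m} {σ : Fin m → Fin m → Fin n} (hσ : IsCheapest c P σ)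
    {Z : Matrix (Fin m) (Fin m) ℕ} (hZ : IsAssignment Z) :
    IsSelection A (selectionOf σ Z) ∧ assignmentOf P (selectionOf σ Z) = Z ∧
      totalCost c (selectionOf σ Z) = totalCost (sccCost c P) Z := by
  obtain ⟨τ, rfl⟩ := isAssignment_iff.1 hZ
  have hmem : ∀ i, σ i (τ i) ∈ (P (τ i)).1 := fun i => (hσ i (τ i)).1
  rw [selectionOf_indicator, assignmentOf_indicator P hmem, totalCost_indicator,
    totalCost_indicator]
  exact ⟨(isSelection_iff hA P).2 ⟨τ, _, hmem, rfl⟩, rfl,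
    Finset.sum_congr rfl fun i _ => (hσ.sccCost_eq i (τ i)).symm⟩

theorem exists_isOptimalAssignment (C : Matrix (Fin m) (Fin m) ℝ) :
    ∃ Z, IsOptimalAssignment C Z := by
  obtain ⟨τ, -, hτ⟩ := (Finset.univ : Finset (Equiv.Perm (Fin m))).exists_min_image
    (fun τ => totalCost C (indicator τ)) ⟨1, Finset.mem_univ _⟩
  refine ⟨indicator τ, isAssignment_iff.2 ⟨τ, rfl⟩, fun Z' hZ' => ?_⟩
  obtain ⟨τ', rfl⟩ := isAssignment_iff.1 hZ'
  exact hτ τ' (Finset.mem_univ _)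

/-- Optimality transfers in both directions, since no selection is cheaper than the assignment that
it induces. -/
theorem isOptimalAssignment_iff_selectionOf (hA : StructurallyCyclic A)
    {c : Matrix (Fin m) (Fin n) ℝ} {P : ParentEnum A m} {σ : Fin m → Fin m → Fin n}
    (hσ : IsCheapest c P σ) {Z : Matrix (Fin m) (Fin m) ℕ} (hZ : IsAssignment Z) :
    IsOptimalAssignment (sccCost c P) Z ↔ IsOptimalSelection A c (selectionOf σ Z) := by
  obtain ⟨h1, -, h3⟩ := isSelection_selectionOf hA hσ hZ
  constructor
  · rintro ⟨-, hmin⟩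
    refine ⟨h1, fun H' hH' => ?_⟩
    obtain ⟨h4, h5⟩ := isAssignment_assignmentOf hA c P hH'
    rw [h3]
    exact (hmin _ h4).trans h5
  · rintro ⟨-, hmin⟩
    refine ⟨hZ, fun Z' hZ' => ?_⟩
    obtain ⟨h4, -, h6⟩ := isSelection_selectionOf hA hσ hZ'
    rw [← h3, ← h6]
    exact hmin _ h4

theorem isOptimalSelection_iff (hA : StructurallyCyclic A) (c : Matrix (Fin m) (Fin n) ℝ)
    (P : ParentEnum A m) (H : Matrix (Fin m) (Fin n) ℕ) :
    IsOptimalSelection A c H ↔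
      IsSelection A H ∧ IsOptimalAssignment (sccCost c P) (assignmentOf P H) ∧
      totalCost c H = totalCost (sccCost c P) (assignmentOf P H) := by
  obtain ⟨σ, hσ⟩ := exists_isCheapest c P
  constructor
  · rintro ⟨hH, hmin⟩
    obtain ⟨h1, h2⟩ := isAssignment_assignmentOf hA c P hH
    -- The cheapest states for the assignment of an optimal selection give no lower cost.
    have key : ∀ Z', IsAssignment Z' → totalCost c H ≤ totalCost (sccCost c P) Z' := by
      intro Z' hZ'
      obtain ⟨h3, -, h4⟩ := isSelection_selectionOf hA hσ hZ'
      rw [← h4]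
      exact hmin _ h3
    exact ⟨hH, ⟨h1, fun Z' hZ' => h2.trans (key Z' hZ')⟩, le_antisymm (key _ h1) h2⟩
  · rintro ⟨hH, ⟨h1, hmin⟩, he⟩
    refine ⟨hH, fun H' hH' => ?_⟩
    obtain ⟨h3, h4⟩ := isAssignment_assignmentOf hA c P hH'
    rw [he]
    exact (hmin _ h3).trans h4

theorem exists_isLeast_totalCost (hA : StructurallyCyclic A) (c : Matrix (Fin m) (Fin n) ℝ)
    (P : ParentEnum A m) :
    ∃ v : ℝ, IsLeast (totalCost c '' {H | IsSelection A H}) v ∧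
      IsLeast (totalCost (sccCost c P) '' {Z | IsAssignment Z}) v := by
  obtain ⟨σ, hσ⟩ := exists_isCheapest c P
  obtain ⟨Z, hZ⟩ := exists_isOptimalAssignment (sccCost c P)
  have hH := (isOptimalAssignment_iff_selectionOf hA hσ hZ.1).1 hZ
  refine ⟨totalCost (sccCost c P) Z, ⟨⟨_, hH.1, ?_⟩, ?_⟩, ⟨_, hZ.1, rfl⟩, ?_⟩
  · exact (isSelection_selectionOf hA hσ hZ.1).2.2
  · rintro _ ⟨H', hH', rfl⟩
    rw [← (isSelection_selectionOf hA hσ hZ.1).2.2]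
    exact hH.2 H' hH'
  · rintro _ ⟨Z', hZ', rfl⟩
    exact hZ.2 Z' hZ'

end

/-! ### A program logic with running times -/

infixr:60 " ;; " => Program.seq

instance : Coe Instr Program := ⟨Program.instr⟩

/-- Total correctness with a time bound: started in `s`, the program `p` halts after at most `B`
steps, in a configuration that satisfies `Q`. -/
def Runs (p : Program) (s : State) (B : ℕ) (Q : State → Prop) : Prop :=
  ∃ t s', Exec p s t s' ∧ t ≤ B ∧ Q s'

theorem Runs.mono {p : Program} {s : State} {B B' : ℕ} {Q Q' : State → Prop}
    (h : Runs p s B Q) (hB : B ≤ B') (hQ : ∀ s', Q s' → Q' s') : Runs p s B' Q' := by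
  obtain ⟨t, s', he, ht, hq⟩ := h
  exact ⟨t, s', he, ht.trans hB, hQ _ hq⟩

theorem Runs.seq {p q : Program} {s : State} {B B' : ℕ} {Q R : State → Prop}
    (h : Runs p s B R) (h' : ∀ s', R s' → Runs q s' B' Q) : Runs (p ;; q) s (B + B') Q := by
  obtain ⟨t, s', he, ht, hr⟩ := h
  obtain ⟨t', s'', he', ht', hq⟩ := h' s' hr
  exact ⟨t + t', s'', .seq he he', by omega, hq⟩

theorem Runs.ite {b : Test} {p q : Program} {s : State} {B : ℕ} {Q : State → Prop}
    (h : b.Holds s → Runs p s B Q) (h' : ¬ b.Holds s → Runs q s B Q) :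
    Runs (.ite b p q) s (B + 1) Q := by
  by_cases hb : b.Holds s
  · obtain ⟨t, s', he, ht, hq⟩ := h hb
    exact ⟨1 + t, s', .ite_true hb he, by omega, hq⟩
  · obtain ⟨t, s', he, ht, hq⟩ := h' hb
    exact ⟨1 + t, s', .ite_false hb he, by omega, hq⟩

/-- A loop whose body takes at most `B` steps and decreases the variant `k`. -/
theorem Runs.loop {b : Test} {p : Program} {B : ℕ} {Q : State → Prop} (I : ℕ → State → Prop)
    (hbody : ∀ k s, I k s → b.Holds s → Runs p s B (fun s' => ∃ k' < k, I k' s'))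
    (hexit : ∀ k s, I k s → ¬ b.Holds s → Q s) {k : ℕ} {s : State} (h : I k s) :
    Runs (.loop b p) s (k * (B + 1) + 1) Q := by
  induction k using Nat.strong_induction_on generalizing s with
  | _ k ih =>
    by_cases hb : b.Holds s
    · obtain ⟨t, s', he, ht, k', hk', hI⟩ := hbody k s h hb
      obtain ⟨t', s'', he', ht', hq⟩ := ih k' hk' hI
      refine ⟨1 + t + t', s'', .loop_true hb he he', ?_, hq⟩
      have : (k' + 1) * (B + 1) ≤ k * (B + 1) := Nat.mul_le_mul_right _ hk'
      linarith
    · exact ⟨1, s, .loop_false hb, by omega, hexit k s h hb⟩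

open Classical in
/-- The final configuration of a program without loops (loops are skipped). -/
noncomputable def Program.eval : Program → State → State
  | .instr a, s => a.apply s
  | .seq p q, s => q.eval (p.eval s)
  | .ite b p q, s => if b.Holds s then p.eval s else q.eval s
  | .loop _ _, s => s

/-- The program contains no loop. -/
def Program.loopFree : Program → Bool
  | .instr _ => true
  | .seq p q => p.loopFree && q.loopFree
  | .ite _ p q => p.loopFree && q.loopFree
  | .loop _ _ => false

/-- An upper bound for the running time of a program without loops: its number of instructions
and tests. -/
def Program.size : Program → ℕ
  | .instr _ => 1
  | .seq p q => p.size + q.size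
  | .ite _ p q => 1 + p.size + q.size
  | .loop _ p => 1 + p.size

theorem Runs.of_eval {p : Program} {s : State} {Q : State → Prop} (B : ℕ) (hp : p.loopFree = true)
    (hB : p.size ≤ B) (h : Q (p.eval s)) : Runs p s B Q := by
  suffices ∃ t, Exec p s t (p.eval s) ∧ t ≤ p.size by
    obtain ⟨t, he, ht⟩ := this
    exact ⟨t, _, he, ht.trans hB, h⟩
  clear h hB Q
  induction p generalizing s with
  | instr a => exact ⟨1, .instr a s, le_rfl⟩
  | seq p q ihp ihq =>
    simp only [Program.loopFree, Bool.and_eq_true] at hp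
    obtain ⟨t, he, ht⟩ := ihp hp.1 (s := s)
    obtain ⟨t', he', ht'⟩ := ihq hp.2 (s := p.eval s)
    exact ⟨t + t', .seq he he', Nat.add_le_add ht ht'⟩
  | ite b p q ihp ihq =>
    simp only [Program.loopFree, Bool.and_eq_true] at hp
    by_cases hb : b.Holds s
    · obtain ⟨t, he, ht⟩ := ihp hp.1 (s := s)
      refine ⟨1 + t, ?_, by simp only [Program.size]; omega⟩
      rw [Program.eval, if_pos hb]
      exact .ite_true hb he
    · obtain ⟨t, he, ht⟩ := ihq hp.2 (s := s)
      refine ⟨1 + t, ?_, by simp only [Program.size]; omega⟩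
      rw [Program.eval, if_neg hb]
      exact .ite_false hb he
  | loop b p => simp [Program.loopFree] at hp

@[simp] theorem setEntry_same {α : Type} (f : ℕ → ℕ → ℕ → α) (b i j : ℕ) (v : α) :
    setEntry f b i j v b i = Function.update (f b i) j v := by
  funext j'
  simp [setEntry, Function.update_apply]

theorem setEntry_row_ne {α : Type} (f : ℕ → ℕ → ℕ → α) (b i j : ℕ) (v : α) {i' : ℕ}
    (h : i' ≠ i) : setEntry f b i j v b i' = f b i' := by
  funext j'
  simp [setEntry, h]

theorem setEntry_ne {α : Type} (f : ℕ → ℕ → ℕ → α) (b i j : ℕ) (v : α) {b' : ℕ}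
    (h : b' ≠ b) : setEntry f b i j v b' = f b' := by
  funext i' j'
  simp [setEntry, h]

/-- The instruction writes the natural-number register `y`. -/
def Instr.writesNatReg : Instr → ℕ → Bool
  | .natConst x _, y | .natAdd x _ _, y | .natSub x _ _, y | .natLoad x _ _ _, y => x == y
  | _, _ => false

/-- The instruction writes the real register `y`. -/
def Instr.writesRealReg : Instr → ℕ → Bool
  | .realAdd x _ _, y | .realSub x _ _, y | .realLoad x _ _ _, y => x == y
  | _, _ => false

/-- The instruction writes the natural-number array `y`. -/
def Instr.writesNatArr : Instr → ℕ → Bool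
  | .natStore x _ _ _, y => x == y
  | _, _ => false

/-- The instruction writes the real array `y`. -/
def Instr.writesRealArr : Instr → ℕ → Bool
  | .realStore x _ _ _, y => x == y
  | _, _ => false

/-- Some instruction of the program satisfies `w`. -/
def Program.any (w : Instr → Bool) : Program → Bool
  | .instr a => w a
  | .seq p q => p.any w || q.any w
  | .ite _ p q => p.any w || q.any w
  | .loop _ p => p.any w

/-- `s'` agrees with `s` on all registers and arrays that `p` does not write. The conditions are
equations in `Bool`, so that they hold by `rfl` for concrete programs. -/
structure Frame (p : Program) (s s' : State) : Prop where
  natReg : ∀ x, p.any (·.writesNatReg x) = false → s'.natReg x = s.natReg x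
  realReg : ∀ x, p.any (·.writesRealReg x) = false → s'.realReg x = s.realReg x
  natArr : ∀ b, p.any (·.writesNatArr b) = false → s'.natArr b = s.natArr b
  realArr : ∀ b, p.any (·.writesRealArr b) = false → s'.realArr b = s.realArr b

theorem Frame.refl (p : Program) (s : State) : Frame p s s :=
  ⟨fun _ _ => rfl, fun _ _ => rfl, fun _ _ => rfl, fun _ _ => rfl⟩

theorem Frame.trans {p : Program} {s s' s'' : State} (h : Frame p s s') (h' : Frame p s' s'') :
    Frame p s s'' :=
  ⟨fun x hx => (h'.natReg x hx).trans (h.natReg x hx),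
    fun x hx => (h'.realReg x hx).trans (h.realReg x hx),
    fun x hx => (h'.natArr x hx).trans (h.natArr x hx),
    fun x hx => (h'.realArr x hx).trans (h.realArr x hx)⟩

theorem Frame.mono {p q : Program} {s s' : State} (h : Frame p s s')
    (hpq : ∀ w, q.any w = false → p.any w = false) : Frame q s s' :=
  ⟨fun x hx => h.natReg x (hpq _ hx), fun x hx => h.realReg x (hpq _ hx),
    fun x hx => h.natArr x (hpq _ hx), fun x hx => h.realArr x (hpq _ hx)⟩

theorem Instr.frame_apply (a : Instr) (s : State) : Frame a s (a.apply s) := by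
  cases a <;> constructor <;> intro x hx <;>
    first
      | rfl
      | exact Function.update_of_ne (ne_of_beq_false hx).symm _ _
      | exact setEntry_ne _ _ _ _ _ (ne_of_beq_false hx).symm

theorem Exec.frame {p : Program} {s s' : State} {t : ℕ} (h : Exec p s t s') : Frame p s s' := by
  induction h with
  | instr a s => exact a.frame_apply s
  | seq _ _ ih ih' =>
    exact (ih.mono fun w hw => by simp_all [Program.any]).trans
      (ih'.mono fun w hw => by simp_all [Program.any])
  | ite_true _ _ ih => exact ih.mono fun w hw => by simp_all [Program.any]
  | ite_false _ _ ih => exact ih.mono fun w hw => by simp_all [Program.any]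
  | loop_true _ _ _ ih ih' => exact (ih.mono fun w hw => by simp_all [Program.any]).trans ih'
  | loop_false _ => exact .refl _ _

theorem Runs.frame {p : Program} {s : State} {B : ℕ} {Q : State → Prop} (h : Runs p s B Q) :
    Runs p s B (fun s' => Q s' ∧ Frame p s s') := by
  obtain ⟨t, s', he, ht, hq⟩ := h
  exact ⟨t, s', he, ht, hq, he.frame⟩

/-- The rule `Runs.loop`, with the information which registers and arrays do not change. -/
theorem Runs.while {b : Test} {p : Program} {B k : ℕ} {s : State} (I : ℕ → State → Prop)
    (h : I k s)
    (hbody : ∀ k s', I k s' → Frame (.loop b p) s s' → b.Holds s' →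
      Runs p s' B (fun s'' => ∃ k' < k, I k' s'')) :
    Runs (.loop b p) s (k * (B + 1) + 1)
      (fun s' => (∃ k, I k s') ∧ ¬ b.Holds s' ∧ Frame (.loop b p) s s') := by
  refine Runs.loop (fun k s' => I k s' ∧ Frame (.loop b p) s s') ?_ ?_ ⟨h, .refl _ _⟩
  · rintro k s' ⟨hI, hF⟩ hb
    refine (hbody k s' hI hF hb).frame.mono le_rfl ?_
    rintro s'' ⟨⟨k', hk', hI'⟩, hF'⟩
    exact ⟨k', hk', hI', hF.trans (hF'.mono fun w hw => by simpa [Program.any] using hw)⟩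
  · rintro k s' ⟨hI, hF⟩ hb
    exact ⟨⟨k, hI⟩, hb, hF⟩

/-- The assignment of a value to a natural-number register. -/
def State.setNat (s : State) (x v : ℕ) : State :=
  { s with natReg := Function.update s.natReg x v }

/-- `for x in 0, 1, …, N - 1 do p`, where `N` is the content of the register `y`. The register `3`
has to hold the number `1`. -/
def forLoop (x y : ℕ) (p : Program) : Program :=
  Instr.natConst x 0 ;; .loop (.natLt x y) (p ;; Instr.natAdd x x 3)

/-- The rule for counting loops: `I j` holds when `j` iterations are complete. -/
theorem Runs.forLoop {x y : ℕ} {p : Program} {s : State} {N B : ℕ} (I : ℕ → State → Prop)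
    (hx : p.any (·.writesNatReg x) = false) (hy : (forLoop x y p).any (·.writesNatReg y) = false)
    (h3 : (forLoop x y p).any (·.writesNatReg 3) = false)
    (hN : s.natReg y = N) (hone : s.natReg 3 = 1) (h0 : I 0 (s.setNat x 0))
    (hbody : ∀ j s', j < N → I j s' → s'.natReg x = j →
      Frame (SensorSelection.forLoop x y p) s s' →
      Runs p s' B (fun s'' => I (j + 1) (s''.setNat x (j + 1)))) :
    Runs (SensorSelection.forLoop x y p) s (N * (B + 2) + 2)
      (fun s' => I N s' ∧ Frame (SensorSelection.forLoop x y p) s s') := by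
  set P := SensorSelection.forLoop x y p with hP
  let J : ℕ → State → Prop := fun k s' =>
    ∃ j, j + k = N ∧ I j s' ∧ s'.natReg x = j ∧ Frame P s s'
  have hfirst : J N (s.setNat x 0) :=
    ⟨0, by omega, h0, by simp [State.setNat], ((Instr.natConst x 0).frame_apply s).mono fun w hw => by
      simp_all [P, SensorSelection.forLoop, Program.any]⟩
  have hloop : Runs (.loop (.natLt x y) (p ;; Instr.natAdd x x 3)) (s.setNat x 0)
      (N * ((B + 1) + 1) + 1) (fun s' => I N s' ∧ Frame P s s') := by
    refine Runs.loop J ?_ ?_ hfirst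
    · rintro k s' ⟨j, hjk, hI, hj, hF⟩ hb
      have hb' : j < N := by
        have : s'.natReg x < s'.natReg y := hb
        rwa [hj, hF.natReg y hy, hN] at this
      refine Runs.seq (hbody j s' hb' hI hj hF).frame fun s'' ⟨hI', hF'⟩ => ?_
      refine ⟨1, _, .instr _ _, le_rfl, k - 1, by omega, j + 1, by omega, ?_⟩
      have e1 : s''.natReg x = j := (hF'.natReg x hx).trans hj
      have hF2 : Frame P s' s'' := hF'.mono fun w hw => by
        simp_all [P, SensorSelection.forLoop, Program.any]
      have e3 : s''.natReg 3 = 1 := by rw [hF2.natReg 3 h3, hF.natReg 3 h3, hone]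
      have e : (Instr.natAdd x x 3).apply s'' = s''.setNat x (j + 1) := by
        simp [Instr.apply, State.setNat, e1, e3]
      refine ⟨e ▸ hI', by simp [e, State.setNat], (hF.trans hF2).trans ?_⟩
      exact ((Instr.natAdd x x 3).frame_apply s'').mono fun w hw => by
        simp_all [P, SensorSelection.forLoop, Program.any]
    · rintro k s' ⟨j, hjk, hI, hj, hF⟩ hb
      have hb' : ¬ j < N := by
        have : ¬ s'.natReg x < s'.natReg y := hb
        rwa [hj, hF.natReg y hy, hN] at this
      obtain rfl : j = N := by omega
      exact ⟨hI, hF⟩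
  have h1 : Runs (Instr.natConst x 0) s 1 (fun s' => s' = s.setNat x 0) :=
    ⟨1, _, .instr _ _, le_rfl, rfl⟩
  refine (h1.seq fun s' hs' => hs' ▸ hloop).mono ?_ fun _ h => h
  linarith [Nat.zero_le B]

/-! ### Shortest augmenting paths for the assignment problem -/

/-- `q` matches the rows below `i` with distinct columns below `m`; `p` is the inverse matching,
shifted by one, with the value `0` at unmatched columns. -/
structure IsMatching (m i : ℕ) (q p : ℕ → ℕ) : Prop where
  lt : ∀ r < i, q r < m
  inv : ∀ r < i, p (q r) = r + 1
  surj : ∀ j < m, p j ≠ 0 → ∃ r < i, q r = j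

/-- With the column potentials `v`, the entry of row `r` in column `j` has the least reduced cost of
its row. -/
def Tight (C : ℕ → ℕ → ℝ) (m : ℕ) (v : ℕ → ℝ) (r j : ℕ) : Prop :=
  ∀ j' < m, C r j - v j ≤ C r j' - v j'

/-- The row `r` has been reached by the search from row `i`. -/
def RowReached (i : ℕ) (q used : ℕ → ℕ) (r : ℕ) : Prop :=
  r = i ∨ r < i ∧ used (q r) ≠ 0

/-- The distance of row `r` from the root row `i`, minus the row potential of `r`, which is the
reduced cost of its matched entry (and `0` for the root). -/
noncomputable def rowOffset (C : ℕ → ℕ → ℝ) (i : ℕ) (q : ℕ → ℕ) (v dist : ℕ → ℝ) (r : ℕ) : ℝ :=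
  if r = i then 0 else dist (q r) - (C r (q r) - v (q r))

/-- State of the search for a shortest augmenting path from row `i` after `k` columns have been
settled. The entry `used j` is `0` as long as `j` is not settled, and then the number of columns
settled up to `j`. The tentative distance of the column `j` is `dist j`, and `way j` is the row
before it on a path of this length. -/
structure SearchTree (C : ℕ → ℕ → ℝ) (m i k : ℕ) (q p : ℕ → ℕ) (v : ℕ → ℝ) (used : ℕ → ℕ)
    (dist : ℕ → ℝ) (way : ℕ → ℕ) : Prop where
  used_le : ∀ j < m, used j ≤ k
  card : ((Finset.range m).filter (used · ≠ 0)).card = k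
  matched : ∀ j < m, used j ≠ 0 → p j ≠ 0
  reached : ∀ j < m, RowReached i q used (way j)
  dist_eq : ∀ j < m, dist j = rowOffset C i q v dist (way j) + (C (way j) j - v j)
  rank : ∀ j < m, used j ≠ 0 → way j ≠ i → used (q (way j)) < used j
  dist_le : ∀ r, RowReached i q used r → ∀ j < m, dist j ≤ rowOffset C i q v dist r + (C r j - v j)
  settled_le : ∀ j < m, used j ≠ 0 → ∀ j' < m, used j' = 0 → dist j ≤ dist j'

/-- State while a matching is changed along the alternating path that ends in the column `j`. This
column still has to be matched; it is not a value of `q`, and it is the only column where `p` may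
have a nonzero value without being matched. The stamps `used` decrease along the path towards the
row `i`. -/
structure Augmenting (C : ℕ → ℕ → ℝ) (m i : ℕ) (v : ℕ → ℝ) (used way q p : ℕ → ℕ) (j : ℕ) :
    Prop where
  lt : ∀ r < i, q r < m
  inv : ∀ r < i, p (q r) = r + 1
  surj : ∀ j' < m, j' ≠ j → p j' ≠ 0 → ∃ r < i, q r = j'
  tight : ∀ r < i, Tight C m v r (q r)
  col_lt : j < m
  col_used : used j ≠ 0
  col_free : ∀ r < i, q r ≠ j
  tree_tight : ∀ j' < m, used j' ≠ 0 → used j' ≤ used j → Tight C m v (way j') j'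
  tree_rank : ∀ j' < m, used j' ≠ 0 → used j' ≤ used j →
    way j' = i ∨ way j' < i ∧ used (q (way j')) ≠ 0 ∧ used (q (way j')) < used j'

section
variable {C : ℕ → ℕ → ℝ} {m i k : ℕ} {q p used way : ℕ → ℕ} {v dist : ℕ → ℝ}

theorem SearchTree.init (hM : IsMatching m i q p) (hu : ∀ j < m, used j = 0)
    (hw : ∀ j < m, way j = i) (hd : ∀ j < m, dist j = C i j - v j) :
    SearchTree C m i 0 q p v used dist way where
  used_le j hj := (hu j hj).le
  card := by
    rw [Finset.card_eq_zero, Finset.filter_eq_empty_iff]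
    intro j hj
    simp [hu j (Finset.mem_range.1 hj)]
  matched j hj h := absurd (hu j hj) h
  reached j hj := .inl (hw j hj)
  dist_eq j hj := by simp [rowOffset, hw j hj, hd j hj]
  rank j hj h := absurd (hu j hj) h
  dist_le r hr j hj := by
    rcases hr with rfl | ⟨hr, hr'⟩
    · simp [rowOffset, hd j hj]
    · exact absurd (hu _ (hM.lt r hr)) hr'
  settled_le j hj h := absurd (hu j hj) h

/-- Settled columns are matched with different rows below `i`. -/
theorem SearchTree.count_le (hM : IsMatching m i q p)
    (h : SearchTree C m i k q p v used dist way) : k ≤ i := by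
  rw [← h.card, ← Finset.card_range i]
  refine Finset.card_le_card_of_injOn (fun j => p j - 1) ?_ ?_
  · intro j hj
    simp only [Finset.coe_filter, Finset.mem_range, Set.mem_ofPred_eq] at hj
    obtain ⟨r, hr, rfl⟩ := hM.surj j hj.1 (h.matched j hj.1 hj.2)
    simpa [hM.inv r hr] using hr
  · intro j hj j' hj' e
    simp only [Finset.coe_filter, Finset.mem_range, Set.mem_ofPred_eq] at hj hj'
    obtain ⟨r, hr, rfl⟩ := hM.surj j hj.1 (h.matched j hj.1 hj.2)
    obtain ⟨r', hr', rfl⟩ := hM.surj j' hj'.1 (h.matched j' hj'.1 hj'.2)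
    simp only [hM.inv r hr, hM.inv r' hr', Nat.add_sub_cancel] at e
    rw [e]

theorem SearchTree.exists_unused (hM : IsMatching m i q p) (hi : i < m)
    (h : SearchTree C m i k q p v used dist way) : ∃ j < m, used j = 0 := by
  by_contra! hne
  have h1 := h.card
  rw [Finset.filter_true_of_mem fun j hj => hne j (Finset.mem_range.1 hj), Finset.card_range] at h1
  have := h.count_le hM
  omega

/-- One step of Dijkstra's algorithm: the unsettled column `b` of least distance is settled, and the
edges of its row `r` are relaxed. The reduced costs of this row are nonnegative, so that no distance
of a settled column changes. -/
theorem SearchTree.step {used' way' : ℕ → ℕ} {dist' : ℕ → ℝ} {b r : ℕ}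
    (hM : IsMatching m i q p) (hT : ∀ r < i, Tight C m v r (q r))
    (h : SearchTree C m i k q p v used dist way) (hb : b < m) (hub : used b = 0)
    (hmin : ∀ j < m, used j = 0 → dist b ≤ dist j) (hp : p b = r + 1)
    (hu' : ∀ j, used' j = if j = b then k + 1 else used j)
    (hd' : ∀ j < m, dist' j = if C r j - v j + (dist b - (C r b - v b)) < dist j then
      C r j - v j + (dist b - (C r b - v b)) else dist j)
    (hw' : ∀ j < m, way' j = if C r j - v j + (dist b - (C r b - v b)) < dist j then r
      else way j) :
    SearchTree C m i (k + 1) q p v used' dist' way' := by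
  obtain ⟨hri, rfl⟩ : r < i ∧ q r = b := by
    obtain ⟨r', hr', e⟩ := hM.surj b hb (by omega)
    have := hM.inv r' hr'
    rw [e, hp] at this
    obtain rfl : r = r' := by omega
    exact ⟨hr', e⟩
  have hne : r ≠ i := hri.ne
  have hcand : ∀ j < m, dist (q r) ≤ C r j - v j + (dist (q r) - (C r (q r) - v (q r))) :=
    fun j hj => by linarith [hT r hri j hj]
  have hsame : ∀ j < m, used' j ≠ 0 → dist' j = dist j ∧ way' j = way j := by
    intro j hj huj
    have hle : dist j ≤ dist (q r) := by
      by_cases e : j = q r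
      · rw [e]
      · rw [hu', if_neg e] at huj
        exact h.settled_le j hj huj _ hb hub
    have : ¬ C r j - v j + (dist (q r) - (C r (q r) - v (q r))) < dist j := by
      linarith [hcand j hj]
    rw [hd' j hj, hw' j hj, if_neg this, if_neg this]
    exact ⟨rfl, rfl⟩
  have hused : ∀ j, used j ≠ 0 → used' j ≠ 0 := by
    intro j hj
    rw [hu']
    split_ifs <;> omega
  have hreach : ∀ r', RowReached i q used r' → RowReached i q used' r' := by
    rintro r' (e | ⟨h1, h2⟩)
    · exact .inl e
    · exact .inr ⟨h1, hused _ h2⟩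
  have hreach' : ∀ r', RowReached i q used' r' → RowReached i q used r' ∨ r' = r := by
    rintro r' (e | ⟨h1, h2⟩)
    · exact .inl (.inl e)
    · by_cases e : q r' = q r
      · have h3 := hM.inv r' h1
        rw [e, hM.inv r hri] at h3
        right; omega
      · rw [hu', if_neg e] at h2
        exact .inl (.inr ⟨h1, h2⟩)
  have hoff : ∀ r', RowReached i q used' r' →
      rowOffset C i q v dist' r' = rowOffset C i q v dist r' := by
    rintro r' (e | ⟨h1, h2⟩)
    · simp [rowOffset, e]
    · simp [rowOffset, (hsame _ (hM.lt r' h1) h2).1]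
  have hoffr : rowOffset C i q v dist r = dist (q r) - (C r (q r) - v (q r)) := by
    simp [rowOffset, hne]
  have hrr : RowReached i q used' r := .inr ⟨hri, by simp [hu']⟩
  constructor
  · intro j hj
    rw [hu']
    split_ifs
    · rfl
    · exact (h.used_le j hj).trans (Nat.le_succ k)
  · have : (Finset.range m).filter (used' · ≠ 0)
        = insert (q r) ((Finset.range m).filter (used · ≠ 0)) := by
      ext j
      simp only [Finset.mem_filter, Finset.mem_range, Finset.mem_insert, hu']
      by_cases e : j = q r
      · simp [e, hb]
      · simp [e]
    rw [this, Finset.card_insert_of_notMem (by simp [hub]), h.card]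
  · intro j hj huj
    by_cases e : j = q r
    · rw [e, hp]; omega
    · rw [hu', if_neg e] at huj
      exact h.matched j hj huj
  · intro j hj
    rw [hw' j hj]
    split_ifs
    · exact hrr
    · exact hreach _ (h.reached j hj)
  · intro j hj
    rw [hw' j hj, hd' j hj]
    split_ifs
    · rw [hoff r hrr, hoffr]; ring
    · rw [hoff _ (hreach _ (h.reached j hj))]
      exact h.dist_eq j hj
  · intro j hj huj
    rw [(hsame j hj huj).2]
    intro hwi
    rcases h.reached j hj with e | ⟨h1, h2⟩
    · exact absurd e hwi
    have h3 : q (way j) ≠ q r := fun e => h2 (e ▸ hub)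
    rw [hu' (q (way j)), if_neg h3, hu']
    split_ifs with e
    · exact Nat.lt_succ_of_le (h.used_le _ (hM.lt _ h1))
    · rw [hu', if_neg e] at huj
      exact h.rank j hj huj hwi
  · intro r' hr' j hj
    rw [hoff r' hr', hd' j hj]
    rcases hreach' r' hr' with h1 | rfl
    · have := h.dist_le r' h1 j hj
      split_ifs <;> linarith
    · rw [hoffr]
      split_ifs <;> linarith
  · intro j hj huj j' hj' huj'
    have hne' : j' ≠ q r := by
      rintro rfl
      simp [hu'] at huj'
    rw [hu', if_neg hne'] at huj'
    rw [(hsame j hj huj).1]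
    have h1 : dist j ≤ dist (q r) := by
      by_cases e : j = q r
      · rw [e]
      · rw [hu', if_neg e] at huj
        exact h.settled_le j hj huj _ hb hub
    have h2 := hmin j' hj' huj'
    have h3 := hcand j' hj'
    rw [hd' j' hj']
    split_ifs <;> linarith

/-- When an unmatched column `b` is nearest, the potentials `v` are lowered at the columns that are
nearer than `b`. Then the old matching and the paths of the search consist of tight entries. -/
theorem SearchTree.augmenting {used' : ℕ → ℕ} {v' : ℕ → ℝ} {b : ℕ}
    (hM : IsMatching m i q p) (hT : ∀ r < i, Tight C m v r (q r))
    (h : SearchTree C m i k q p v used dist way) (hb : b < m) (hub : used b = 0)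
    (hmin : ∀ j < m, used j = 0 → dist b ≤ dist j) (hp : p b = 0)
    (hu' : ∀ j, used' j = if j = b then k + 1 else used j)
    (hv' : ∀ j < m, v' j = if dist j < dist b then v j + (dist j - dist b) else v j) :
    Augmenting C m i v' used' way q p b := by
  have hfree : ∀ r < i, q r ≠ b := by
    intro r hr e
    have := hM.inv r hr
    rw [e, hp] at this
    omega
  have hle : ∀ j < m, used' j ≠ 0 → dist j ≤ dist b := by
    intro j hj huj
    by_cases e : j = b
    · rw [e]
    · rw [hu', if_neg e] at huj
      exact h.settled_le j hj huj _ hb hub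
  have hv1 : ∀ j < m, dist j ≤ dist b → v' j = v j + (dist j - dist b) := by
    intro j hj hj'
    rw [hv' j hj]
    split_ifs
    · rfl
    · linarith
  -- For a reached row, each new reduced cost is at least that of a tree entry.
  have hlow : ∀ r, RowReached i q used r → ∀ j < m,
      dist b - rowOffset C i q v dist r ≤ C r j - v' j := by
    intro r hr j hj
    have := h.dist_le r hr j hj
    rw [hv' j hj]
    split_ifs <;> linarith
  have htree : ∀ j < m, used' j ≠ 0 → Tight C m v' (way j) j := by
    intro j hj huj j' hj'
    have h1 := hlow _ (h.reached j hj) j' hj'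
    have h2 := h.dist_eq j hj
    rw [hv1 j hj (hle j hj huj)]
    linarith
  refine ⟨hM.lt, hM.inv, fun j hj _ => hM.surj j hj, ?_, hb, by simp [hu'], hfree,
    fun j hj huj _ => htree j hj huj, ?_⟩
  · intro r hr
    by_cases hur : used (q r) = 0
    · intro j hj
      have h1 := hmin _ (hM.lt r hr) hur
      have h2 := hT r hr j hj
      rw [hv' _ (hM.lt r hr), if_neg (not_lt.2 h1), hv' j hj]
      split_ifs <;> linarith
    · intro j hj
      have h1 := hlow r (.inr ⟨hr, hur⟩) j hj
      have h2 : used' (q r) ≠ 0 := by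
        rw [hu', if_neg (hfree r hr)]
        exact hur
      rw [hv1 _ (hM.lt r hr) (hle _ (hM.lt r hr) h2)]
      rw [rowOffset, if_neg hr.ne] at h1
      linarith
  · intro j hj huj _
    rcases h.reached j hj with h1 | ⟨h1, h2⟩
    · exact .inl h1
    · refine .inr ⟨h1, ?_⟩
      rw [hu' (q (way j)), if_neg (hfree _ h1)]
      refine ⟨h2, ?_⟩
      rw [hu']
      split_ifs with e
      · exact Nat.lt_succ_of_le (h.used_le _ (hM.lt _ h1))
      · rw [hu', if_neg e] at huj
        exact h.rank j hj huj h1.ne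

/-- A step of the augmentation at a column whose row `way j` is matched already. -/
theorem Augmenting.step {j : ℕ} (h : Augmenting C m i v used way q p j) (hne : way j < i) :
    Augmenting C m i v used way (Function.update q (way j) j) (Function.update p j (way j + 1))
      (q (way j)) ∧ used (q (way j)) < used j := by
  obtain e | ⟨-, hr2, hr3⟩ := h.tree_rank j h.col_lt h.col_used le_rfl
  · omega
  set r := way j with hr
  have hinj : ∀ r' < i, q r' = q r → r' = r := by
    intro r' hr' e
    have := h.inv r' hr'
    rw [e, h.inv r hne] at this
    omega
  refine ⟨⟨?_, ?_, ?_, ?_, h.lt r hne, hr2, ?_, ?_, ?_⟩, hr3⟩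
  · intro r' hr'
    rw [Function.update_apply]
    split_ifs
    · exact h.col_lt
    · exact h.lt r' hr'
  · intro r' hr'
    by_cases e : r' = r
    · simp [e]
    · rw [Function.update_of_ne e, Function.update_of_ne (h.col_free r' hr')]
      exact h.inv r' hr'
  · intro j' hj' hj'r hpj
    by_cases e : j' = j
    · exact ⟨r, hne, by simp [e]⟩
    · rw [Function.update_of_ne e] at hpj
      obtain ⟨r', hr', e'⟩ := h.surj j' hj' e hpj
      have : r' ≠ r := by
        rintro rfl
        exact hj'r e'.symm
      exact ⟨r', hr', by rw [Function.update_of_ne this, e']⟩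
  · intro r' hr'
    by_cases e : r' = r
    · rw [e, Function.update_self]
      exact h.tree_tight j h.col_lt h.col_used le_rfl
    · rw [Function.update_of_ne e]
      exact h.tight r' hr'
  · intro r' hr'
    by_cases e : r' = r
    · rw [e, Function.update_self]
      exact (h.col_free r hne).symm
    · rw [Function.update_of_ne e]
      exact fun e' => e (hinj r' hr' e')
  · exact fun j' hj' h1 h2 => h.tree_tight j' hj' h1 (h2.trans hr3.le)
  · intro j' hj' h1 h2
    rcases h.tree_rank j' hj' h1 (h2.trans hr3.le) with h3 | ⟨h3, h4, h5⟩
    · exact .inl h3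
    · have : way j' ≠ r := by
        intro e
        rw [e] at h5
        omega
      rw [Function.update_of_ne this]
      exact .inr ⟨h3, h4, h5⟩

/-- The last step of the augmentation. -/
theorem Augmenting.finish {j : ℕ} (h : Augmenting C m i v used way q p j) (hi : ¬ way j < i) :
    way j = i ∧ IsMatching m (i + 1) (Function.update q i j) (Function.update p j (i + 1)) ∧
      ∀ r < i + 1, Tight C m v r (Function.update q i j r) := by
  obtain hw | ⟨hr1, -⟩ := h.tree_rank j h.col_lt h.col_used le_rfl
  swap
  · omega
  refine ⟨hw, ⟨?_, ?_, ?_⟩, ?_⟩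
  · intro r hr
    by_cases e : r = i
    · rw [e, Function.update_self]
      exact h.col_lt
    · rw [Function.update_of_ne e]
      exact h.lt r (by omega)
  · intro r hr
    by_cases e : r = i
    · simp [e]
    · rw [Function.update_of_ne e, Function.update_of_ne (h.col_free r (by omega))]
      exact h.inv r (by omega)
  · intro j' hj' hpj
    by_cases e : j' = j
    · exact ⟨i, by omega, by simp [e]⟩
    · rw [Function.update_of_ne e] at hpj
      obtain ⟨r', hr', e'⟩ := h.surj j' hj' e hpj
      exact ⟨r', by omega, by rw [Function.update_of_ne hr'.ne, e']⟩
  · intro r hr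
    by_cases e : r = i
    · rw [e, Function.update_self, ← hw]
      exact h.tree_tight j h.col_lt h.col_used le_rfl
    · rw [Function.update_of_ne e]
      exact h.tight r (by omega)

end

/-! ### The assignment program -/

section
open Instr

/-- Distances and predecessors at the start of the search from the row in register `4`. The program
uses the register `0` for `m`, `2` for the number `0` and `3` for the number `1`. Columns are counted
in register `5`. The matching `q`, its inverse `p`, and `way` and `used` are the natural-number
arrays `3`, `2`, `4` and `5`, the potentials and the distances the real arrays `1` and `2`, and the
costs the real array `cb`. -/
def initSearch (cb : ℕ) : Program :=
  forLoop 5 0 (realLoad 1 cb 4 5 ;; realLoad 2 1 2 5 ;; realSub 1 1 2 ;; realStore 2 2 5 1 ;;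
    natStore 4 2 5 4 ;; natStore 5 2 5 2)

/-- An unsettled column of least distance, in the register `8`, and its distance, in the real
register `3`. The value `m` stands for no column. -/
def findNearest : Program :=
  natAdd 8 0 2 ;;
  forLoop 5 0 (natLoad 10 5 2 5 ;;
    .ite (.natLt 10 3)
      (realLoad 1 2 2 5 ;;
        .ite (.natLt 8 0)
          (.ite (.realLt 1 3) (natAdd 8 5 2 ;; realLoad 3 2 2 5) (natConst 10 0))
          (natAdd 8 5 2 ;; realLoad 3 2 2 5))
      (natConst 10 0))

/-- Relaxation of the edges of the row in register `9`, which is matched with the column in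
register `8`. -/
def relaxRow (cb : ℕ) : Program :=
  (realLoad 4 cb 9 8 ;; realLoad 1 1 2 8 ;; realSub 4 4 1 ;; realSub 4 3 4) ;;
  forLoop 5 0 (realLoad 1 cb 9 5 ;; realLoad 2 1 2 5 ;; realSub 1 1 2 ;; realAdd 1 1 4 ;;
    realLoad 2 2 2 5 ;;
    .ite (.realLt 1 2) (realStore 2 2 5 1 ;; natStore 4 2 5 9) (natConst 10 0))

/-- Change of the potentials at the columns nearer than the value of the real register `3`. -/
def updatePotentials : Program :=
  forLoop 5 0 (realLoad 1 2 2 5 ;;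
    .ite (.realLt 1 3)
      (realSub 1 1 3 ;; realLoad 2 1 2 5 ;; realAdd 1 2 1 ;; realStore 1 2 5 1)
      (natConst 10 0))

/-- Change of the matching along the path that ends in the column in register `8`. -/
def augmentPath : Program :=
  natConst 6 0 ;;
  .loop (.natLt 6 3) (natLoad 9 4 2 8 ;; natLoad 11 3 2 9 ;; natStore 3 2 9 8 ;; natAdd 10 9 3 ;;
    natStore 2 2 8 10 ;; .ite (.natLt 9 4) (natAdd 8 11 2) (natConst 6 1))

/-- Search for a shortest augmenting path. The register `7` counts the settled columns. -/
def searchPath (cb : ℕ) : Program :=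
  (natConst 6 0 ;; natConst 7 0) ;;
  .loop (.natLt 6 3) (findNearest ;; (natAdd 7 7 3 ;; natStore 5 2 8 7 ;; natLoad 9 2 2 8) ;;
    .ite (.natLt 9 3) (natConst 6 1) (natSub 9 9 3 ;; relaxRow cb))

/-- A minimum-cost assignment, found row by row. -/
def assignRows (cb : ℕ) : Program :=
  forLoop 4 0 (initSearch cb ;; searchPath cb ;; updatePotentials ;; augmentPath)

end

/-- The registers with fixed contents. -/
structure Consts (m : ℕ) (s : State) : Prop where
  size : s.natReg 0 = m
  zero : s.natReg 2 = 0
  one : s.natReg 3 = 1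

theorem Consts.of_frame {m : ℕ} {p : Program} {s s' : State} (h : Consts m s) (hF : Frame p s s')
    (h0 : p.any (·.writesNatReg 0) = false) (h2 : p.any (·.writesNatReg 2) = false)
    (h3 : p.any (·.writesNatReg 3) = false) : Consts m s' :=
  ⟨(hF.natReg 0 h0).trans h.size, (hF.natReg 2 h2).trans h.zero, (hF.natReg 3 h3).trans h.one⟩

theorem initSearch_runs {cb : ℕ} (hcb : cb ≠ 2) {m : ℕ} {s : State} (hs : Consts m s) :
    Runs (initSearch cb) s (m * 8 + 2) (fun s' =>
      (∀ j < m, s'.natArr 5 0 j = 0 ∧ s'.natArr 4 0 j = s.natReg 4 ∧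
        s'.realArr 2 0 j = s.realArr cb (s.natReg 4) j - s.realArr 1 0 j) ∧
      Frame (initSearch cb) s s') := by
  refine Runs.forLoop (fun k s' => ∀ j < k, s'.natArr 5 0 j = 0 ∧
    s'.natArr 4 0 j = s.natReg 4 ∧
    s'.realArr 2 0 j = s.realArr cb (s.natReg 4) j - s.realArr 1 0 j) rfl rfl rfl
    hs.size hs.one (by simp) ?_
  intro k s' hk hI hx hF
  have hc := hs.of_frame hF rfl rfl rfl
  have h4 := hF.natReg 4 rfl
  have ha := hF.realArr 1 rfl
  have hb := hF.realArr cb (by simpa [forLoop, Program.any, Instr.writesRealArr] using hcb.symm)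
  refine Runs.of_eval 6 rfl (Nat.le_of_ble_eq_true rfl) ?_
  intro j hj
  simp only [Program.eval, Instr.apply, State.setNat]
  simp [hc.zero, hx, h4, ha, hb, setEntry_ne]
  by_cases e : j = k
  · simp [e]
  · simpa [e] using hI j (by omega)

/-- The register `8` holds the nearest unsettled column found so far, where the value `m` says that
there was none yet. -/
theorem findNearest_runs {m : ℕ} {s : State} (hs : Consts m s)
    (hex : ∃ j < m, s.natArr 5 0 j = 0) :
    Runs findNearest s (m * 13 + 3) (fun s' =>
      (s'.natReg 8 < m ∧ s.natArr 5 0 (s'.natReg 8) = 0 ∧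
        s'.realReg 3 = s.realArr 2 0 (s'.natReg 8) ∧
        ∀ j < m, s.natArr 5 0 j = 0 → s.realArr 2 0 (s'.natReg 8) ≤ s.realArr 2 0 j) ∧
      Frame findNearest s s') := by
  refine Runs.frame ?_
  have hs1 : Runs (Instr.natAdd 8 0 2) s 1 (fun s' => s'.natReg 8 = m ∧
      Frame (Instr.natAdd 8 0 2) s s') :=
    (Runs.of_eval 1 rfl le_rfl (by simp [Program.eval, Instr.apply, hs.zero, hs.size])).frame
  refine (hs1.seq (B' := m * 13 + 2) ?_).mono (by omega) fun _ h => h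
  rintro s1 ⟨h8, hF1⟩
  have hc1 := hs.of_frame hF1 rfl rfl rfl
  have e5 := hF1.natArr 5 rfl
  have e2 := hF1.realArr 2 rfl
  refine (Runs.forLoop (B := 11) (fun k s' =>
    (s'.natReg 8 = m ∧ ∀ j < k, s.natArr 5 0 j ≠ 0) ∨
    (s'.natReg 8 < m ∧ s.natArr 5 0 (s'.natReg 8) = 0 ∧
        s'.realReg 3 = s.realArr 2 0 (s'.natReg 8) ∧
        ∀ j < k, s.natArr 5 0 j = 0 → s.realArr 2 0 (s'.natReg 8) ≤ s.realArr 2 0 j)) rfl rfl rfl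
    hc1.size hc1.one (by simp [State.setNat, h8]) ?_).mono le_rfl ?_
  · intro k s' hk hI hx hF
    have hc := hc1.of_frame hF rfl rfl rfl
    have h5 := (hF.natArr 5 rfl).trans e5
    have h2 := (hF.realArr 2 rfl).trans e2
    refine Runs.of_eval 11 rfl (Nat.le_of_ble_eq_true rfl) ?_
    simp only [Program.eval, Instr.apply, State.setNat, Test.Holds]
    have hstep : ∀ j, j ≤ k → j < k ∨ j = k := by omega
    by_cases hu : s.natArr 5 0 k = 0
    · by_cases hm : s'.natReg 8 < m
      · obtain ⟨-, h6, h7, h9⟩ := hI.resolve_left (by omega)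
        by_cases hlt : s.realArr 2 0 k < s.realArr 2 0 (s'.natReg 8)
        · right
          simp [hc.zero, hc.one, hc.size, hx, h5, h2, hu, hm, h7, hlt, hk]
          intro j hj huj
          rcases hstep j hj with h | rfl
          · exact hlt.le.trans (h9 j h huj)
          · exact le_rfl
        · right
          simp [hc.zero, hc.one, hc.size, hx, h5, h2, hu, hm, h7, hlt, h6]
          intro j hj huj
          rcases hstep j hj with h | rfl
          · exact h9 j h huj
          · exact not_lt.1 hlt
      · obtain ⟨h6, h7⟩ := hI.resolve_right (by omega)
        right
        simp [hc.zero, hc.one, hc.size, hx, h5, h2, hu, hm, hk]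
        intro j hj huj
        rcases hstep j hj with h | rfl
        · exact absurd huj (h7 j h)
        · exact le_rfl
    · simp [hc.zero, hc.one, hx, h5, hu]
      rcases hI with ⟨h6, h7⟩ | ⟨h6, h7, h8, h9⟩
      · refine .inl ⟨h6, fun j hj => ?_⟩
        rcases hstep j hj with h | rfl
        · exact h7 j h
        · exact hu
      · refine .inr ⟨h6, h7, h8, fun j hj huj => ?_⟩
        rcases hstep j hj with h | rfl
        · exact h9 j h huj
        · exact absurd huj hu
  · rintro s' ⟨⟨-, h⟩ | h, -⟩
    · obtain ⟨j, hj, huj⟩ := hex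
      exact absurd huj (h j hj)
    · exact h

theorem relaxRow_runs {cb : ℕ} (hcb : cb ≠ 2) {m : ℕ} {s : State} (hs : Consts m s) :
    Runs (relaxRow cb) s (m * 11 + 6) (fun s' =>
      (∀ j < m,
        s'.realArr 2 0 j = (if s.realArr cb (s.natReg 9) j - s.realArr 1 0 j +
          (s.realReg 3 - (s.realArr cb (s.natReg 9) (s.natReg 8) - s.realArr 1 0 (s.natReg 8)))
            < s.realArr 2 0 j then
          s.realArr cb (s.natReg 9) j - s.realArr 1 0 j +
          (s.realReg 3 - (s.realArr cb (s.natReg 9) (s.natReg 8) - s.realArr 1 0 (s.natReg 8)))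
          else s.realArr 2 0 j) ∧
        s'.natArr 4 0 j = (if s.realArr cb (s.natReg 9) j - s.realArr 1 0 j +
          (s.realReg 3 - (s.realArr cb (s.natReg 9) (s.natReg 8) - s.realArr 1 0 (s.natReg 8)))
            < s.realArr 2 0 j then s.natReg 9 else s.natArr 4 0 j)) ∧
      Frame (relaxRow cb) s s') := by
  refine Runs.frame ?_
  set r := s.natReg 9 with hr
  set D := s.realReg 3 - (s.realArr cb r (s.natReg 8) - s.realArr 1 0 (s.natReg 8)) with hD
  refine (Runs.seq (R := fun s' => s'.realReg 4 = D ∧ Frame (Instr.realLoad 4 cb 9 8 ;;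
      Instr.realLoad 1 1 2 8 ;; Instr.realSub 4 4 1 ;; Instr.realSub 4 3 4) s s')
    (Runs.of_eval 4 rfl (Nat.le_of_ble_eq_true rfl) ?_).frame (B' := m * 11 + 2) ?_).mono
      (by omega) fun _ h => h
  · simp [Program.eval, Instr.apply, hs.zero, hD, hr]
  rintro s1 ⟨h4, hF1⟩
  have hc1 := hs.of_frame hF1 rfl rfl rfl
  have a9 := hF1.natReg 9 rfl
  have a1 := hF1.realArr 1 rfl
  have a2 := hF1.realArr 2 rfl
  have ab := hF1.realArr cb rfl
  have a4 := hF1.natArr 4 rfl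
  refine (Runs.forLoop (B := 9) (fun k s' => ∀ j,
    s'.realArr 2 0 j = (if j < k ∧ s.realArr cb r j - s.realArr 1 0 j + D < s.realArr 2 0 j then
      s.realArr cb r j - s.realArr 1 0 j + D else s.realArr 2 0 j) ∧
    s'.natArr 4 0 j = (if j < k ∧ s.realArr cb r j - s.realArr 1 0 j + D < s.realArr 2 0 j then r
      else s.natArr 4 0 j)) rfl rfl rfl
    hc1.size hc1.one (by simp [State.setNat, a2, a4]) ?_).mono le_rfl ?_
  · intro k s' hk hI hx hF
    have hc := hc1.of_frame hF rfl rfl rfl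
    have b9 := (hF.natReg 9 rfl).trans a9
    have b1 := (hF.realArr 1 rfl).trans a1
    have b4 := (hF.realReg 4 rfl).trans h4
    have bb := (hF.realArr cb
      (by simpa [forLoop, Program.any, Instr.writesRealArr] using hcb.symm)).trans ab
    have hk2 : s'.realArr 2 0 k = s.realArr 2 0 k := by simpa using (hI k).1
    refine Runs.of_eval 9 rfl (Nat.le_of_ble_eq_true rfl) ?_
    intro j
    simp only [Program.eval, Instr.apply, State.setNat, Test.Holds]
    by_cases hlt : s.realArr cb r k - s.realArr 1 0 k + D < s.realArr 2 0 k
    · by_cases e : j = k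
      · subst e
        simp [hc.zero, hx, b1, b4, bb, b9, hk2, hlt, ← hr]
      · have e' : j < k + 1 ↔ j < k := by omega
        simpa [hc.zero, hx, b1, b4, bb, b9, hk2, hlt, ← hr, e, e'] using hI j
    · by_cases e : j = k
      · subst e
        simpa [hc.zero, hx, b1, b4, bb, b9, hk2, hlt, ← hr] using hI j
      · have e' : j < k + 1 ↔ j < k := by omega
        simpa [hc.zero, hx, b1, b4, bb, b9, hk2, hlt, ← hr, e, e'] using hI j
  · rintro s' ⟨h, -⟩ j hj
    simpa [hj] using h j

theorem updatePotentials_runs {m : ℕ} {s : State} (hs : Consts m s) :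
    Runs updatePotentials s (m * 9 + 2) (fun s' =>
      (∀ j < m, s'.realArr 1 0 j = if s.realArr 2 0 j < s.realReg 3 then
        s.realArr 1 0 j + (s.realArr 2 0 j - s.realReg 3) else s.realArr 1 0 j) ∧
      Frame updatePotentials s s') := by
  refine (Runs.forLoop (B := 7) (fun k s' => ∀ j, s'.realArr 1 0 j =
      if j < k ∧ s.realArr 2 0 j < s.realReg 3 then
        s.realArr 1 0 j + (s.realArr 2 0 j - s.realReg 3) else s.realArr 1 0 j) rfl rfl rfl
    hs.size hs.one (by simp [State.setNat]) ?_).mono le_rfl ?_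
  · intro k s' hk hI hx hF
    have hc := hs.of_frame hF rfl rfl rfl
    have a3 := hF.realReg 3 rfl
    have a2 := hF.realArr 2 rfl
    have hk1 : s'.realArr 1 0 k = s.realArr 1 0 k := by simpa using hI k
    refine Runs.of_eval 7 rfl (Nat.le_of_ble_eq_true rfl) ?_
    intro j
    simp only [Program.eval, Instr.apply, State.setNat, Test.Holds]
    by_cases hlt : s.realArr 2 0 k < s.realReg 3
    · by_cases e : j = k
      · subst e
        simp [hc.zero, hx, a2, a3, hk1, hlt]
      · have e' : j < k + 1 ↔ j < k := by omega
        simpa [hc.zero, hx, a2, a3, hk1, hlt, e, e'] using hI j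
    · by_cases e : j = k
      · subst e
        simpa [hc.zero, hx, a2, a3, hlt] using hI j
      · have e' : j < k + 1 ↔ j < k := by omega
        simpa [hc.zero, hx, a2, a3, hlt, e, e'] using hI j
  · rintro s' ⟨h, hF⟩
    exact ⟨fun j hj => by simpa [hj] using h j, hF⟩

/-- The order of settlement, stored in the array `5`, decreases along the path back to the root, so
the path has at most `m` columns. -/
theorem augmentPath_runs {C : ℕ → ℕ → ℝ} {v : ℕ → ℝ} {m i : ℕ} {s : State} (hs : Consts m s)
    (hi : s.natReg 4 = i) (hm : s.natArr 5 0 (s.natReg 8) ≤ m)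
    (h : Augmenting C m i v (s.natArr 5 0) (s.natArr 4 0) (s.natArr 3 0) (s.natArr 2 0)
      (s.natReg 8)) :
    Runs augmentPath s (m * 9 + 2) (fun s' =>
      (IsMatching m (i + 1) (s'.natArr 3 0) (s'.natArr 2 0) ∧
        ∀ r < i + 1, Tight C m v r (s'.natArr 3 0 r)) ∧ Frame augmentPath s s') := by
  refine Runs.frame ?_
  refine (Runs.seq (Q := fun s' => IsMatching m (i + 1) (s'.natArr 3 0) (s'.natArr 2 0) ∧
        ∀ r < i + 1, Tight C m v r (s'.natArr 3 0 r)) (B' := s.natArr 5 0 (s.natReg 8) * 9 + 1)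
    (R := fun s' => s'.natReg 6 = 0 ∧ Frame (Instr.natConst 6 0) s s')
    (Runs.of_eval 1 rfl le_rfl ?_).frame ?_).mono (by omega) fun _ h => h
  · simp [Program.eval, Instr.apply]
  rintro s1 ⟨h6, hF1⟩
  have hc1 := hs.of_frame hF1 rfl rfl rfl
  have a4 := hF1.natArr 4 rfl
  have a5 := hF1.natArr 5 rfl
  have a3 := hF1.natArr 3 rfl
  have a2 := hF1.natArr 2 rfl
  have a8 := hF1.natReg 8 rfl
  have ai := (hF1.natReg 4 rfl).trans hi
  -- The register `6` says whether the root row has received its new column.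
  refine (Runs.while (B := 8) (fun k s' =>
    (s'.natReg 6 = 0 ∧ k = s.natArr 5 0 (s'.natReg 8) ∧ Augmenting C m i v (s.natArr 5 0)
      (s.natArr 4 0) (s'.natArr 3 0) (s'.natArr 2 0) (s'.natReg 8)) ∨
    (s'.natReg 6 = 1 ∧ k = 0 ∧ IsMatching m (i + 1) (s'.natArr 3 0) (s'.natArr 2 0) ∧
        ∀ r < i + 1, Tight C m v r (s'.natArr 3 0 r))) (k := s.natArr 5 0 (s.natReg 8))
    (.inl ⟨h6, by rw [a8], by rwa [a2, a3, a8]⟩) ?_).mono le_rfl ?_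
  · intro k s' hI hF hb
    have hc := hc1.of_frame hF rfl rfl rfl
    have b4 := (hF.natArr 4 rfl).trans a4
    have bi := (hF.natReg 4 rfl).trans ai
    obtain ⟨h6', rfl, hA⟩ := hI.resolve_right fun hI => by
      have : s'.natReg 6 < s'.natReg 3 := hb
      rw [hI.1, hc.one] at this
      omega
    refine Runs.of_eval 8 rfl (Nat.le_of_ble_eq_true rfl) ?_
    simp only [Program.eval, Instr.apply, Test.Holds]
    by_cases hlt : s.natArr 4 0 (s'.natReg 8) < i
    · obtain ⟨h1, h2⟩ := hA.step hlt
      refine ⟨_, h2, .inl ?_⟩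
      simpa [hc.zero, hc.one, b4, bi, hlt, h6', setEntry_ne] using h1
    · obtain ⟨hw, h1, h2⟩ := hA.finish hlt
      refine ⟨0, Nat.pos_of_ne_zero hA.col_used, .inr ?_⟩
      have h12 := And.intro h1 h2
      simpa [hc.zero, hc.one, b4, bi, setEntry_ne, hw] using h12
  · rintro s' ⟨⟨k, hI⟩, hb, hF⟩
    have hc := hc1.of_frame hF rfl rfl rfl
    rcases hI with hI | hI
    · refine absurd ?_ hb
      simp [Test.Holds, hI.1, hc.one]
    · exact hI.2.2

/-- The result of a completed search: `used` marks the settled columns, and the column `b` is the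
nearest unsettled one, which is unmatched. -/
def SearchDone (C : ℕ → ℕ → ℝ) (m i : ℕ) (q p : ℕ → ℕ) (v : ℕ → ℝ) (used' : ℕ → ℕ)
    (dist : ℕ → ℝ) (way : ℕ → ℕ) (b : ℕ) (D : ℝ) : Prop :=
  ∃ k used, SearchTree C m i k q p v used dist way ∧ b < m ∧ used b = 0 ∧
    (∀ j < m, used j = 0 → dist b ≤ dist j) ∧ p b = 0 ∧
    used' = Function.update used b (k + 1) ∧ D = dist b

/-- Every round either ends the search or settles a further matched column. At most `m` rounds are
possible, and each takes `O(m)` steps. -/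
theorem searchPath_runs {cb : ℕ} (hcb : cb ≠ 2) {m i : ℕ} {s : State} (hs : Consts m s)
    (hi : i < m) (hM : IsMatching m i (s.natArr 3 0) (s.natArr 2 0))
    (hT : ∀ r < i, Tight (s.realArr cb) m (s.realArr 1 0) r (s.natArr 3 0 r))
    (h : SearchTree (s.realArr cb) m i 0 (s.natArr 3 0) (s.natArr 2 0) (s.realArr 1 0)
      (s.natArr 5 0) (s.realArr 2 0) (s.natArr 4 0)) :
    Runs (searchPath cb) s (m * (m * 24 + 15) + 3) (fun s' =>
      SearchDone (s.realArr cb) m i (s.natArr 3 0) (s.natArr 2 0) (s.realArr 1 0)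
        (s'.natArr 5 0) (s'.realArr 2 0) (s'.natArr 4 0) (s'.natReg 8) (s'.realReg 3) ∧
      Frame (searchPath cb) s s') := by
  refine Runs.frame ?_
  set SD := fun s' : State => SearchDone (s.realArr cb) m i (s.natArr 3 0) (s.natArr 2 0)
    (s.realArr 1 0) (s'.natArr 5 0) (s'.realArr 2 0) (s'.natArr 4 0) (s'.natReg 8) (s'.realReg 3)
    with hSD
  refine (Runs.seq (Q := SD) (B' := m * ((m * 24 + 14) + 1) + 1)
    (R := fun s' => (s'.natReg 6 = 0 ∧ s'.natReg 7 = 0) ∧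
      Frame (Instr.natConst 6 0 ;; Instr.natConst 7 0) s s')
    (Runs.of_eval 2 rfl le_rfl ?_).frame ?_).mono (by linarith) fun _ h => h
  · simp [Program.eval, Instr.apply]
  rintro s1 ⟨⟨h6, h7⟩, hF1⟩
  have hc1 := hs.of_frame hF1 rfl rfl rfl
  have a2 := hF1.natArr 2 rfl
  have a3 := hF1.natArr 3 rfl
  have a4 := hF1.natArr 4 rfl
  have a5 := hF1.natArr 5 rfl
  have r1 := hF1.realArr 1 rfl
  have r2 := hF1.realArr 2 rfl
  have rb := hF1.realArr cb rfl
  -- The register `6` says whether the search is over, and `7` counts the settled columns.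
  refine (Runs.while (B := m * 24 + 14) (fun f s' =>
    (s'.natReg 6 = 0 ∧ f = m - s'.natReg 7 ∧ SearchTree (s.realArr cb) m i (s'.natReg 7)
      (s.natArr 3 0) (s.natArr 2 0) (s.realArr 1 0)
      (s'.natArr 5 0) (s'.realArr 2 0) (s'.natArr 4 0)) ∨
    (s'.natReg 6 = 1 ∧ f = 0 ∧ SD s')) (k := m)
    (.inl ⟨h6, by simp [h7], by rwa [h7, a4, a5, r2]⟩) ?_).mono le_rfl ?_
  · intro f s' hI hF hb
    have hc := hc1.of_frame hF rfl rfl rfl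
    have b2 := (hF.natArr 2 rfl).trans a2
    have b3 := (hF.natArr 3 rfl).trans a3
    have b1 := (hF.realArr 1 rfl).trans r1
    have bb := (hF.realArr cb
      (by simpa [forLoop, Program.any, Instr.writesRealArr, findNearest, relaxRow]
        using hcb.symm)).trans rb
    obtain ⟨h6', rfl, hA⟩ := hI.resolve_right fun hI => by
      have : s'.natReg 6 < s'.natReg 3 := hb
      rw [hI.1, hc.one] at this
      omega
    have hk := hA.count_le hM
    refine (Runs.seq (findNearest_runs hc (hA.exists_unused hM hi)) (B' := 3 + (m * 11 + 8))
      ?_).mono (by omega) fun _ h => h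
    rintro s2 ⟨⟨hbm, hub, hD, hmin⟩, hF2⟩
    have hc2 := hc.of_frame hF2 rfl rfl rfl
    have c2 := (hF2.natArr 2 rfl).trans b2
    have c3 := (hF2.natArr 3 rfl).trans b3
    have c4 := hF2.natArr 4 rfl
    have c5 := hF2.natArr 5 rfl
    have d1 := (hF2.realArr 1 rfl).trans b1
    have d2 := hF2.realArr 2 rfl
    have db := (hF2.realArr cb rfl).trans bb
    have c7 := hF2.natReg 7 rfl
    have c6 := hF2.natReg 6 rfl
    set b := s2.natReg 8 with hbdef
    refine Runs.seq (R := fun s3 => (s3.natReg 7 = s'.natReg 7 + 1 ∧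
        s3.natArr 5 0 = Function.update (s'.natArr 5 0) b (s'.natReg 7 + 1) ∧
        s3.natReg 9 = s.natArr 2 0 b) ∧
        Frame (Instr.natAdd 7 7 3 ;; Instr.natStore 5 2 8 7 ;; Instr.natLoad 9 2 2 8) s2 s3)
      (Runs.of_eval 3 rfl le_rfl ?_).frame ?_
    · simp [Program.eval, Instr.apply, hc2.zero, hc2.one, c2, c5, c7, setEntry_ne, hbdef]
    rintro s3 ⟨⟨e7, e5, e9⟩, hF3⟩
    have hc3 := hc2.of_frame hF3 rfl rfl rfl
    have f4 := (hF3.natArr 4 rfl).trans c4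
    have g1 := (hF3.realArr 1 rfl).trans d1
    have g2 := (hF3.realArr 2 rfl).trans d2
    have gb := (hF3.realArr cb rfl).trans db
    have f8 := hF3.natReg 8 rfl
    have f6 := (hF3.natReg 6 rfl).trans (c6.trans h6')
    have g3 := (hF3.realReg 3 rfl).trans hD
    rw [← hbdef] at f8
    refine Runs.ite (B := m * 11 + 7) ?_ ?_
    · intro hlt
      have hp : s.natArr 2 0 b = 0 := by
        have : s3.natReg 9 < s3.natReg 3 := hlt
        rw [hc3.one, e9] at this
        omega
      refine Runs.of_eval _ rfl (by simp [Program.size]) ?_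
      refine ⟨0, by omega, .inr ⟨by simp [Program.eval, Instr.apply], rfl,
        s'.natReg 7, s'.natArr 5 0, ?_⟩⟩
      simp only [Program.eval, Instr.apply]
      simp only [show (8 : ℕ) ≠ 6 by decide, Function.update_of_ne, ne_eq, not_false_eq_true]
      rw [f4, g2, f8, e5, g3]
      exact ⟨hA, hbm, hub, hmin, hp, rfl, rfl⟩
    · intro hlt
      obtain ⟨r, hr⟩ : ∃ r, s.natArr 2 0 b = r + 1 := by
        refine Nat.exists_eq_succ_of_ne_zero fun h0 => hlt ?_
        simp [Test.Holds, e9, h0, hc3.one]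
      refine (Runs.seq (R := fun s4 => s4.natReg 9 = r ∧ Frame (Instr.natSub 9 9 3) s3 s4)
        (Runs.of_eval 1 rfl le_rfl ?_).frame
        (B' := m * 11 + 6) ?_).mono (by omega) fun _ h => h
      · simp [Program.eval, Instr.apply, e9, hr, hc3.one]
      rintro s4 ⟨h9, hF4⟩
      have hc4 := hc3.of_frame hF4 rfl rfl rfl
      refine (relaxRow_runs hcb hc4).mono le_rfl ?_
      rintro s5 ⟨h5, hF5⟩
      have i4 := (hF4.natArr 4 rfl).trans f4
      have i5 := (congrFun (hF5.natArr 5 rfl) 0).trans ((congrFun (hF4.natArr 5 rfl) 0).trans e5)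
      have j1 := (hF4.realArr 1 rfl).trans g1
      have j2 := (hF4.realArr 2 rfl).trans g2
      have jb := (hF4.realArr cb rfl).trans gb
      have i8 := (hF4.natReg 8 rfl).trans f8
      have j3 := (hF4.realReg 3 rfl).trans g3
      have i6 := (hF5.natReg 6 rfl).trans ((hF4.natReg 6 rfl).trans f6)
      have i7 := (hF5.natReg 7 rfl).trans ((hF4.natReg 7 rfl).trans e7)
      simp only [i4, j1, j2, jb, i8, j3, h9] at h5
      refine ⟨m - s5.natReg 7, by omega, .inl ⟨i6, rfl, ?_⟩⟩
      rw [i7]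
      refine hA.step hM hT hbm hub hmin hr ?_ (fun j hj => (h5 j hj).1) (fun j hj => (h5 j hj).2)
      intro j
      rw [i5, Function.update_apply]
  · rintro s' ⟨⟨k, hI⟩, hb, hF⟩
    have hc := hc1.of_frame hF rfl rfl rfl
    rcases hI with hI | hI
    · refine absurd ?_ hb
      simp [Test.Holds, hI.1, hc.one]
    · exact hI.2.2

/-- The assignment program computes a matching of all rows with tight entries. -/
theorem assignRows_runs {cb : ℕ} (hcb1 : cb ≠ 1) (hcb2 : cb ≠ 2) {m : ℕ} {s : State}
    (hs : Consts m s) (hp : ∀ j < m, s.natArr 2 0 j = 0) :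
    Runs (assignRows cb) s (m * (m * (m * 24 + 41) + 11) + 2) (fun s' =>
      (IsMatching m m (s'.natArr 3 0) (s'.natArr 2 0) ∧
        ∀ r < m, Tight (s.realArr cb) m (s'.realArr 1 0) r (s'.natArr 3 0 r)) ∧
      Frame (assignRows cb) s s') := by
  refine (Runs.forLoop (B := m * (m * 24 + 41) + 9) (fun i s' =>
      IsMatching m i (s'.natArr 3 0) (s'.natArr 2 0) ∧
        ∀ r < i, Tight (s.realArr cb) m (s'.realArr 1 0) r (s'.natArr 3 0 r)) rfl rfl rfl
    hs.size hs.one ⟨⟨by simp, by simp, ?_⟩, by simp⟩ ?_).mono le_rfl fun _ h => h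
  · intro j hj hne
    exact absurd (hp j hj) hne
  intro i s0 hi ⟨hM, hT⟩ h4 hF0
  have hc0 := hs.of_frame hF0 rfl rfl rfl
  have b0 := hF0.realArr cb (by
    simp [forLoop, Program.any, Instr.writesRealArr, findNearest, relaxRow, initSearch, searchPath,
      updatePotentials, augmentPath, hcb1.symm, hcb2.symm])
  refine ((initSearch_runs hcb2 hc0).seq
    (B' := (m * (m * 24 + 15) + 3) + ((m * 9 + 2) + (m * 9 + 2))) ?_).mono
    (by nlinarith) fun _ h => h
  rintro s1 ⟨h1, hF1⟩
  have hc1 := hc0.of_frame hF1 rfl rfl rfl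
  have b1 := (hF1.realArr cb (by
    simpa [forLoop, Program.any, Instr.writesRealArr, initSearch] using hcb2.symm)).trans b0
  have q1 := hF1.natArr 3 rfl
  have p1 := hF1.natArr 2 rfl
  have v1 := hF1.realArr 1 rfl
  have i1 := (hF1.natReg 4 rfl).trans h4
  rw [← q1, ← p1] at hM
  rw [← q1, ← v1, ← b1] at hT
  rw [h4, b0, ← b1, ← v1] at h1
  refine Runs.seq (searchPath_runs hcb2 hc1 hi hM hT (SearchTree.init hM (fun j hj => (h1 j hj).1)
    (fun j hj => (h1 j hj).2.1) (fun j hj => (h1 j hj).2.2))) ?_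
  rintro s2 ⟨⟨k, used, hS, hbm, hub, hmin, hpb, hu, hD⟩, hF2⟩
  have hc2 := hc1.of_frame hF2 rfl rfl rfl
  have q2 := hF2.natArr 3 rfl
  have p2 := hF2.natArr 2 rfl
  have v2 := hF2.realArr 1 rfl
  have i2 := (hF2.natReg 4 rfl).trans i1
  refine Runs.seq (updatePotentials_runs hc2) ?_
  rintro s3 ⟨h3, hF3⟩
  have hc3 := hc2.of_frame hF3 rfl rfl rfl
  have q3 := (hF3.natArr 3 rfl).trans q2
  have p3 := (hF3.natArr 2 rfl).trans p2
  have w3 := hF3.natArr 4 rfl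
  have u3 := hF3.natArr 5 rfl
  have i3 := (hF3.natReg 4 rfl).trans i2
  have e3 := hF3.natReg 8 rfl
  rw [v2, hD] at h3
  have hA := hS.augmenting (used' := s2.natArr 5 0) hM hT hbm hub hmin hpb
    (fun j => by rw [hu, Function.update_apply]) h3
  have hk := hS.count_le hM
  refine (augmentPath_runs (C := s.realArr cb) (v := s3.realArr 1 0) hc3 i3 ?_ ?_).mono le_rfl ?_
  · rw [e3, u3, hu, Function.update_self]
    omega
  · rw [u3, w3, q3, p3, e3, ← b1]
    exact hA
  · rintro s4 ⟨h, hF4⟩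
    have v4 := hF4.realArr 1 rfl
    simpa [State.setNat, v4] using h

/-- Output of the matrix with the nonzero entries `(i, q i)`. -/
def writeMatching : Program :=
  forLoop 4 0 (Instr.natLoad 8 3 2 4 ;; Instr.natStore 1 4 8 3)

/-- The program for the assignment problem. -/
def assignmentProgram : Program :=
  Instr.natConst 3 1 ;; assignRows 0 ;; writeMatching

theorem writeMatching_runs {m : ℕ} {s : State} (hs : Consts m s) (h1 : s.natArr 1 = 0) :
    Runs writeMatching s (m * 4 + 2) (fun s' =>
      ∀ i j, s'.natArr 1 i j = if i < m ∧ s.natArr 3 0 i = j then 1 else 0) := by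
  refine (Runs.forLoop (B := 2) (fun k s' => ∀ i j, s'.natArr 1 i j =
    if i < k ∧ s.natArr 3 0 i = j then 1 else 0) rfl rfl rfl hs.size hs.one
    (by simp [State.setNat, h1]) ?_).mono le_rfl fun _ h => h.1
  intro k s' hk hI hx hF
  have hc := hs.of_frame hF rfl rfl rfl
  have h3 := hF.natArr 3 rfl
  refine Runs.of_eval 2 rfl (Nat.le_of_ble_eq_true rfl) ?_
  intro i j
  simp only [Program.eval, Instr.apply, State.setNat]
  by_cases e : i = k
  · subst e
    have := hI i j
    simp only [lt_irrefl, false_and, if_false] at this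
    by_cases e2 : s.natArr 3 0 i = j
    · simp [hc.zero, hc.one, hx, h3, e2]
    · simp [hc.zero, hc.one, hx, h3, e2, this, Ne.symm e2]
  · have e' : i < k + 1 ↔ i < k := by omega
    simpa [hc.zero, hc.one, hx, h3, e', setEntry_row_ne _ _ _ _ _ e] using hI i j

/-- A matching of all rows is a permutation. -/
theorem IsMatching.exists_perm {m : ℕ} {q p : ℕ → ℕ} (h : IsMatching m m q p) :
    ∃ τ : Equiv.Perm (Fin m), ∀ i, (τ i : ℕ) = q i := by
  let f : Fin m → Fin m := fun i => ⟨q i, h.lt i i.2⟩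
  have hf : Function.Injective f := by
    intro i i' e
    have e1 : q i = q i' := congrArg Fin.val e
    have e2 := h.inv i i.2
    rw [e1, h.inv i' i'.2] at e2
    exact Fin.ext (by omega)
  exact ⟨Equiv.ofBijective f (Finite.injective_iff_bijective.1 hf), fun i => rfl⟩

theorem arrayOf_apply {α : Type} [Zero α] {m n : ℕ} (M : Matrix (Fin m) (Fin n) α)
    (i : Fin m) (j : Fin n) : arrayOf M 0 i j = M i j := by
  simp [arrayOf]

theorem assignmentProgram_runs {m : ℕ} (C : Matrix (Fin m) (Fin m) ℝ) :
    Runs assignmentProgram (assignmentInput C) (1000 * (m ^ 3 + 1))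
      (fun s => IsOptimalAssignment C (output m m s)) := by
  refine (Runs.seq (R := fun s' => s'.natReg 3 = 1 ∧
      Frame (Instr.natConst 3 1) (assignmentInput C) s')
    (Runs.of_eval 1 rfl le_rfl ?_).frame
    (B' := (m * (m * (m * 24 + 41) + 11) + 2) + (m * 4 + 2)) ?_).mono ?_ fun _ h => h
  · simp [Program.eval, Instr.apply]
  swap
  · have h1 : m ≤ m ^ 3 := Nat.le_self_pow (by norm_num) m
    have h2 : m ^ 2 ≤ m ^ 3 := by
      rcases Nat.eq_zero_or_pos m with rfl | h
      · simp
      · exact Nat.pow_le_pow_right h (by norm_num)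
    nlinarith
  rintro s1 ⟨h3, hF1⟩
  have hc1 : Consts m s1 := ⟨by rw [hF1.natReg 0 rfl]; simp [assignmentInput],
    by rw [hF1.natReg 2 rfl]; simp [assignmentInput], h3⟩
  refine Runs.seq (assignRows_runs (by norm_num) (by norm_num) hc1
    (by rw [hF1.natArr 2 rfl]; simp [assignmentInput])) ?_
  rintro s2 ⟨⟨hM, hT⟩, hF2⟩
  have hc2 := hc1.of_frame hF2 rfl rfl rfl
  refine (writeMatching_runs hc2 ?_).mono le_rfl fun s3 h => ?_
  · rw [hF2.natArr 1 rfl, hF1.natArr 1 rfl]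
    simp [assignmentInput]
  obtain ⟨τ, hτ⟩ := hM.exists_perm
  have ho : output m m s3 = indicator τ := by
    ext i j
    simp [output, indicator, h, ← hτ, Fin.ext_iff]
  rw [ho]
  refine isOptimalAssignment_of_potential τ (fun j => s2.realArr 1 0 j) fun i j => ?_
  have := hT i i.2 j j.2
  rw [hF1.realArr 0 rfl, ← hτ] at this
  simpa [assignmentInput, arrayOf_apply] using this

/-! ### Graph search from a list of seeds -/

/-- Result of a search of the digraph `E` from the seeds `seeds (N - 1), …, seeds 0`, in this order.
A seed that has not been found before becomes one of the roots `roots 0, …, roots (k - 1)`; then all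
new vertices that can be reached from it are found. The label `lab x` is `i + 1` if `x` has been
found from the root `roots i`, and `0` if it has not been found. -/
structure SearchResult {n : ℕ} (E : Fin n → Fin n → Prop) (N k : ℕ) (seeds roots lab : ℕ → ℕ) :
    Prop where
  seed : ∀ p < N, lab (seeds p) ≠ 0
  closed : ∀ x y : Fin n, lab x ≠ 0 → E x y → lab y ≠ 0 ∧ lab y ≤ lab x
  lab_le : ∀ x, lab x ≤ k
  reach : ∀ x : Fin n, lab x ≠ 0 →
    ∃ r : Fin n, roots (lab x - 1) = r ∧ Relation.ReflTransGen E r x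
  root : ∀ i < k, ∃ p < N, seeds p = roots i ∧ lab (roots i) = i + 1 ∧
    ∀ p', p < p' → p' < N → lab (seeds p') ≤ i

/-- State of the search: `v` seeds are left, and `st 0, …, st (sp - 1)` is the stack of found
vertices whose edges have not been examined. Of the vertex `x`, the edges to the vertices below `Y`
have been examined. -/
structure SearchState {n : ℕ} (E : Fin n → Fin n → Prop) (N : ℕ) (seeds : ℕ → ℕ)
    (v sp k x Y : ℕ) (roots lab st : ℕ → ℕ) : Prop where
  seed : ∀ p, v ≤ p → p < N → lab (seeds p) ≠ 0
  closed : ∀ z : Fin n, lab z ≠ 0 → (∃ p < sp, st p = z) ∨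
    ∀ y : Fin n, (z = x → y < Y) → E z y → lab y ≠ 0 ∧ lab y ≤ lab z
  stack : ∀ p < sp, st p < n ∧ lab (st p) = k ∧ k ≠ 0
  lab_le : ∀ z, lab z ≤ k
  reach : ∀ z : Fin n, lab z ≠ 0 →
    ∃ r : Fin n, roots (lab z - 1) = r ∧ Relation.ReflTransGen E r z
  root : ∀ i < k, ∃ p, v ≤ p ∧ p < N ∧ seeds p = roots i ∧ lab (roots i) = i + 1 ∧
    ∀ p', p < p' → p' < N → lab (seeds p') ≤ i

/-- The number of vertices that have not been found. -/
def unlabeled (n : ℕ) (lab : ℕ → ℕ) : ℕ :=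
  ((Finset.range n).filter (lab · = 0)).card

theorem unlabeled_le (n : ℕ) (lab : ℕ → ℕ) : unlabeled n lab ≤ n := by
  simpa [unlabeled] using Finset.card_filter_le (Finset.range n) (lab · = 0)

theorem unlabeled_update {n : ℕ} {lab : ℕ → ℕ} {y k : ℕ} (hy : y < n) (h : lab y = 0)
    (hk : k ≠ 0) : unlabeled n (Function.update lab y k) + 1 = unlabeled n lab := by
  have : (Finset.range n).filter (lab · = 0)
      = insert y ((Finset.range n).filter (Function.update lab y k · = 0)) := by
    ext z
    by_cases e : z = y
    · simp [e, h, hy]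
    · simp [e]
  rw [unlabeled, unlabeled, this, Finset.card_insert_of_notMem (by simp [hk])]

section
variable {n : ℕ} {E : Fin n → Fin n → Prop} {N v sp k x Y : ℕ} {seeds roots lab st : ℕ → ℕ}

theorem SearchState.init (h : ∀ z, lab z = 0) :
    SearchState E N seeds N 0 0 x n roots lab st where
  seed p h1 h2 := by omega
  closed z hz := absurd (h z) hz
  stack p hp := by omega
  lab_le z := (h z).le
  reach z hz := absurd (h z) hz
  root i hi := by omega

theorem SearchState.result (h : SearchState E N seeds 0 0 k x n roots lab st) :
    SearchResult E N k seeds roots lab where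
  seed p hp := h.seed p (Nat.zero_le p) hp
  closed z y hz hE := by
    rcases h.closed z hz with ⟨p, hp, -⟩ | h1
    · omega
    · exact h1 y (fun _ => y.2) hE
  lab_le := h.lab_le
  reach := h.reach
  root i hi := by
    obtain ⟨p, -, hp⟩ := h.root i hi
    exact ⟨p, hp⟩

/-- The vertex at the top of the stack is taken up. -/
theorem SearchState.pop (h : SearchState E N seeds v (sp + 1) k x n roots lab st) :
    SearchState E N seeds v sp k (st sp) 0 roots lab st where
  seed := h.seed
  closed z hz := by
    rcases h.closed z hz with ⟨p, hp, e⟩ | h1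
    · rcases Nat.lt_succ_iff_lt_or_eq.1 hp with h2 | rfl
      · exact .inl ⟨p, h2, e⟩
      · exact .inr fun y hy => absurd (hy e.symm) (Nat.not_lt_zero _)
    · exact .inr fun y _ => h1 y fun _ => y.2
  stack p hp := h.stack p (by omega)
  lab_le := h.lab_le
  reach := h.reach
  root := h.root

/-- The examination of a pair that is no edge, or whose end has been found before. -/
theorem SearchState.skip {y : Fin n} (h : SearchState E N seeds v sp k x y roots lab st)
    (hx : lab x = k) (hy : ∀ z : Fin n, z = x → E z y → lab y ≠ 0) :
    SearchState E N seeds v sp k x (y + 1) roots lab st where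
  seed := h.seed
  closed z hz := by
    rcases h.closed z hz with h1 | h1
    · exact .inl h1
    refine .inr fun y' hy' hE => ?_
    by_cases e : (z : ℕ) = x ∧ y' = y
    · obtain ⟨e1, rfl⟩ := e
      refine ⟨hy z e1 hE, ?_⟩
      rw [e1, hx]
      exact h.lab_le y'
    · refine h1 y' (fun e1 => ?_) hE
      have h2 := hy' e1
      have h3 : (y' : ℕ) ≠ y := fun h4 => e ⟨e1, Fin.ext h4⟩
      omega
  stack := h.stack
  lab_le := h.lab_le
  reach := h.reach
  root := h.root

/-- The examination of an edge to a new vertex. -/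
theorem SearchState.push {z y : Fin n} (h : SearchState E N seeds v sp k z y roots lab st)
    (hk : k ≠ 0) (hz : lab z = k) (hE : E z y) (hy : lab y = 0) :
    SearchState E N seeds v (sp + 1) k z (y + 1) roots (Function.update lab y k)
      (Function.update st sp y) := by
  have hkeep : ∀ w, lab w ≠ 0 → Function.update lab y k w = lab w := by
    intro w hw
    rw [Function.update_of_ne]
    rintro rfl
    exact hw hy
  refine ⟨?_, ?_, ?_, ?_, ?_, ?_⟩
  · intro p h1 h2
    have := h.seed p h1 h2
    rwa [hkeep _ this]
  · intro w hw
    by_cases ewy : w = y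
    · exact .inl ⟨sp, by omega, by simp [ewy]⟩
    have ewy' : (w : ℕ) ≠ y := fun e => ewy (Fin.ext e)
    rw [Function.update_of_ne ewy'] at hw ⊢
    rcases h.closed w hw with ⟨p, hp, e⟩ | h1
    · exact .inl ⟨p, by omega, by rw [Function.update_of_ne hp.ne, e]⟩
    refine .inr fun y' hy' hE' => ?_
    by_cases e : w = z ∧ y' = y
    · obtain ⟨rfl, rfl⟩ := e
      simp [hk, hz]
    · have h2 := h1 y' (fun e1 => ?_) hE'
      · rwa [hkeep _ h2.1]
      · have h3 := hy' e1
        have h4 : (y' : ℕ) ≠ y := fun h4 => e ⟨Fin.ext e1, Fin.ext h4⟩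
        omega
  · intro p hp
    rcases Nat.lt_succ_iff_lt_or_eq.1 hp with h2 | rfl
    · obtain ⟨h3, h4, h5⟩ := h.stack p h2
      rw [Function.update_of_ne h2.ne, hkeep _ (by omega)]
      exact ⟨h3, h4, h5⟩
    · simp [hk]
  · intro w
    rw [Function.update_apply]
    split_ifs
    · exact le_rfl
    · exact h.lab_le w
  · intro w hw
    by_cases ewy : w = y
    · obtain ⟨r, hr, hr'⟩ := h.reach z (by omega)
      refine ⟨r, ?_, ewy ▸ hr'.tail hE⟩
      rw [ewy, Function.update_self, ← hr, hz]
    · have ewy' : (w : ℕ) ≠ y := fun e => ewy (Fin.ext e)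
      rw [Function.update_of_ne ewy'] at hw ⊢
      exact h.reach w hw
  · intro i hi
    obtain ⟨p, h1, h2, h3, h4, h5⟩ := h.root i hi
    refine ⟨p, h1, h2, h3, by rw [hkeep _ (by omega), h4], fun p' h6 h7 => ?_⟩
    rw [hkeep _ (h.seed p' (by omega) h7)]
    exact h5 p' h6 h7

/-- A seed that has been found before. -/
theorem SearchState.skipSeed (h : SearchState E N seeds (v + 1) sp k x Y roots lab st)
    (hl : lab (seeds v) ≠ 0) : SearchState E N seeds v sp k x Y roots lab st where
  seed p h1 h2 := by
    rcases h1.eq_or_lt with rfl | h3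
    · exact hl
    · exact h.seed p h3 h2
  closed := h.closed
  stack := h.stack
  lab_le := h.lab_le
  reach := h.reach
  root i hi := by
    obtain ⟨p, h1, h2⟩ := h.root i hi
    exact ⟨p, by omega, h2⟩

/-- A new seed becomes a root. -/
theorem SearchState.newRoot {r : Fin n} (h : SearchState E N seeds (v + 1) 0 k x n roots lab st)
    (hv : v < N) (hr : seeds v = r) (hl : lab r = 0) :
    SearchState E N seeds v 1 (k + 1) x n (Function.update roots k r)
      (Function.update lab r (k + 1)) (Function.update st 0 r) := by
  have hkeep : ∀ w, lab w ≠ 0 → Function.update lab r (k + 1) w = lab w := by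
    intro w hw
    rw [Function.update_of_ne]
    rintro rfl
    exact hw hl
  refine ⟨?_, ?_, ?_, ?_, ?_, ?_⟩
  · intro p h1 h2
    rcases h1.eq_or_lt with rfl | h3
    · simp [hr]
    · have := h.seed p h3 h2
      rwa [hkeep _ this]
  · intro w hw
    by_cases ew : w = r
    · exact .inl ⟨0, by omega, by simp [ew]⟩
    have ew' : (w : ℕ) ≠ r := fun e => ew (Fin.ext e)
    rw [Function.update_of_ne ew'] at hw ⊢
    rcases h.closed w hw with ⟨p, hp, e⟩ | h1
    · omega
    refine .inr fun y' hy' hE' => ?_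
    have h2 := h1 y' (fun _ => y'.2) hE'
    rwa [hkeep _ h2.1]
  · intro p hp
    obtain rfl : p = 0 := by omega
    simp
  · intro w
    rw [Function.update_apply]
    split_ifs
    · exact le_rfl
    · exact (h.lab_le w).trans (Nat.le_succ k)
  · intro w hw
    by_cases ew : w = r
    · exact ⟨r, by simp [ew], ew ▸ .refl⟩
    · have ew' : (w : ℕ) ≠ r := fun e => ew (Fin.ext e)
      rw [Function.update_of_ne ew'] at hw ⊢
      obtain ⟨r', h1, h2⟩ := h.reach w hw
      refine ⟨r', ?_, h2⟩
      have := h.lab_le w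
      rw [Function.update_of_ne (by omega), h1]
  · intro i hi
    rcases Nat.lt_succ_iff_lt_or_eq.1 hi with h0 | rfl
    · obtain ⟨p, h1, h2, h3, h4, h5⟩ := h.root i h0
      rw [Function.update_of_ne h0.ne]
      refine ⟨p, by omega, h2, h3, by rw [hkeep _ (by omega), h4], fun p' h6 h7 => ?_⟩
      rw [hkeep _ (h.seed p' (by omega) h7)]
      exact h5 p' h6 h7
    · refine ⟨v, le_rfl, hv, by simp [hr], by simp, fun p' h6 h7 => ?_⟩
      have h8 := h.seed p' h6 h7
      rw [hkeep _ h8]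
      exact h.lab_le _

end

section
open Instr

/-- Examination of all edges between the vertex in register `15` and the vertices counted in
register `16`. One of the registers `a` and `b` is `15` and the other one `16`, which determines the
direction of the edges. New vertices get the label in register `14`, in the array `L`, and are put
on the stack, which is the array `6` and has its height in register `13`. -/
def scanVertex (a b L : ℕ) : Program :=
  forLoop 16 1 (natLoad 17 0 a b ;;
    .ite (.natLt 2 17)
      (natLoad 17 L 2 16 ;;
        .ite (.natLt 2 17) (natConst 17 0)
          (natStore L 2 16 14 ;; natStore 6 2 13 16 ;; natAdd 13 13 3))
      (natConst 17 0))

/-- The next seed, which is taken from the array `S`. If it is new, then it is stored as a root in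
the array `R`. Register `12` counts the remaining seeds, and register `14` the roots. -/
def takeSeed (S R L : ℕ) : Program :=
  natSub 12 12 3 ;; natLoad 15 S 2 12 ;; natLoad 17 L 2 15 ;;
    .ite (.natLt 2 17) (natConst 17 0)
      (natStore R 2 14 15 ;; natAdd 14 14 3 ;; natStore L 2 15 14 ;; natStore 6 2 13 15 ;;
        natAdd 13 13 3)

/-- Graph search from the seeds in the array `S`, whose number is in register `12`. -/
def graphSearch (a b S R L : ℕ) : Program :=
  (natConst 13 0 ;; natConst 14 0 ;; natAdd 19 12 13) ;;
  .loop (.natLt 2 19)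
    (.ite (.natLt 2 13)
      ((natSub 13 13 3 ;; natLoad 15 6 2 13) ;; scanVertex a b L)
      (takeSeed S R L) ;;
    natAdd 19 12 13)

end

/-- The array `0` and the registers `a` and `b` of the program `graphSearch` describe the
digraph `E`. -/
def EdgeTest {n : ℕ} (E : Fin n → Fin n → Prop) (M : ℕ → ℕ → ℕ) (a b : ℕ) : Prop :=
  ∀ (x y : Fin n) (s : State), s.natReg 15 = x → s.natReg 16 = y →
    (0 < M (s.natReg a) (s.natReg b) ↔ E x y)

theorem scanVertex_runs {n m : ℕ} {E : Fin n → Fin n → Prop} {a b L : ℕ} (hL0 : L ≠ 0) (hL6 : L ≠ 6)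
    {s : State} (hs : Consts m s) (hn : s.natReg 1 = n) (hE : EdgeTest E (s.natArr 0) a b)
    {N v sp k : ℕ} {seeds roots : ℕ → ℕ} {x : Fin n} (hk : k ≠ 0)
    (h13 : s.natReg 13 = sp) (h14 : s.natReg 14 = k) (h15 : s.natReg 15 = x)
    (hx : s.natArr L 0 x = k)
    (h : SearchState E N seeds v sp k x 0 roots (s.natArr L 0) (s.natArr 6 0)) :
    Runs (scanVertex a b L) s (n * 11 + 2) (fun s' =>
      (SearchState E N seeds v (s'.natReg 13) k x n roots (s'.natArr L 0) (s'.natArr 6 0) ∧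
        2 * unlabeled n (s'.natArr L 0) + s'.natReg 13 ≤
          2 * unlabeled n (s.natArr L 0) + sp) ∧
      Frame (scanVertex a b L) s s') := by
  refine (Runs.forLoop (B := 9) (fun Y s' =>
      SearchState E N seeds v (s'.natReg 13) k x Y roots (s'.natArr L 0) (s'.natArr 6 0) ∧
        s'.natArr L 0 x = k ∧
        2 * unlabeled n (s'.natArr L 0) + s'.natReg 13 ≤
          2 * unlabeled n (s.natArr L 0) + sp) rfl rfl rfl hn hs.one ?_ ?_).mono le_rfl
    fun s' h => ⟨⟨h.1.1, h.1.2.2⟩, h.2⟩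
  · simpa [State.setNat, h13] using ⟨h, hx⟩
  intro Y s' hY ⟨hI, hIx, hU⟩ h16 hF
  have hc := hs.of_frame hF rfl rfl rfl
  have b0 := hF.natArr 0 (by simpa [forLoop, Program.any, Instr.writesNatArr] using hL0)
  have b14 := (hF.natReg 14 rfl).trans h14
  have b15 := (hF.natReg 15 rfl).trans h15
  have hedge := hE x ⟨Y, hY⟩ s' b15 h16
  rw [← b0] at hedge
  have hskip : (E x ⟨Y, hY⟩ → s'.natArr L 0 Y ≠ 0) →
      SearchState E N seeds v (s'.natReg 13) k x (Y + 1) roots (s'.natArr L 0) (s'.natArr 6 0) :=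
    fun hne => hI.skip (y := ⟨Y, hY⟩) hIx fun z hz hEz => hne (Fin.ext hz ▸ hEz)
  refine Runs.of_eval 9 rfl (Nat.le_of_ble_eq_true rfl) ?_
  simp only [Program.eval, Instr.apply, State.setNat, Test.Holds]
  by_cases he : E x ⟨Y, hY⟩
  · by_cases hl : s'.natArr L 0 Y = 0
    · have hp := hI.push (y := ⟨Y, hY⟩) hk hIx he hl
      have hxY : (x : ℕ) ≠ Y := fun e => hk (by rw [← hIx, e, hl])
      have hu := unlabeled_update hY hl hk
      simp [hc.zero, hc.one, h16, b14, hedge.2 he, hl, setEntry_ne, hL6, hL6.symm, hxY, hIx]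
      refine ⟨hp, ?_⟩
      omega
    · have hp := hskip fun _ => hl
      simpa [hc.zero, hc.one, h16, b14, hedge.2 he, hl, Nat.pos_of_ne_zero hl] using
        ⟨hp, hIx, hU⟩
  · have hp := hskip fun h => absurd h he
    have he' : ¬ 0 < s'.natArr 0 (s'.natReg a) (s'.natReg b) := fun h => he (hedge.1 h)
    simpa [hc.zero, hc.one, h16, b14, he'] using ⟨hp, hIx, hU⟩

/-- A search takes `O(n ^ 2)` steps. Labelling a vertex puts it on the stack, so twice the number of
unlabelled vertices plus the size of the stack plus the number of remaining seeds decreases in every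
round; initially it is at most `3 * n`. -/
theorem graphSearch_runs {n m : ℕ} {E : Fin n → Fin n → Prop} {a b S R L : ℕ} (hL0 : L ≠ 0)
    (hL6 : L ≠ 6) (hR0 : R ≠ 0) (hR6 : R ≠ 6) (hS6 : S ≠ 6) (hSR : S ≠ R) (hSL : S ≠ L) (hRL : R ≠ L)
    {s : State} (hs : Consts m s) (hn : s.natReg 1 = n) (hE : EdgeTest E (s.natArr 0) a b)
    {N : ℕ} (hN : s.natReg 12 = N) (hNn : N ≤ n) (hS : ∀ p < N, s.natArr S 0 p < n)
    (hL : ∀ x, s.natArr L 0 x = 0) :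
    Runs (graphSearch a b S R L) s (3 * n * (n * 11 + 16) + 4) (fun s' =>
      SearchResult E N (s'.natReg 14) (s.natArr S 0) (s'.natArr R 0) (s'.natArr L 0) ∧
      Frame (graphSearch a b S R L) s s') := by
  refine Runs.frame ?_
  refine (Runs.seq (Q := fun s' =>
      SearchResult E N (s'.natReg 14) (s.natArr S 0) (s'.natArr R 0) (s'.natArr L 0))
    (R := fun s' => (s'.natReg 13 = 0 ∧ s'.natReg 14 = 0 ∧ s'.natReg 19 = N) ∧
      Frame (Instr.natConst 13 0 ;; Instr.natConst 14 0 ;; Instr.natAdd 19 12 13) s s')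
    (Runs.of_eval 3 rfl le_rfl ?_).frame (B' := 3 * n * ((n * 11 + 15) + 1) + 1) ?_).mono
    (by linarith) fun _ h => h
  · simp [Program.eval, Instr.apply, hN]
  rintro s1 ⟨⟨h13, h14, h19⟩, hF1⟩
  have hc1 := hs.of_frame hF1 rfl rfl rfl
  have a0 := hF1.natArr 0 rfl
  have aS := hF1.natArr S rfl
  have aL := hF1.natArr L rfl
  have a1 := (hF1.natReg 1 rfl).trans hn
  have a12 := (hF1.natReg 12 rfl).trans hN
  refine (Runs.while (B := n * 11 + 15) (fun f s' =>
    s'.natReg 19 = s'.natReg 12 + s'.natReg 13 ∧ s'.natReg 12 ≤ N ∧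
    2 * unlabeled n (s'.natArr L 0) + s'.natReg 13 + s'.natReg 12 ≤ f ∧
    ∃ x, SearchState E N (s.natArr S 0) (s'.natReg 12) (s'.natReg 13) (s'.natReg 14) x n
      (s'.natArr R 0) (s'.natArr L 0) (s'.natArr 6 0)) (k := 3 * n)
    ⟨by rw [h19, a12, h13]; rfl, a12.le, ?_, 0, ?_⟩ ?_).mono le_rfl ?_
  · have := unlabeled_le n (s1.natArr L 0)
    rw [h13, a12]
    omega
  · rw [a12, h13, h14, aL]
    exact .init hL
  · intro f s' ⟨h19', hv, hf, x, hI⟩ hF hb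
    have hc := hc1.of_frame hF rfl rfl rfl
    have b0 := (hF.natArr 0 (by
      simp [forLoop, Program.any, Instr.writesNatArr, scanVertex, takeSeed, hL0, hR0])).trans a0
    have bS := (hF.natArr S (by
      simp [forLoop, Program.any, Instr.writesNatArr, scanVertex, takeSeed, hSL.symm, hSR.symm,
        hS6.symm])).trans aS
    have b1 := (hF.natReg 1 rfl).trans a1
    have hpos : 0 < s'.natReg 12 + s'.natReg 13 := by
      have : s'.natReg 2 < s'.natReg 19 := hb
      rwa [hc.zero, h19'] at this
    refine (Runs.seq (R := fun s2 => s2.natReg 12 ≤ N ∧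
      2 * unlabeled n (s2.natArr L 0) + s2.natReg 13 + s2.natReg 12 < f ∧
      ∃ x, SearchState E N (s.natArr S 0) (s2.natReg 12) (s2.natReg 13) (s2.natReg 14) x n
      (s2.natArr R 0) (s2.natArr L 0) (s2.natArr 6 0)) (B' := 1)
      (Runs.ite (B := n * 11 + 13) ?_ ?_) ?_).mono (by omega) fun _ h => h
    · intro hsp
      obtain ⟨sp, e13⟩ : ∃ sp, s'.natReg 13 = sp + 1 := by
        refine Nat.exists_eq_succ_of_ne_zero ?_
        have : s'.natReg 2 < s'.natReg 13 := hsp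
        omega
      rw [e13] at hI hf
      obtain ⟨hst, hlab, hk⟩ := hI.stack sp (by omega)
      refine (Runs.seq (R := fun s2 => (s2.natReg 13 = sp ∧ s2.natReg 15 = s'.natArr 6 0 sp) ∧
          Frame (Instr.natSub 13 13 3 ;; Instr.natLoad 15 6 2 13) s' s2)
        (Runs.of_eval 2 rfl le_rfl ?_).frame (B' := n * 11 + 2) ?_).mono (by omega) fun _ h => h
      · simp [Program.eval, Instr.apply, e13, hc.one, hc.zero]
      rintro s2 ⟨⟨c13, c15⟩, hF2⟩
      have c0 := (hF2.natArr 0 rfl).trans b0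
      have cL := hF2.natArr L rfl
      have c6 := hF2.natArr 6 rfl
      have cR := hF2.natArr R rfl
      have c1 := (hF2.natReg 1 rfl).trans b1
      have c14 := hF2.natReg 14 rfl
      have c12 := hF2.natReg 12 rfl
      refine (scanVertex_runs (x := ⟨s'.natArr 6 0 sp, hst⟩) hL0 hL6
        (hc.of_frame hF2 rfl rfl rfl) c1 (by rwa [c0]) hk c13 c14 c15 (by rw [cL]; exact hlab)
        (by rw [cL, c6]; exact hI.pop)).mono le_rfl ?_
      rintro s3 ⟨⟨hI3, hU⟩, hF3⟩
      have d12 := (hF3.natReg 12 rfl).trans c12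
      have d14 := (hF3.natReg 14 rfl).trans c14
      have dR := (hF3.natArr R (by
        simp [forLoop, Program.any, Instr.writesNatArr, scanVertex, hRL.symm, hR6.symm])).trans cR
      rw [cL] at hU
      refine ⟨by omega, by omega, s'.natArr 6 0 sp, ?_⟩
      rw [d12, d14, dR]
      exact hI3
    · intro hsp
      have e13 : s'.natReg 13 = 0 := by
        have : ¬ s'.natReg 2 < s'.natReg 13 := hsp
        rw [hc.zero] at this
        omega
      obtain ⟨v, e12⟩ : ∃ v, s'.natReg 12 = v + 1 :=
        Nat.exists_eq_succ_of_ne_zero (by omega)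
      rw [e13, e12] at hI hf
      refine Runs.of_eval _ rfl (by simp [takeSeed, Program.size]) ?_
      simp only [takeSeed, Program.eval, Instr.apply, Test.Holds]
      by_cases hl : s'.natArr L 0 (s.natArr S 0 v) = 0
      · have hr := hS v (by omega)
        have h1 := hI.newRoot (r := ⟨_, hr⟩) (by omega) rfl hl
        have hu := unlabeled_update hr hl (k := s'.natReg 14 + 1) (by omega)
        simp [hc.zero, hc.one, e12, e13, bS, hl, setEntry_ne, hL6, hL6.symm, hR6, hR6.symm, hRL,
          hRL.symm]
        exact ⟨by omega, by omega, _, h1⟩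
      · have h1 := hI.skipSeed hl
        simp [hc.zero, hc.one, e12, e13, bS, Nat.pos_of_ne_zero hl]
        exact ⟨by omega, by omega, _, h1⟩
    · rintro s2 ⟨h1, h2, x', h3⟩
      refine Runs.of_eval 1 rfl le_rfl ?_
      refine ⟨_, h2, ?_⟩
      simpa [Program.eval, Instr.apply] using ⟨h1, x', h3⟩
  · rintro s' ⟨⟨f, h19', hv, hf, x, hI⟩, hb, hF⟩
    have hc := hc1.of_frame hF rfl rfl rfl
    have hz : ¬ s'.natReg 2 < s'.natReg 19 := hb
    rw [hc.zero, h19'] at hz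
    have e13 : s'.natReg 13 = 0 := by omega
    have e12 : s'.natReg 12 = 0 := by omega
    rw [e12, e13] at hI
    refine SearchState.result (x := x) (st := s'.natArr 6 0) hI

/-! ### Parent components from three graph searches -/

theorem SearchResult.of_reach {n N k : ℕ} {E : Fin n → Fin n → Prop} {seeds roots lab : ℕ → ℕ}
    (h : SearchResult E N k seeds roots lab) {x y : Fin n} (hxy : Relation.ReflTransGen E x y)
    (hx : lab x ≠ 0) : lab y ≠ 0 ∧ lab y ≤ lab x := by
  induction hxy with
  | refl => exact ⟨hx, le_rfl⟩
  | tail _ he ih =>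
    have := h.closed _ _ ih.1 he
    exact ⟨this.1, this.2.trans ih.2⟩

theorem SearchResult.root_lt {n N k : ℕ} {E : Fin n → Fin n → Prop} {seeds roots lab : ℕ → ℕ}
    (h : SearchResult E N k seeds roots lab) (hs : ∀ p < N, seeds p < n) {i : ℕ} (hi : i < k) :
    roots i < n := by
  obtain ⟨p, hp, e, -⟩ := h.root i hi
  exact e ▸ hs p hp

theorem SearchResult.root_lab {n N k : ℕ} {E : Fin n → Fin n → Prop} {seeds roots lab : ℕ → ℕ}
    (h : SearchResult E N k seeds roots lab) {i : ℕ} (hi : i < k) : lab (roots i) = i + 1 := by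
  obtain ⟨p, hp, -, e, -⟩ := h.root i hi
  exact e

theorem SearchResult.count_le {n N k : ℕ} {E : Fin n → Fin n → Prop} {seeds roots lab : ℕ → ℕ}
    (h : SearchResult E N k seeds roots lab) (hs : ∀ p < N, seeds p < n) : k ≤ n := by
  let f : Fin k → Fin n := fun i => ⟨roots i, h.root_lt hs i.2⟩
  have hf : Function.Injective f := by
    intro i j e
    have e1 : roots i = roots j := congrArg Fin.val e
    have e2 := h.root_lab i.2
    rw [e1, h.root_lab j.2] at e2
    exact Fin.ext (by omega)
  simpa using Fintype.card_le_of_injective f hf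

section
variable {n k₁ k₂ k₃ : ℕ} {A : Matrix (Fin n) (Fin n) ℕ} {R₀ R₁ R₂ R₃ L₁ L₂ L₃ : ℕ → ℕ}

/-- A backward search from all states puts a root into each parent SCC, since a parent SCC can be
entered backwards only from itself. -/
theorem exists_root_mem (h₁ : SearchResult (fun x y => Edge A y x) n k₁ R₀ R₁ L₁)
    (hR₀ : ∀ p < n, R₀ p = p) {S : Set (Fin n)} (hS : IsParentSCC A S) :
    ∃ b < k₁, ∃ r : Fin n, R₁ b = r ∧ r ∈ S := by
  obtain ⟨x, hx⟩ := hS.nonempty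
  have hlab : L₁ x ≠ 0 := by
    have := h₁.seed x x.2
    rwa [hR₀ x x.2] at this
  obtain ⟨r, hr, hrx⟩ := h₁.reach x hlab
  refine ⟨L₁ x - 1, ?_, r, hr, hS.mem_of_reach hx ?_⟩
  · have := h₁.lab_le x
    omega
  · exact Relation.reflTransGen_swap.1 hrx

/-- A second backward search, from the roots of the first one in reversed order, has its roots in
parent SCCs. Indeed, if the root `r` is in no parent SCC, then a parent SCC can be reached from it.
The root of the first search in that component is later than `r` in the first search (otherwise `r`
would have been found from it), hence earlier in the second search, which finds `r` from it. -/
theorem root_mem_parentSCC (h₁ : SearchResult (fun x y => Edge A y x) n k₁ R₀ R₁ L₁)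
    (hR₀ : ∀ p < n, R₀ p = p) (h₂ : SearchResult (fun x y => Edge A y x) k₁ k₂ R₁ R₂ L₂) {i : ℕ}
    (hi : i < k₂) {r : Fin n} (hr : R₂ i = r) : ∃ S, IsParentSCC A S ∧ r ∈ S := by
  obtain ⟨S, hS, y, hyS, hry⟩ := exists_isParentSCC_reach A r
  refine ⟨S, hS, ?_⟩
  obtain ⟨b, hb, z, hz, hzS⟩ := exists_root_mem h₁ hR₀ hS
  have hrz : Relation.ReflTransGen (fun x y => Edge A y x) z r :=
    Relation.reflTransGen_swap.2 (hry.trans (hS.reach hyS hzS))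
  obtain ⟨a, ha, hseed, hlab, hlater⟩ := h₂.root i hi
  have h3 : L₁ r = a + 1 := by rw [← hr, ← hseed, h₁.root_lab ha]
  have h4 : L₁ z = b + 1 := by rw [← hz, h₁.root_lab hb]
  have h5 := (h₁.of_reach hrz (by omega)).2
  rcases Nat.lt_or_ge a b with h6 | h6
  · have h7 := hlater b h6 hb
    rw [hz] at h7
    have h8 : L₂ z ≠ 0 := by
      rw [← hz]
      exact h₂.seed b hb
    have h9 := (h₂.of_reach hrz h8).2
    rw [hr] at hlab
    omega
  · obtain rfl : a = b := by omega
    have : r = z := Fin.ext (by rw [← hr, ← hseed, hz])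
    exact this ▸ hzS

/-- A forward search from representatives of the parent SCCs labels the parent SCCs. -/
theorem exists_parentEnum (h₁ : SearchResult (fun x y => Edge A y x) n k₁ R₀ R₁ L₁)
    (hR₀ : ∀ p < n, R₀ p = p) (h₂ : SearchResult (fun x y => Edge A y x) k₁ k₂ R₁ R₂ L₂)
    (h₃ : SearchResult (Edge A) k₂ k₃ R₂ R₃ L₃) :
    ∃ P : ParentEnum A k₃, ∀ j x, x ∈ (P j).1 ↔ L₃ x = j + 1 := by
  have hlt₁ : ∀ p < k₁, R₁ p < n := fun p hp =>
    h₁.root_lt (fun p hp => by rw [hR₀ p hp]; exact hp) hp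
  have hlt₂ : ∀ p < k₂, R₂ p < n := fun p hp => h₂.root_lt hlt₁ hp
  have hlt₃ : ∀ p < k₃, R₃ p < n := fun p hp => h₃.root_lt hlt₂ hp
  have hmem : ∀ j : Fin k₃, ∃ S, IsParentSCC A S ∧ (⟨R₃ j, hlt₃ j j.2⟩ : Fin n) ∈ S := by
    intro j
    obtain ⟨p, hp, e, -⟩ := h₃.root j j.2
    exact root_mem_parentSCC h₁ hR₀ h₂ hp e
  choose S hS hrS using hmem
  have hlab : ∀ j x, x ∈ S j ↔ L₃ x = j + 1 := by
    intro j x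
    have hj : L₃ (⟨R₃ j, hlt₃ j j.2⟩ : Fin n) = j + 1 := h₃.root_lab j.2
    constructor
    · intro hx
      obtain ⟨h4, h5⟩ := h₃.of_reach ((hS j).reach (hrS j) hx) (by omega)
      obtain ⟨r, hr, hrx⟩ := h₃.reach x h4
      have hk := h₃.lab_le x
      have h6 : L₃ r = L₃ x := by rw [← hr, h₃.root_lab (by omega)]; omega
      -- The root of `x` is in a parent SCC that contains `x`, so that it is in `S j`.
      have h7 : Reach A x r := by
        have := hrS ⟨L₃ x - 1, by omega⟩
        have h8 : (⟨R₃ (L₃ x - 1), hlt₃ _ (by omega)⟩ : Fin n) = r := Fin.ext hr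
        rw [h8] at this
        exact (hS _).reach ((hS _).mem_of_reach this hrx) this
      have h9 := (h₃.of_reach ((hS j).reach ((hS j).mem_of_reach hx h7) (hrS j)) (by omega)).2
      omega
    · intro hx
      obtain ⟨r, hr, hrx⟩ := h₃.reach x (by omega)
      rw [hx, Nat.add_sub_cancel] at hr
      have h8 : (⟨R₃ j, hlt₃ j j.2⟩ : Fin n) = r := Fin.ext hr
      exact (hS j).mem_of_reach (h8 ▸ hrS j) hrx
  have hinj : Function.Injective fun j => (⟨S j, hS j⟩ : {S // IsParentSCC A S}) := by
    intro j j' e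
    have e1 : S j = S j' := congrArg Subtype.val e
    have h4 := (hlab j' _).1 (e1 ▸ hrS j)
    rw [(hlab j _).1 (hrS j)] at h4
    exact Fin.ext (by omega)
  have hsurj : Function.Surjective fun j => (⟨S j, hS j⟩ : {S // IsParentSCC A S}) := by
    rintro ⟨T, hT⟩
    obtain ⟨b, hb, z, hz, hzT⟩ := exists_root_mem h₁ hR₀ hT
    have h4 : L₂ z ≠ 0 := by
      rw [← hz]
      exact h₂.seed b hb
    obtain ⟨w, hw, hwz⟩ := h₂.reach z h4
    have h5 := h₂.lab_le z
    have hwT : w ∈ T := hT.mem_of_reach hzT (Relation.reflTransGen_swap.1 hwz)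
    have h6 : L₃ w ≠ 0 := by
      rw [← hw]
      exact h₃.seed _ (by omega)
    have h7 := h₃.lab_le w
    refine ⟨⟨L₃ w - 1, by omega⟩, Subtype.ext ?_⟩
    exact (hS _).eq_of_mem hT ((hlab _ w).2 (show L₃ w = L₃ w - 1 + 1 by omega)) hwT
  exact ⟨Equiv.ofBijective _ ⟨hinj, hsurj⟩, hlab⟩

end

/-! ### The sensor selection program -/

section
open Instr

/-- The list of all states, in the array `7`. -/
def listStates : Program :=
  forLoop 16 1 (natStore 7 2 16 16)

/-- The minimal costs for the sensor in register `4` to measure the parent SCCs, which are described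
by the labels in the array `13`, as a row of the real array `3`. A state of minimal cost, plus one,
is stored in the array `14`, where `0` stands for no state. -/
def cheapestRow : Program :=
  forLoop 16 1 (natLoad 17 13 2 16 ;;
    .ite (.natLt 2 17)
      (natSub 17 17 3 ;; realLoad 1 0 4 16 ;; natLoad 18 14 4 17 ;;
        .ite (.natLt 2 18)
          (realLoad 2 3 4 17 ;;
            .ite (.realLt 1 2) (realStore 3 4 17 1 ;; natAdd 18 16 3 ;; natStore 14 4 17 18)
              (natConst 18 0))
          (realStore 3 4 17 1 ;; natAdd 18 16 3 ;; natStore 14 4 17 18))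
      (natConst 18 0))

/-- Output of the selection where each sensor measures a cheapest state of the parent SCC that is
assigned to it. -/
def writeSelection : Program :=
  forLoop 4 0 (natLoad 8 3 2 4 ;; natLoad 17 14 4 8 ;; natSub 17 17 3 ;; natStore 1 4 17 3)

/-- The labels of the parent SCCs, in the array `13`. -/
def labelParents : Program :=
  listStates ;; natAdd 12 1 2 ;; graphSearch 15 16 7 8 9 ;; natAdd 12 14 2 ;;
    graphSearch 15 16 8 10 11 ;; natAdd 12 14 2 ;; graphSearch 16 15 10 12 13

/-- The program for the sensor selection problem. -/
def selectionProgram : Program :=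
  natConst 3 1 ;; labelParents ;; forLoop 4 0 cheapestRow ;; assignRows 3 ;; writeSelection

end

theorem listStates_runs {m n : ℕ} {s : State} (hs : Consts m s) (hn : s.natReg 1 = n) :
    Runs listStates s (n * 3 + 2) (fun s' => (∀ p < n, s'.natArr 7 0 p = p) ∧
      Frame listStates s s') := by
  refine Runs.forLoop (fun k s' => ∀ p < k, s'.natArr 7 0 p = p) rfl rfl rfl hn hs.one
    (by simp) ?_
  intro k s' hk hI hx hF
  have hc := hs.of_frame hF rfl rfl rfl
  refine Runs.of_eval 1 rfl (Nat.le_of_ble_eq_true rfl) ?_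
  intro p hp
  simp only [Program.eval, Instr.apply, State.setNat]
  by_cases e : p = k
  · simp [hc.zero, hx, e]
  · simpa [hc.zero, hx, e] using hI p (by omega)

/-- Among the states below `N` with label `j + 1`, the entry `sig j` is the successor of a state of
least cost `D j`; it is `0` if there are no such states. -/
def CheapestBelow (lab : ℕ → ℕ) (c : ℕ → ℝ) (N : ℕ) (sig : ℕ → ℕ) (D : ℕ → ℝ) : Prop :=
  ∀ j, (sig j = 0 ∧ ∀ l < N, lab l ≠ j + 1) ∨
    ∃ l < N, lab l = j + 1 ∧ sig j = l + 1 ∧ D j = c l ∧ ∀ l' < N, lab l' = j + 1 → c l ≤ c l'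

section
variable {lab : ℕ → ℕ} {c : ℕ → ℝ} {N : ℕ} {sig : ℕ → ℕ} {D : ℕ → ℝ}

theorem CheapestBelow.keep (h : CheapestBelow lab c N sig D)
    (hN : ∀ j, lab N = j + 1 → sig j ≠ 0 ∧ D j ≤ c N) : CheapestBelow lab c (N + 1) sig D := by
  have hlt : ∀ l, l < N + 1 → l < N ∨ l = N := by omega
  intro j
  rcases h j with ⟨h1, h2⟩ | ⟨l, h1, h2, h3, h4, h5⟩
  · refine .inl ⟨h1, fun l hl e => ?_⟩
    rcases hlt l hl with h3 | rfl
    · exact h2 l h3 e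
    · exact (hN j e).1 h1
  · refine .inr ⟨l, by omega, h2, h3, h4, fun l' hl' e => ?_⟩
    rcases hlt l' hl' with h6 | rfl
    · exact h5 l' h6 e
    · exact h4 ▸ (hN j e).2

theorem CheapestBelow.change (h : CheapestBelow lab c N sig D) {j : ℕ} (hj : lab N = j + 1)
    (hN : sig j = 0 ∨ c N ≤ D j) :
    CheapestBelow lab c (N + 1) (Function.update sig j (N + 1)) (Function.update D j (c N)) := by
  have hlt : ∀ l, l < N + 1 → l < N ∨ l = N := by omega
  intro j'
  by_cases e : j' = j
  · subst e
    refine .inr ⟨N, by omega, hj, by simp, by simp, fun l' hl' e' => ?_⟩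
    rcases hlt l' hl' with h6 | rfl
    · rcases h j' with ⟨h1, h2⟩ | ⟨l, h1, h2, h3, h4, h5⟩
      · exact absurd e' (h2 l' h6)
      · have h7 := hN.resolve_left (by omega)
        exact h7.trans (h4 ▸ h5 l' h6 e')
    · exact le_rfl
  · rw [Function.update_of_ne e, Function.update_of_ne e]
    rcases h j' with ⟨h1, h2⟩ | ⟨l, h1, h2, h3, h4, h5⟩
    · refine .inl ⟨h1, fun l hl e' => ?_⟩
      rcases hlt l hl with h3 | rfl
      · exact h2 l h3 e'
      · omega
    · refine .inr ⟨l, by omega, h2, h3, h4, fun l' hl' e' => ?_⟩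
      rcases hlt l' hl' with h6 | rfl
      · exact h5 l' h6 e'
      · omega

end

theorem cheapestRow_runs {m n i : ℕ} {s : State} (hs : Consts m s) (hn : s.natReg 1 = n)
    (hi : s.natReg 4 = i) (h0 : s.natArr 14 i = 0) :
    Runs cheapestRow s (n * 18 + 2) (fun s' =>
      (CheapestBelow (s.natArr 13 0) (s.realArr 0 i) n (s'.natArr 14 i) (s'.realArr 3 i) ∧
        ∀ i', i' ≠ i → s'.natArr 14 i' = s.natArr 14 i' ∧ s'.realArr 3 i' = s.realArr 3 i') ∧
      Frame cheapestRow s s') := by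
  refine Runs.forLoop (B := 16) (fun k s' =>
      CheapestBelow (s.natArr 13 0) (s.realArr 0 i) k (s'.natArr 14 i) (s'.realArr 3 i) ∧
        ∀ i', i' ≠ i → s'.natArr 14 i' = s.natArr 14 i' ∧ s'.realArr 3 i' = s.realArr 3 i')
    rfl rfl rfl hn hs.one ?_ ?_
  · refine ⟨fun j => .inl ⟨?_, by simp⟩, fun i' _ => ⟨rfl, rfl⟩⟩
    simp [State.setNat, h0]
  intro k s' hk ⟨hI, hI'⟩ hx hF
  have hc := hs.of_frame hF rfl rfl rfl
  have b13 := hF.natArr 13 rfl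
  have b0 := hF.realArr 0 rfl
  have bi := (hF.natReg 4 rfl).trans hi
  refine Runs.of_eval 16 rfl (Nat.le_of_ble_eq_true rfl) ?_
  simp only [Program.eval, Instr.apply, State.setNat, Test.Holds]
  rcases Nat.eq_zero_or_pos (s.natArr 13 0 k) with hl | hl
  · have h1 := hI.keep fun j hj => by omega
    simpa [hc.zero, hc.one, hx, b13, hl] using ⟨h1, hI'⟩
  obtain ⟨j, hj⟩ : ∃ j, s.natArr 13 0 k = j + 1 := Nat.exists_eq_succ_of_ne_zero (by omega)
  have hset : s'.natArr 14 i j = 0 ∨ s.realArr 0 i k < s'.realArr 3 i j →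
      CheapestBelow (s.natArr 13 0) (s.realArr 0 i) (k + 1)
        (Function.update (s'.natArr 14 i) j (k + 1))
        (Function.update (s'.realArr 3 i) j (s.realArr 0 i k)) ∧
      ∀ i', i' ≠ i → setEntry s'.natArr 14 i j (k + 1) 14 i' = s.natArr 14 i' ∧
        setEntry s'.realArr 3 i j (s.realArr 0 i k) 3 i' = s.realArr 3 i' := by
    intro h
    refine ⟨hI.change hj (h.imp_right le_of_lt), fun i' hi' => ?_⟩
    rw [setEntry_row_ne _ _ _ _ _ hi', setEntry_row_ne _ _ _ _ _ hi']
    exact hI' i' hi'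
  rcases Nat.eq_zero_or_pos (s'.natArr 14 i j) with hz | hz
  · have h1 := hset (.inl hz)
    simpa [hc.zero, hc.one, hx, b13, b0, bi, hj, hz] using h1
  · by_cases hlt : s.realArr 0 i k < s'.realArr 3 i j
    · have h1 := hset (.inr hlt)
      simpa [hc.zero, hc.one, hx, b13, b0, bi, hj, hz, hlt] using h1
    · have h1 := hI.keep fun j' hj' => by
        obtain rfl : j' = j := by omega
        exact ⟨by omega, not_lt.1 hlt⟩
      simpa [hc.zero, hc.one, hx, b13, b0, bi, hj, hz, hlt] using ⟨h1, hI'⟩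

theorem cheapestRows_runs {m n : ℕ} {s : State} (hs : Consts m s) (hn : s.natReg 1 = n)
    (h0 : s.natArr 14 = 0) :
    Runs (forLoop 4 0 cheapestRow) s (m * (n * 18 + 4) + 2) (fun s' =>
      (∀ i < m, CheapestBelow (s.natArr 13 0) (s.realArr 0 i) n (s'.natArr 14 i)
        (s'.realArr 3 i)) ∧ Frame (forLoop 4 0 cheapestRow) s s') := by
  refine (Runs.forLoop (B := n * 18 + 2) (fun k s' =>
      (∀ i < k, CheapestBelow (s.natArr 13 0) (s.realArr 0 i) n (s'.natArr 14 i)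
        (s'.realArr 3 i)) ∧ ∀ i, k ≤ i → s'.natArr 14 i = 0)
    rfl rfl rfl hs.size hs.one ⟨by simp, by simp [State.setNat, h0]⟩ ?_).mono le_rfl
    fun s' h => ⟨h.1.1, h.2⟩
  intro k s' hk ⟨hI, hI'⟩ hx hF
  have b13 := hF.natArr 13 rfl
  have b0 := hF.realArr 0 rfl
  refine (cheapestRow_runs (hs.of_frame hF rfl rfl rfl) ((hF.natReg 1 rfl).trans hn) hx
    (hI' k le_rfl)).mono le_rfl ?_
  rintro s2 ⟨⟨h1, h2⟩, -⟩
  rw [b13, b0] at h1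
  refine ⟨fun i hi => ?_, fun i hi => ?_⟩
  · by_cases e : i = k
    · exact e ▸ h1
    · have := hI i (by omega)
      rwa [← (h2 i e).1, ← (h2 i e).2] at this
  · exact (h2 i (by omega)).1.trans (hI' i (by omega))

theorem writeSelection_runs {m : ℕ} {s : State} (hs : Consts m s) (h1 : s.natArr 1 = 0) :
    Runs writeSelection s (m * 6 + 2) (fun s' => ∀ i l, s'.natArr 1 i l =
      if i < m ∧ s.natArr 14 i (s.natArr 3 0 i) - 1 = l then 1 else 0) := by
  refine (Runs.forLoop (B := 4) (fun k s' => ∀ i l, s'.natArr 1 i l =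
    if i < k ∧ s.natArr 14 i (s.natArr 3 0 i) - 1 = l then 1 else 0) rfl rfl rfl hs.size hs.one
    (by simp [State.setNat, h1]) ?_).mono le_rfl fun _ h => h.1
  intro k s' hk hI hx hF
  have hc := hs.of_frame hF rfl rfl rfl
  have h3 := hF.natArr 3 rfl
  have h14 := hF.natArr 14 rfl
  refine Runs.of_eval 4 rfl (Nat.le_of_ble_eq_true rfl) ?_
  intro i l
  simp only [Program.eval, Instr.apply, State.setNat]
  by_cases e : i = k
  · subst e
    have := hI i l
    simp only [lt_irrefl, false_and, if_false] at this
    by_cases e2 : s.natArr 14 i (s.natArr 3 0 i) - 1 = l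
    · simp [hc.zero, hc.one, hx, h3, h14, e2]
    · simp [hc.zero, hc.one, hx, h3, h14, e2, this, Ne.symm e2]
  · have e' : i < k + 1 ↔ i < k := by omega
    simpa [hc.zero, hc.one, hx, h3, h14, e', setEntry_row_ne _ _ _ _ _ e] using hI i l

theorem edgeTest_backward {n : ℕ} {A : Matrix (Fin n) (Fin n) ℕ} (h01 : IsZeroOne A) :
    EdgeTest (fun x y => Edge A y x) (arrayOf A 0) 15 16 := by
  intro x y s hx hy
  rw [hx, hy, arrayOf_apply]
  change 0 < _ ↔ _ = 1
  rcases h01 x y with h | h <;> simp [h]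

theorem edgeTest_forward {n : ℕ} {A : Matrix (Fin n) (Fin n) ℕ} (h01 : IsZeroOne A) :
    EdgeTest (Edge A) (arrayOf A 0) 16 15 := by
  intro x y s hx hy
  rw [hx, hy, arrayOf_apply]
  change 0 < _ ↔ _ = 1
  rcases h01 y x with h | h <;> simp [h]

/-- The array `13` is zero outside the parent components and holds the number of the component,
counted from `1`, on them. The number `k` of components is the number of roots found. -/
theorem labelParents_runs {m n : ℕ} {A : Matrix (Fin n) (Fin n) ℕ} (h01 : IsZeroOne A) {s : State}
    (hs : Consts m s) (hn : s.natReg 1 = n) (hA : s.natArr 0 = arrayOf A 0)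
    (h9 : s.natArr 9 = 0) (h11 : s.natArr 11 = 0) (h13 : s.natArr 13 = 0) :
    Runs labelParents s (n * (n * 99 + 147) + 17) (fun s' =>
      (∃ k, ∃ P : ParentEnum A k, ∀ j x, x ∈ (P j).1 ↔ s'.natArr 13 0 (x : Fin n) = j + 1) ∧
      Frame labelParents s s') := by
  refine Runs.frame ?_
  refine (Runs.seq (listStates_runs hs hn) (B' := 1 + ((3 * n * (n * 11 + 16) + 4) + (1 +
    ((3 * n * (n * 11 + 16) + 4) + (1 + (3 * n * (n * 11 + 16) + 4)))))) ?_).mono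
    (by ring_nf; omega) fun _ h => h
  rintro s1 ⟨hR₀, hF1⟩
  have hc1 := hs.of_frame hF1 rfl rfl rfl
  have n1 := (hF1.natReg 1 rfl).trans hn
  have A1 := (hF1.natArr 0 rfl).trans hA
  have u1 := (hF1.natArr 9 rfl).trans h9
  have v1 := (hF1.natArr 11 rfl).trans h11
  have w1 := (hF1.natArr 13 rfl).trans h13
  refine Runs.seq (R := fun s' => s'.natReg 12 = n ∧ Frame (Instr.natAdd 12 1 2) s1 s')
    (Runs.of_eval 1 rfl le_rfl (by simp [Program.eval, Instr.apply, n1, hc1.zero])).frame ?_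
  rintro s2 ⟨h2, hF2⟩
  have hc2 := hc1.of_frame hF2 rfl rfl rfl
  have n2 := (hF2.natReg 1 rfl).trans n1
  have A2 := (hF2.natArr 0 rfl).trans A1
  have u2 := (hF2.natArr 9 rfl).trans u1
  have v2 := (hF2.natArr 11 rfl).trans v1
  have w2 := (hF2.natArr 13 rfl).trans w1
  rw [← hF2.natArr 7 rfl] at hR₀
  have hlt₀ : ∀ p < n, s2.natArr 7 0 p < n := fun p hp => by rwa [hR₀ p hp]
  refine Runs.seq (graphSearch_runs (by norm_num) (by norm_num) (by norm_num) (by norm_num)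
    (by norm_num) (by norm_num) (by norm_num) (by norm_num) hc2 n2
    (A2.symm ▸ edgeTest_backward h01) h2 le_rfl hlt₀ (by simp [u2])) ?_
  rintro s3 ⟨hS1, hF3⟩
  have hc3 := hc2.of_frame hF3 rfl rfl rfl
  have n3 := (hF3.natReg 1 rfl).trans n2
  have A3 := (hF3.natArr 0 rfl).trans A2
  have v3 := (hF3.natArr 11 rfl).trans v2
  have w3 := (hF3.natArr 13 rfl).trans w2
  refine Runs.seq (R := fun s' => s'.natReg 12 = s3.natReg 14 ∧
    Frame (Instr.natAdd 12 14 2) s3 s')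
    (Runs.of_eval 1 rfl le_rfl (by simp [Program.eval, Instr.apply, hc3.zero])).frame ?_
  rintro s4 ⟨h4, hF4⟩
  have hc4 := hc3.of_frame hF4 rfl rfl rfl
  have n4 := (hF4.natReg 1 rfl).trans n3
  have A4 := (hF4.natArr 0 rfl).trans A3
  have v4 := (hF4.natArr 11 rfl).trans v3
  have w4 := (hF4.natArr 13 rfl).trans w3
  rw [← hF4.natArr 8 rfl] at hS1
  have hlt₁ : ∀ p < s3.natReg 14, s4.natArr 8 0 p < n := fun p hp => hS1.root_lt hlt₀ hp
  refine Runs.seq (graphSearch_runs (by norm_num) (by norm_num) (by norm_num) (by norm_num)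
    (by norm_num) (by norm_num) (by norm_num) (by norm_num) hc4 n4
    (A4.symm ▸ edgeTest_backward h01) h4 (hS1.count_le hlt₀) hlt₁ (by simp [v4])) ?_
  rintro s5 ⟨hS2, hF5⟩
  have hc5 := hc4.of_frame hF5 rfl rfl rfl
  have n5 := (hF5.natReg 1 rfl).trans n4
  have A5 := (hF5.natArr 0 rfl).trans A4
  have w5 := (hF5.natArr 13 rfl).trans w4
  refine Runs.seq (R := fun s' => s'.natReg 12 = s5.natReg 14 ∧
    Frame (Instr.natAdd 12 14 2) s5 s')
    (Runs.of_eval 1 rfl le_rfl (by simp [Program.eval, Instr.apply, hc5.zero])).frame ?_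
  rintro s6 ⟨h6, hF6⟩
  have hc6 := hc5.of_frame hF6 rfl rfl rfl
  have n6 := (hF6.natReg 1 rfl).trans n5
  have A6 := (hF6.natArr 0 rfl).trans A5
  have w6 := (hF6.natArr 13 rfl).trans w5
  rw [← hF6.natArr 10 rfl] at hS2
  refine (graphSearch_runs (by norm_num) (by norm_num) (by norm_num) (by norm_num)
    (by norm_num) (by norm_num) (by norm_num) (by norm_num) hc6 n6
    (A6.symm ▸ edgeTest_forward h01) h6 (hS2.count_le hlt₁)
    (fun p hp => hS2.root_lt hlt₁ hp) (by simp [w6])).mono le_rfl ?_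
  rintro s7 ⟨hS3, -⟩
  exact ⟨_, exists_parentEnum hS1 hR₀ hS2 hS3⟩

theorem ParentEnum.card_eq {n m k : ℕ} {A : Matrix (Fin n) (Fin n) ℕ} (P : ParentEnum A m)
    (P' : ParentEnum A k) : m = k :=
  Fin.equiv_iff_eq.1 ⟨P.trans P'.symm⟩

/-- The computed potentials certify that the matching is an optimal assignment for the costs
`sccCost c P`, where `P` is the numbering of the components found by the graph searches; the written
selection measures the corresponding cheapest states. -/
theorem selectionProgram_runs {m n : ℕ} {A : Matrix (Fin n) (Fin n) ℕ} (h01 : IsZeroOne A)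
    (hA : StructurallyCyclic A) (hm : Nonempty (ParentEnum A m)) (c : Matrix (Fin m) (Fin n) ℝ) :
    Runs selectionProgram (selectionInput A c) (1000 * (n ^ 2 + m ^ 3 + 1))
      (fun s => IsOptimalSelection A c (output m n s)) := by
  refine (Runs.seq (R := fun s' => s'.natReg 3 = 1 ∧
      Frame (Instr.natConst 3 1) (selectionInput A c) s')
    (Runs.of_eval 1 rfl le_rfl ?_).frame
    (B' := (n * (n * 99 + 147) + 17) + ((m * (n * 18 + 4) + 2) +
      ((m * (m * (m * 24 + 41) + 11) + 2) + (m * 6 + 2)))) ?_).mono ?_ fun _ h => h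
  · simp [Program.eval, Instr.apply]
  swap
  -- The term `m * n` from the search for cheapest states is at most `n ^ 2 + m ^ 2`.
  · have h1 : m ≤ m ^ 3 := Nat.le_self_pow (by norm_num) m
    have h2 : m ^ 2 ≤ m ^ 3 := by
      rcases Nat.eq_zero_or_pos m with rfl | h
      · simp
      · exact Nat.pow_le_pow_right h (by norm_num)
    have h3 : n ≤ n ^ 2 := Nat.le_self_pow (by norm_num) n
    have h4 : m * n ≤ n ^ 2 + m ^ 2 := by
      rcases le_total m n with h | h
      · have := Nat.mul_le_mul_right n h
        nlinarith
      · have := Nat.mul_le_mul_left m h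
        nlinarith
    nlinarith
  rintro s1 ⟨h3, hF1⟩
  have hc1 : Consts m s1 := ⟨by rw [hF1.natReg 0 rfl]; simp [selectionInput],
    by rw [hF1.natReg 2 rfl]; simp [selectionInput], h3⟩
  have n1 : s1.natReg 1 = n := by rw [hF1.natReg 1 rfl]; simp [selectionInput]
  have hz : ∀ b, b ≠ 0 → s1.natArr b = 0 := by
    intro b hb
    rw [hF1.natArr b rfl]
    funext i j
    simp [selectionInput, arrayOf, hb]
  refine Runs.seq (labelParents_runs h01 hc1 n1 (hF1.natArr 0 rfl) (hz 9 (by norm_num))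
    (hz 11 (by norm_num)) (hz 13 (by norm_num))) ?_
  rintro s2 ⟨⟨k, P, hP⟩, hF2⟩
  obtain rfl : m = k := hm.some.card_eq P
  have hc2 := hc1.of_frame hF2 rfl rfl rfl
  have n2 := (hF2.natReg 1 rfl).trans n1
  refine Runs.seq (cheapestRows_runs hc2 n2
    ((hF2.natArr 14 rfl).trans (hz 14 (by norm_num)))) ?_
  rintro s3 ⟨hch, hF3⟩
  have hc3 := hc2.of_frame hF3 rfl rfl rfl
  refine Runs.seq (assignRows_runs (by norm_num) (by norm_num) hc3 (by
    rw [hF3.natArr 2 rfl, hF2.natArr 2 rfl, hz 2 (by norm_num)]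
    simp)) ?_
  rintro s4 ⟨⟨hM, hT⟩, hF4⟩
  have hc4 := hc3.of_frame hF4 rfl rfl rfl
  refine (writeSelection_runs hc4 ?_).mono le_rfl fun s5 h5 => ?_
  · rw [hF4.natArr 1 rfl, hF3.natArr 1 rfl, hF2.natArr 1 rfl, hz 1 (by norm_num)]
  rw [hF4.natArr 14 rfl] at h5
  obtain ⟨τ, hτ⟩ := hM.exists_perm
  have hcost : ∀ (i : Fin m) (x : Fin n), s2.realArr 0 i x = c i x := by
    intro i x
    rw [hF2.realArr 0 rfl, hF1.realArr 0 rfl]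
    simp [selectionInput, arrayOf_apply]
  have hσ : ∀ i j : Fin m, ∃ x : Fin n, s3.natArr 14 i j = x + 1 ∧ s3.realArr 3 i j = c i x ∧
      x ∈ (P j).1 ∧ ∀ l ∈ (P j).1, c i x ≤ c i l := by
    intro i j
    rcases hch i i.2 j with ⟨-, h⟩ | ⟨l, hl, h6, h7, h8, h9⟩
    · obtain ⟨x, hx⟩ := (P j).2.nonempty
      exact absurd ((hP j x).1 hx) (h x x.2)
    · refine ⟨⟨l, hl⟩, h7, by rw [h8, ← hcost], (hP j _).2 h6, fun l' hl' => ?_⟩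
      have := h9 l' l'.2 ((hP j l').1 hl')
      rwa [hcost i l', hcost i ⟨l, hl⟩] at this
  choose σ hσ1 hσ2 hσ3 hσ4 using hσ
  have hcheap : IsCheapest c P σ := fun i j => ⟨hσ3 i j, hσ4 i j⟩
  have ho : output m n s5 = selectionOf σ (indicator τ) := by
    rw [selectionOf_indicator]
    ext i l
    simp [output, indicator, h5, ← hτ, hσ1, Fin.ext_iff]
  rw [ho]
  refine (isOptimalAssignment_iff_selectionOf hA hcheap (isAssignment_iff.2 ⟨τ, rfl⟩)).1 ?_
  refine isOptimalAssignment_of_potential τ (fun j => s4.realArr 1 0 j) fun i j => ?_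
  have := hT i i.2 j j.2
  rwa [← hτ, hσ2, hσ2, ← hcheap.sccCost_eq, ← hcheap.sccCost_eq] at this

end SensorSelection

open SensorSelection in
theorem mainTheorem1 :
    -- equivalence of the two problems
    (∀ (n m : ℕ) (A : Matrix (Fin n) (Fin n) ℕ), IsZeroOne A → StructurallyCyclic A →
      ∀ (c : Matrix (Fin m) (Fin n) ℝ) (P : ParentEnum A m),
        -- a feasible selection induces a feasible assignment that is not more expensive
        (∀ H, IsSelection A H →
          IsAssignment (assignmentOf P H) ∧
          totalCost (sccCost c P) (assignmentOf P H) ≤ totalCost c H) ∧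
        -- a feasible assignment, with cheapest states, induces a feasible selection of equal cost
        (∀ σ, IsCheapest c P σ → ∀ Z, IsAssignment Z →
          IsSelection A (selectionOf σ Z) ∧
          assignmentOf P (selectionOf σ Z) = Z ∧
          totalCost c (selectionOf σ Z) = totalCost (sccCost c P) Z) ∧
        -- both minima exist and are equal
        (∃ v : ℝ, IsLeast (totalCost c '' {H | IsSelection A H}) v ∧
          IsLeast (totalCost (sccCost c P) '' {Z | IsAssignment Z}) v) ∧
        -- optimal selections and optimal assignments correspond to each other
        (∀ H, IsOptimalSelection A c H ↔
          IsSelection A H ∧ IsOptimalAssignment (sccCost c P) (assignmentOf P H) ∧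
          totalCost c H = totalCost (sccCost c P) (assignmentOf P H)) ∧
        (∀ σ, IsCheapest c P σ → ∀ Z, IsAssignment Z →
          (IsOptimalAssignment (sccCost c P) Z ↔ IsOptimalSelection A c (selectionOf σ Z)))) ∧
    -- the assignment problem is solved in `O(m ^ 3)` steps
    (∃ (p : Program) (K : ℕ), ∀ (m : ℕ) (C : Matrix (Fin m) (Fin m) ℝ),
      ∃ (t : ℕ) (s : State), Exec p (assignmentInput C) t s ∧ t ≤ K * (m ^ 3 + 1) ∧
        IsOptimalAssignment C (output m m s)) ∧
    -- the sensor selection problem is solved in `O(n ^ 2 + m ^ 3)` steps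
    (∃ (p : Program) (K : ℕ), ∀ (n m : ℕ) (A : Matrix (Fin n) (Fin n) ℕ),
      IsZeroOne A → StructurallyCyclic A → Nonempty (ParentEnum A m) →
      ∀ c : Matrix (Fin m) (Fin n) ℝ,
        ∃ (t : ℕ) (s : State), Exec p (selectionInput A c) t s ∧ t ≤ K * (n ^ 2 + m ^ 3 + 1) ∧
          IsOptimalSelection A c (output m n s)) := by
  refine ⟨fun n m A _ hA c P => ⟨?_, ?_, ?_, ?_, ?_⟩, ⟨assignmentProgram, 1000, ?_⟩,
    ⟨selectionProgram, 1000, ?_⟩⟩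
  · exact fun H hH => isAssignment_assignmentOf hA c P hH
  · exact fun σ hσ Z hZ => isSelection_selectionOf hA hσ hZ
  · exact exists_isLeast_totalCost hA c P
  · exact isOptimalSelection_iff hA c P
  · exact fun σ hσ Z hZ => isOptimalAssignment_iff_selectionOf hA hσ hZ
  · exact fun m C => assignmentProgram_runs C
  · exact fun n m A h01 hA hm c => selectionProgram_runs h01 hA hm c
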